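/- Let $K$ be a number field with ring of integers $\mathcal{O}_K$, let $n\ge 0$ and $\delta\ge 1$ be integers, and let $f=\sum_{i_0+\cdots+i_n=\delta} a_{i_0,\ldots,i_n}T_0^{i_0}\cdots T_n^{i_n}\in K[T_0,\ldots,T_n]$ be a nonzero homogeneous polynomial of degree $\delta$. Assume that the hypersurface $X=\operatorname{Proj}\bigl(K[T_0,\ldots,T_n]/(f)\bigr)\subset\mathbb{P}^n_K$ is reduced, and let $\mathscr{X}$ be the Zariski closure of $X$ in $\mathbb{P}^n_{\mathcal{O}_K}$ (the scheme-theoretic image of $X\to\mathbb{P}^n_K\to\mathbb{P}^n_{\mathcal{O}_K}$). Define the classical height of $X$ by $$h(X)=\sum_{v}\frac{[K_v:\mathbb{Q}_v]}{[K:\mathbb{Q}]}\log\max_{i_0+\cdots+i_n=\delta}|a_{i_0,\ldots,i_n}|_v,$$ where $v$ runs over all places of $K$ and $|\cdot|_v$ extends the usual absolute value of $\mathbb{Q}$ below $v$. For a maximal ideal $\mathfrak{p}$ of $\mathcal{O}_K$ put $N_{\mathfrak{p}}=\#(\mathcal{O}_K/\mathfrak{p})$ and $\mathbb{F}_{\mathfrak{p}}=\mathcal{O}_K/\mathfrak{p}$.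 Then for every real number $N_0\ge 2$ the set of maximal ideals $\mathfrak{p}$ of $\mathcal{O}_K$ such that $N_{\mathfrak{p}}>N_0$ and $\mathscr{X}\times_{\operatorname{Spec}\mathcal{O}_K}\operatorname{Spec}\mathbb{F}_{\mathfrak{p}}$ is not reduced is finite, and its cardinality is at most $$\frac{[K:\mathbb{Q}]}{\log N_0}\left((2\delta-1)\,h(X)+\delta\log\delta+\frac{2\delta-1}{2}\log\binom{n+\delta}{\delta}\right).$$ -/

import Mathlib

open AlgebraicGeometry CategoryTheory CategoryTheory.Limits NumberField

namespace ReducedReduction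

noncomputable section

universe u

/-! ### The grading of a quotient by a homogeneous ideal -/

section QuotientGrading

variable {R A : Type*} [CommRing R] [CommRing A] [Algebra R A]

/-- The grading of `A ⧸ I` whose `i`-th piece is the image of the `i`-th piece of `A`. -/
def quotGrading (𝒜 : ℕ → Submodule R A) (I : Ideal A) (i : ℕ) : Submodule R (A ⧸ I) :=
  (𝒜 i).map (Ideal.Quotient.mkₐ R I).toLinearMap

variable (𝒜 : ℕ → Submodule R A) (I : Ideal A)

theorem mk_mem_quotGrading {i : ℕ} {a : A} (ha : a ∈ 𝒜 i) :
    Ideal.Quotient.mk I a ∈ quotGrading 𝒜 I i :=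
  ⟨a, ha, rfl⟩

/-- The quotient map on the `i`-th pieces. -/
def quotPiece (i : ℕ) : 𝒜 i →+ quotGrading 𝒜 I i where
  toFun a := ⟨Ideal.Quotient.mk I a, mk_mem_quotGrading 𝒜 I a.2⟩
  map_zero' := by ext; simp
  map_add' a b := by ext; simp

variable [GradedAlgebra 𝒜]

/-- `a ↦` the classes of the homogeneous components of `a`. -/
def quotComponents : A →+ DirectSum ℕ (fun i => quotGrading 𝒜 I i) :=
  (DirectSum.map (quotPiece 𝒜 I)).comp (DirectSum.decomposeAddEquiv 𝒜).toAddMonoidHom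

theorem quotComponents_of_mem {i : ℕ} {a : A} (ha : a ∈ 𝒜 i) :
    quotComponents 𝒜 I a =
      DirectSum.of (fun i => quotGrading 𝒜 I i) i
        ⟨Ideal.Quotient.mk I a, mk_mem_quotGrading 𝒜 I ha⟩ := by
  simp only [quotComponents, AddMonoidHom.comp_apply]
  change DirectSum.map (quotPiece 𝒜 I) (DirectSum.decompose 𝒜 a) = _
  rw [DirectSum.decompose_of_mem 𝒜 ha, DirectSum.map_of]
  rfl

theorem quotComponents_eq_zero (hI : I.IsHomogeneous 𝒜) {a : A} (ha : a ∈ I) :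
    quotComponents 𝒜 I a = 0 := by
  refine DFinsupp.ext fun i => Subtype.ext ?_
  exact Ideal.Quotient.eq_zero_iff_mem.mpr (hI i ha)

/-- The decomposition of an element of `A ⧸ I` into its homogeneous components. -/
def quotDecompose (hI : I.IsHomogeneous 𝒜) :
    A ⧸ I →+ DirectSum ℕ (fun i => quotGrading 𝒜 I i) :=
  QuotientAddGroup.lift I.toAddSubgroup (quotComponents 𝒜 I)
    (fun _ ha => AddMonoidHom.mem_ker.mpr (quotComponents_eq_zero 𝒜 I hI ha))

theorem quotDecompose_mk (hI : I.IsHomogeneous 𝒜) (a : A) :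
    quotDecompose 𝒜 I hI (Ideal.Quotient.mk I a) = quotComponents 𝒜 I a :=
  rfl

/-- The quotient of a graded algebra by a homogeneous ideal is graded. -/
@[reducible]
def quotGradedAlgebra (hI : I.IsHomogeneous 𝒜) : GradedAlgebra (quotGrading 𝒜 I) where
  one_mem := mk_mem_quotGrading 𝒜 I (SetLike.GradedOne.one_mem (A := 𝒜))
  mul_mem := by
    rintro i j _ _ ⟨a, ha, rfl⟩ ⟨b, hb, rfl⟩
    exact ⟨a * b, SetLike.GradedMul.mul_mem ha hb, map_mul (Ideal.Quotient.mk I) a b⟩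
  toDecomposition := DirectSum.Decomposition.ofAddHom (quotGrading 𝒜 I) (quotDecompose 𝒜 I hI)
    (by
      ext x
      obtain ⟨a, rfl⟩ := Ideal.Quotient.mk_surjective x
      rw [AddMonoidHom.comp_apply, quotDecompose_mk, AddMonoidHom.id_apply]
      induction a using DirectSum.Decomposition.inductionOn 𝒜 with
      | zero => simp
      | homogeneous a => rw [quotComponents_of_mem 𝒜 I a.2, DirectSum.coeAddMonoidHom_of]
      | add a b ha hb => rw [map_add, map_add, ha, hb, map_add])
    (by
      refine DirectSum.addHom_ext fun i y => ?_
      obtain ⟨x, a, ha, rfl⟩ := y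
      rw [AddMonoidHom.comp_apply, DirectSum.coeAddMonoidHom_of]
      exact quotComponents_of_mem 𝒜 I ha)

end QuotientGrading

/-! ### Projective space, hypersurfaces and their Zariski closure -/

attribute [local instance] MvPolynomial.gradedAlgebra

/-- The standard grading of `R[T₀, …, Tₙ]`. -/
abbrev polyGrading (n : ℕ) (R : Type u) [CommRing R] :
    ℕ → Submodule R (MvPolynomial (Fin (n + 1)) R) :=
  MvPolynomial.homogeneousSubmodule (Fin (n + 1)) R

/-- Projective space `ℙⁿ_R = Proj R[T₀, …, Tₙ]`. -/
def projSpace (n : ℕ) (R : Type u) [CommRing R] : Scheme.{u} :=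
  Proj (polyGrading n R)

/-- The structure morphism `ℙⁿ_R ⟶ Spec R`. -/
def projSpaceToSpec (n : ℕ) (R : Type u) [CommRing R] :
    projSpace n R ⟶ Spec (CommRingCat.of R) :=
  Proj.toSpecZero (polyGrading n R) ≫
    Spec.map (CommRingCat.ofHom (algebraMap R (polyGrading n R 0)))

/-- The graded ring homomorphism `R[T₀, …, Tₙ] → S[T₀, …, Tₙ]` of an `R`-algebra `S`. -/
def polyGradedHom (n : ℕ) (R S : Type u) [CommRing R] [CommRing S] [Algebra R S] :
    GradedRingHom (polyGrading n R) (polyGrading n S) where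
  toRingHom := MvPolynomial.map (algebraMap R S)
  map_mem h := MvPolynomial.IsHomogeneous.map h _

open HomogeneousIdeal in
theorem irrelevant_le_map_polyGradedHom (n : ℕ) (R S : Type u) [CommRing R] [CommRing S]
    [Algebra R S] :
    irrelevant (polyGrading n S) ≤ (irrelevant (polyGrading n R)).map (polyGradedHom n R S) := by
  rw [irrelevant_le]
  intro i hi p hp
  have hp' : MvPolynomial.IsHomogeneous p i := hp
  change p ∈ ((irrelevant (polyGrading n R)).map (polyGradedHom n R S)).toIdeal
  rw [p.as_sum]
  refine Ideal.sum_mem _ fun d hd => ?_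
  have hdeg : d.degree = i := by
    by_contra h
    exact (MvPolynomial.mem_support_iff.mp hd) (hp'.coeff_eq_zero h)
  have hd0 : d ≠ 0 := by
    rintro rfl
    simp at hdeg
    omega
  obtain ⟨j, hj⟩ := Finsupp.ne_iff.mp hd0
  have hX : (MvPolynomial.X j : MvPolynomial (Fin (n + 1)) S) ∈
      ((irrelevant (polyGrading n R)).map (polyGradedHom n R S)).toIdeal := by
    have h1 : (MvPolynomial.X j : MvPolynomial (Fin (n + 1)) R) ∈
        (irrelevant (polyGrading n R)).toIdeal :=
      mem_irrelevant_of_mem (polyGrading n R) (i := 1) one_pos (MvPolynomial.isHomogeneous_X R j)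
    have h2 := Ideal.mem_map_of_mem (polyGradedHom n R S) h1
    have h3 : (polyGradedHom n R S) (MvPolynomial.X j) = MvPolynomial.X j :=
      MvPolynomial.map_X (algebraMap R S) j
    rw [h3] at h2
    exact h2
  refine Ideal.mem_of_dvd _ ?_ hX
  rw [MvPolynomial.X_dvd_monomial]
  exact Or.inr hj

/-- The canonical morphism `ℙⁿ_S ⟶ ℙⁿ_R` of an `R`-algebra `S`. -/
def projSpaceMap (n : ℕ) (R S : Type u) [CommRing R] [CommRing S] [Algebra R S] :
    projSpace n S ⟶ projSpace n R :=
  Proj.map (polyGradedHom n R S) (irrelevant_le_map_polyGradedHom n R S)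

section Hypersurface

variable {n : ℕ} {K : Type u} [Field K]

/-- The grading of `K[T₀, …, Tₙ] / (f)` induced by the degree. -/
abbrev coordGrading (f : MvPolynomial (Fin (n + 1)) K) :
    ℕ → Submodule K (MvPolynomial (Fin (n + 1)) K ⧸ Ideal.span {f}) :=
  quotGrading (polyGrading n K) (Ideal.span {f})

/-- `K[T₀, …, Tₙ] / (f)` is graded when `f` is homogeneous. -/
@[reducible]
def coordGradedAlgebra {δ : ℕ} {f : MvPolynomial (Fin (n + 1)) K} (hf : f.IsHomogeneous δ) :
    GradedAlgebra (coordGrading f) :=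
  quotGradedAlgebra (polyGrading n K) (Ideal.span {f})
    (Ideal.homogeneous_span (polyGrading n K) {f} (by
      intro x hx
      rw [Set.mem_singleton_iff.mp hx]
      exact ⟨δ, hf⟩))

/-- The hypersurface `X = Proj (K[T₀, …, Tₙ] / (f))` of a homogeneous polynomial `f`. -/
def hypersurface {δ : ℕ} {f : MvPolynomial (Fin (n + 1)) K} (hf : f.IsHomogeneous δ) :
    Scheme.{u} :=
  letI := coordGradedAlgebra hf
  Proj (coordGrading f)

/-- The graded quotient map `K[T₀, …, Tₙ] → K[T₀, …, Tₙ] / (f)`. -/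
def coordGradedHom (f : MvPolynomial (Fin (n + 1)) K) :
    GradedRingHom (polyGrading n K) (coordGrading f) where
  toRingHom := Ideal.Quotient.mk (Ideal.span {f})
  map_mem h := mk_mem_quotGrading (polyGrading n K) _ h

open HomogeneousIdeal in
theorem irrelevant_le_map_coordGradedHom {δ : ℕ} {f : MvPolynomial (Fin (n + 1)) K}
    (hf : f.IsHomogeneous δ) :
    letI := coordGradedAlgebra hf
    irrelevant (coordGrading f) ≤ (irrelevant (polyGrading n K)).map (coordGradedHom f) := by
  let := coordGradedAlgebra hf
  rw [irrelevant_le]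
  rintro i hi _ ⟨a, ha, rfl⟩
  have h1 : a ∈ (irrelevant (polyGrading n K)).toIdeal :=
    mem_irrelevant_of_mem (polyGrading n K) hi ha
  exact Ideal.mem_map_of_mem (coordGradedHom f) h1

/-- The closed embedding `X ⟶ ℙⁿ_K`. -/
def hypersurfaceι {δ : ℕ} {f : MvPolynomial (Fin (n + 1)) K} (hf : f.IsHomogeneous δ) :
    hypersurface hf ⟶ projSpace n K :=
  letI := coordGradedAlgebra hf
  Proj.map (coordGradedHom f) (irrelevant_le_map_coordGradedHom hf)

/-- The Zariski closure of `X` in `ℙⁿ_{𝓞 K}`: the scheme-theoretic image of the composite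
`X ⟶ ℙⁿ_K ⟶ ℙⁿ_{𝓞 K}`. -/
def zariskiClosure {δ : ℕ} {f : MvPolynomial (Fin (n + 1)) K} (hf : f.IsHomogeneous δ) :
    Scheme.{u} :=
  (hypersurfaceι hf ≫ projSpaceMap n (𝓞 K) K).image

/-- The structure morphism of the Zariski closure over `Spec (𝓞 K)`. -/
def zariskiClosureToSpec {δ : ℕ} {f : MvPolynomial (Fin (n + 1)) K} (hf : f.IsHomogeneous δ) :
    zariskiClosure hf ⟶ Spec (CommRingCat.of (𝓞 K)) :=
  (hypersurfaceι hf ≫ projSpaceMap n (𝓞 K) K).imageι ≫ projSpaceToSpec n (𝓞 K)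

/-- The reduction modulo `𝔭` of the Zariski closure, that is its base change along
`Spec (𝓞 K ⧸ 𝔭) ⟶ Spec (𝓞 K)`. -/
def reduction {δ : ℕ} {f : MvPolynomial (Fin (n + 1)) K} (hf : f.IsHomogeneous δ)
    (𝔭 : Ideal (𝓞 K)) : Scheme.{u} :=
  pullback (zariskiClosureToSpec hf)
    (Spec.map (CommRingCat.ofHom (Ideal.Quotient.mk 𝔭)))

/-- The set of the maximal ideals `𝔭` of `𝓞 K` with `N_𝔭 > N₀` at which the reduction of the
Zariski closure of `X` is not reduced. -/
def nonReducedPlaces {δ : ℕ} {f : MvPolynomial (Fin (n + 1)) K} (hf : f.IsHomogeneous δ)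
    (N₀ : ℝ) : Set (MaximalSpectrum (𝓞 K)) :=
  {𝔭 | N₀ < (Nat.card (𝓞 K ⧸ 𝔭.asIdeal) : ℝ) ∧ ¬ IsReduced (reduction hf 𝔭.asIdeal)}

/-- The classical height of (the hypersurface defined by) a nonzero polynomial `f`:
`∑_v [K_v : ℚ_v] / [K : ℚ] * log (max |coefficients of f|_v)`, where `|·|_v` extends the usual
absolute value of `ℚ`. Mathlib's `Height.logHeight` over a number field is the sum over the
places `v` of `[K_v : ℚ_v] * log (max |·|_v)`, see `NumberField.mulHeight_eq`. -/
def classicalHeight [NumberField K] (f : MvPolynomial (Fin (n + 1)) K) : ℝ :=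
  Height.logHeight (fun m : f.support => f.coeff m) / (Module.finrank ℚ K : ℝ)

end Hypersurface

end

end ReducedReduction

/-!
# Places of nonreduced reduction of a hypersurface

Let `F` be the dehomogenisation of `f` with respect to a suitable variable, a polynomial in
`s + 1 = n` variables of degree `N ∈ {δ - 1, δ}`.

*Geometry.* In an affine chart, the Zariski closure is defined by the polynomials with integral
coefficients that are multiples of the dehomogenised equation over `K`
(`closureMap_app_eq_zero_iff`). By Gauss's lemma, its reduction modulo `p` is defined by the
reduction of the equation, normalised so that its coefficients generate the unit ideal locally at
`p` (`isRadical_comap_span_sup`). If the reduction is not reduced, then the normalised equation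
modulo `p` is divisible by the square of a nonconstant form, and either `F` is congruent to a
multiple of the square of a nonconstant polynomial (`IntVal.NearSquare`), or its degree drops modulo
`p` (`IntVal.TopSmall`); see `topSmall_or_nearSquare`. On the other hand, as `X` is reduced, `F` has
no nonconstant square factor (`exists_eq_C_of_sq_dvd`).

*Arithmetic.* If `F` is a polynomial in one variable, then the resultant of `F` and its derivative
is a nonzero element of `K` whose valuation at each bad place exceeds the obvious lower bound. The
product formula, combined with Hadamard's inequality at the complex places, bounds the number of bad
places. Several variables are treated without a discriminant in several variables, whose degree
would be too large: the first variable is moved to the coefficients, and the one-variable argument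
is carried out over a polynomial ring instead of `K`. For this purpose a `HeightData` on a domain
is a family of discrete valuations and a measured family of complex places which satisfy the
product inequality. It extends to polynomial rings by the Gauss extensions of the valuations and
by integration over the unit circle (`HeightData.poly`). Parseval's identity and Jensen's
inequality for the logarithm keep the bounds for the coefficients (`ArchData.Bound.split`). The
prime divisors of a coefficient of largest degree give further discrete places
(`HeightData.adjoin`): at these places, the product inequality of the polynomial ring has a
defect, which serves as their weight. When a variable is moved to the coefficients, a bad place
may cease to be bad. This loss is compensated (`StepData.exists_le_add_gain`) by the valuations of
the resultants of these prime divisors with other coefficients or their derivatives, which are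
bounded by the product formula. The induction is carried out in
`HeightData.eventually_sum_add_le`, and `sum_log_absNorm_le` is the result over a number field.
-/

set_option linter.unusedSectionVars false
namespace ReducedReduction

open Polynomial

/-! ### Integer-valued valuations and their Gauss extensions -/

/-- A valuation of a domain with values in `ℤ`, written additively. The value at `0` is a junk
value. -/
structure IntVal (R : Type*) [CommRing R] where
  /-- The underlying function. -/
  toFun : R → ℤ
  map_mul' : ∀ x y, x ≠ 0 → y ≠ 0 → toFun (x * y) = toFun x + toFun y
  map_add' : ∀ x y n, x ≠ 0 → y ≠ 0 → x + y ≠ 0 → n ≤ toFun x → n ≤ toFun y → n ≤ toFun (x + y)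

namespace IntVal

variable {R : Type*} [CommRing R]

instance : CoeFun (IntVal R) (fun _ => R → ℤ) := ⟨IntVal.toFun⟩

/-- `v.Ge n x` says that the valuation of `x` is at least `n`, where `0` has valuation `∞`. -/
def Ge (v : IntVal R) (n : ℤ) (x : R) : Prop := x = 0 ∨ n ≤ v x

variable (v : IntVal R)

theorem map_mul {x y : R} (hx : x ≠ 0) (hy : y ≠ 0) : v (x * y) = v x + v y :=
  v.map_mul' x y hx hy

theorem ge_self (x : R) : v.Ge (v x) x := Or.inr le_rfl

@[simp] theorem ge_zero (n : ℤ) : v.Ge n 0 := Or.inl rfl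

variable {v}

theorem Ge.le {n : ℤ} {x : R} (h : v.Ge n x) (hx : x ≠ 0) : n ≤ v x := h.resolve_left hx

theorem Ge.mono {n m : ℤ} {x : R} (h : v.Ge n x) (hm : m ≤ n) : v.Ge m x :=
  h.imp id hm.trans

theorem Ge.add {n : ℤ} {x y : R} (hx : v.Ge n x) (hy : v.Ge n y) : v.Ge n (x + y) := by
  by_cases h : x + y = 0
  · exact Or.inl h
  by_cases hx0 : x = 0
  · simpa [hx0] using hy
  by_cases hy0 : y = 0
  · simpa [hy0] using hx
  exact Or.inr (v.map_add' x y n hx0 hy0 h (hx.le hx0) (hy.le hy0))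

theorem Ge.sum {ι : Type*} {s : Finset ι} {n : ℤ} {x : ι → R} (h : ∀ i ∈ s, v.Ge n (x i)) :
    v.Ge n (∑ i ∈ s, x i) :=
  Finset.sum_induction x (v.Ge n) (fun _ _ => Ge.add) (v.ge_zero n) h

section Domain

variable [IsDomain R]

@[simp] theorem map_one : v 1 = 0 := by
  have := v.map_mul (one_ne_zero (α := R)) one_ne_zero
  rw [mul_one] at this
  lia

@[simp] theorem map_neg (x : R) : v (-x) = v x := by
  by_cases hx : x = 0
  · simp [hx]
  have h1 : v (-1 : R) = 0 := by
    have := v.map_mul (x := (-1 : R)) (y := -1) (by simp) (by simp)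
    simp only [mul_neg, mul_one, neg_neg, map_one] at this
    lia
  rw [← neg_one_mul, v.map_mul (by simp) hx, h1, zero_add]

theorem Ge.neg {n : ℤ} {x : R} (h : v.Ge n x) : v.Ge n (-x) := by
  simpa [Ge] using h

theorem Ge.sub {n : ℤ} {x y : R} (hx : v.Ge n x) (hy : v.Ge n y) : v.Ge n (x - y) := by
  rw [sub_eq_add_neg]
  exact hx.add hy.neg

theorem Ge.mul {n m : ℤ} {x y : R} (hx : v.Ge n x) (hy : v.Ge m y) : v.Ge (n + m) (x * y) := by
  by_cases hx0 : x = 0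
  · simp [hx0]
  by_cases hy0 : y = 0
  · simp [hy0]
  exact Or.inr (by rw [v.map_mul hx0 hy0]; exact add_le_add (hx.le hx0) (hy.le hy0))

theorem ge_one : v.Ge 0 (1 : R) := Or.inr (by simp)

theorem ge_natCast (n : ℕ) : v.Ge 0 (n : R) := by
  induction n with
  | zero => simp
  | succ k ih => rw [Nat.cast_succ]; exact ih.add ge_one

theorem Ge.mul_natCast {n : ℤ} {x : R} (hx : v.Ge n x) (k : ℕ) : v.Ge n (x * k) := by
  simpa using hx.mul (v.ge_natCast k)

theorem Ge.natCast_mul {n : ℤ} {x : R} (hx : v.Ge n x) (k : ℕ) : v.Ge n (k * x) := by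
  simpa using (v.ge_natCast k).mul hx

theorem map_pow {x : R} (hx : x ≠ 0) (n : ℕ) : v (x ^ n) = n * v x := by
  induction n with
  | zero => simp
  | succ k ih => rw [pow_succ, v.map_mul (pow_ne_zero _ hx) hx, ih]; push_cast; ring

theorem map_prod {ι : Type*} (s : Finset ι) (x : ι → R) (h : ∀ i ∈ s, x i ≠ 0) :
    v (∏ i ∈ s, x i) = ∑ i ∈ s, v (x i) := by
  classical
  induction s using Finset.induction_on with
  | empty => simp
  | insert a s ha ih =>
    rw [Finset.prod_insert ha, Finset.sum_insert ha, v.map_mul (h a (by simp)) _,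
      ih fun i hi => h i (by simp [hi])]
    exact Finset.prod_ne_zero_iff.mpr fun i hi => h i (by simp [hi])

theorem Ge.prod {ι : Type*} {s : Finset ι} {n : ι → ℤ} {x : ι → R}
    (h : ∀ i ∈ s, v.Ge (n i) (x i)) : v.Ge (∑ i ∈ s, n i) (∏ i ∈ s, x i) := by
  classical
  induction s using Finset.induction_on with
  | empty => simpa using ge_one
  | insert a s ha ih =>
    rw [Finset.prod_insert ha, Finset.sum_insert ha]
    exact (h a (by simp)).mul (ih fun i hi => h i (by simp [hi]))

/-- A bound for the valuation of a determinant whose entries are bounded by the sum of a row weight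
and a column weight. -/
theorem ge_det {m : Type*} [Fintype m] [DecidableEq m] {M : Matrix m m R} {r c : m → ℤ}
    (h : ∀ i j, v.Ge (r i + c j) (M i j)) : v.Ge (∑ i, r i + ∑ j, c j) M.det := by
  rw [Matrix.det_apply]
  refine Ge.sum fun σ _ => ?_
  have h1 : v.Ge (∑ i, r i + ∑ j, c j) (∏ i, M (σ i) i) := by
    have := Ge.prod (v := v) (s := Finset.univ) (fun i _ => h (σ i) i)
    rwa [Finset.sum_add_distrib, Equiv.sum_comp σ r] at this
  rcases Int.units_eq_one_or (Equiv.Perm.sign σ) with h2 | h2 <;> rw [h2]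
  · simpa using h1
  · simpa using h1.neg

end Domain

variable (v)

/-- The least valuation of a nonzero member of a family with finite support. -/
noncomputable def minVal {σ : Type*} (c : σ → R) : ℤ := sInf {z | ∃ i, c i ≠ 0 ∧ v (c i) = z}

variable {v}

section MinVal

variable {σ : Type*} {c : σ → R}

theorem finite_minVal (hc : (Function.support c).Finite) :
    {z | ∃ i, c i ≠ 0 ∧ v (c i) = z}.Finite := by
  refine (hc.image fun i => v (c i)).subset ?_
  rintro _ ⟨i, hi, rfl⟩
  exact ⟨i, hi, rfl⟩

theorem ge_minVal (hc : (Function.support c).Finite) (i : σ) : v.Ge (v.minVal c) (c i) := by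
  by_cases hi : c i = 0
  · exact Or.inl hi
  · exact Or.inr (csInf_le (finite_minVal hc).bddBelow ⟨i, hi, rfl⟩)

theorem exists_eq_minVal (hc : (Function.support c).Finite) {j : σ} (hj : c j ≠ 0) :
    ∃ i, c i ≠ 0 ∧ v (c i) = v.minVal c :=
  Int.csInf_mem (s := {z | ∃ i, c i ≠ 0 ∧ v (c i) = z}) ⟨_, j, hj, rfl⟩
    (finite_minVal hc).bddBelow

theorem le_minVal (hc : (Function.support c).Finite) {j : σ} (hj : c j ≠ 0) {n : ℤ}
    (h : ∀ i, v.Ge n (c i)) : n ≤ v.minVal c := by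
  obtain ⟨i, hi, hi'⟩ := exists_eq_minVal (v := v) hc hj
  exact hi' ▸ (h i).le hi

theorem minVal_eq (hc : (Function.support c).Finite) {j : σ} (hj : c j ≠ 0)
    (h : ∀ i, v.Ge (v (c j)) (c i)) : v.minVal c = v (c j) :=
  le_antisymm ((ge_minVal hc j).le hj) (le_minVal hc hj h)

end MinVal

theorem finite_support_coeff (p : R[X]) : (Function.support p.coeff).Finite := by
  refine p.support.finite_toSet.subset fun i hi => ?_
  simpa using hi

theorem exists_coeff_ne_zero {p : R[X]} (hp : p ≠ 0) : ∃ i, p.coeff i ≠ 0 := by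
  by_contra! h
  exact hp (Polynomial.ext fun i => by simp [h i])

/-- `v.Lead p d a` says that `a` is the least valuation of a coefficient of `p`, and that `d` is the
largest index of a coefficient with this valuation. -/
structure Lead (v : IntVal R) (p : R[X]) (d : ℕ) (a : ℤ) : Prop where
  ne_zero : p.coeff d ≠ 0
  eq : v (p.coeff d) = a
  ge : ∀ i, v.Ge a (p.coeff i)
  gt : ∀ i, d < i → v.Ge (a + 1) (p.coeff i)

theorem exists_lead (v : IntVal R) {p : R[X]} (hp : p ≠ 0) :
    ∃ d, v.Lead p d (v.minVal p.coeff) := by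
  obtain ⟨j, hj⟩ := exists_coeff_ne_zero hp
  have hfin := finite_support_coeff p
  have hS : {i | p.coeff i ≠ 0 ∧ v (p.coeff i) = v.minVal p.coeff}.Finite :=
    hfin.subset fun i hi => hi.1
  obtain ⟨d, hd, hmax⟩ := Set.exists_max_image _ id hS (exists_eq_minVal hfin hj)
  refine ⟨d, hd.1, hd.2, ge_minVal hfin, fun i hi => ?_⟩
  by_cases h0 : p.coeff i = 0
  · exact Or.inl h0
  refine Or.inr ?_
  have h1 := (ge_minVal (v := v) hfin i).le h0
  by_contra h2
  exact absurd (hmax i ⟨h0, by lia⟩) (by simpa using hi)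

theorem Lead.minVal_eq {p : R[X]} {d : ℕ} {a : ℤ} (h : v.Lead p d a) : v.minVal p.coeff = a := by
  rw [IntVal.minVal_eq (finite_support_coeff p) h.ne_zero (by simpa [h.eq] using h.ge), h.eq]

variable [IsDomain R]

theorem Lead.mul {p q : R[X]} {d e : ℕ} {a b : ℤ} (hp : v.Lead p d a) (hq : v.Lead q e b) :
    v.Lead (p * q) (d + e) (a + b) := by
  have key : v.Ge (a + b + 1) ((p * q).coeff (d + e) - p.coeff d * q.coeff e) := by
    rw [coeff_mul, ← Finset.add_sum_erase _ _ (a := (d, e)) (by simp), add_sub_cancel_left]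
    refine Ge.sum fun x hx => ?_
    simp only [Finset.mem_erase, Finset.HasAntidiagonal.mem_antidiagonal, ne_eq, Prod.ext_iff] at hx
    rcases lt_or_gt_of_ne (show x.1 ≠ d by lia) with h | h
    · exact ((hp.ge _).mul (hq.gt x.2 (by lia))).mono (by lia)
    · exact ((hp.gt x.1 h).mul (hq.ge _)).mono (by lia)
  have hne : p.coeff d * q.coeff e ≠ 0 := mul_ne_zero hp.ne_zero hq.ne_zero
  have hv : v (p.coeff d * q.coeff e) = a + b := by
    rw [v.map_mul hp.ne_zero hq.ne_zero, hp.eq, hq.eq]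
  have hge : ∀ i, v.Ge (a + b) ((p * q).coeff i) := fun i => by
    rw [coeff_mul]
    exact Ge.sum fun x _ => (hp.ge _).mul (hq.ge _)
  have hne' : (p * q).coeff (d + e) ≠ 0 := by
    intro h
    rw [h, zero_sub] at key
    have := key.neg.le (by simpa using hne)
    rw [neg_neg, hv] at this
    lia
  refine ⟨hne', le_antisymm ?_ ((hge _).le hne'), hge, fun i hi => ?_⟩
  · by_contra! h
    have h1 : v.Ge (a + b + 1) ((p * q).coeff (d + e)) := Or.inr h
    have h2 := (h1.sub key).le (by simpa using hne)
    rw [sub_sub_cancel, hv] at h2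
    lia
  · rw [coeff_mul]
    refine Ge.sum fun x hx => ?_
    rw [Finset.HasAntidiagonal.mem_antidiagonal] at hx
    rcases lt_or_ge d x.1 with h | h
    · exact ((hp.gt x.1 h).mul (hq.ge _)).mono (by lia)
    · exact ((hp.ge _).mul (hq.gt x.2 (by lia))).mono (by lia)

variable (v)

/-- The Gauss extension of a valuation to the polynomial ring. -/
noncomputable def gauss : IntVal R[X] where
  toFun p := v.minVal p.coeff
  map_mul' x y hx hy := by
    obtain ⟨d, hd⟩ := v.exists_lead hx
    obtain ⟨e, he⟩ := v.exists_lead hy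
    exact (hd.mul he).minVal_eq
  map_add' x y n hx hy hxy h1 h2 := by
    obtain ⟨j, hj⟩ := exists_coeff_ne_zero hxy
    refine le_minVal (finite_support_coeff _) hj fun i => ?_
    rw [coeff_add]
    exact ((ge_minVal (finite_support_coeff x) i).mono h1).add
      ((ge_minVal (finite_support_coeff y) i).mono h2)

variable {v}

theorem ge_gauss_iff {n : ℤ} {p : R[X]} : v.gauss.Ge n p ↔ ∀ i, v.Ge n (p.coeff i) := by
  constructor
  · rintro (rfl | h) i
    · simp
    · exact (ge_minVal (finite_support_coeff p) i).mono h
  · intro h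
    by_cases hp : p = 0
    · exact Or.inl hp
    · obtain ⟨j, hj⟩ := exists_coeff_ne_zero hp
      exact Or.inr (le_minVal (finite_support_coeff p) hj h)

theorem Ge.coeff {n : ℤ} {p : R[X]} (h : v.gauss.Ge n p) (i : ℕ) : v.Ge n (p.coeff i) :=
  ge_gauss_iff.mp h i

theorem exists_lead_gauss (v : IntVal R) {p : R[X]} (hp : p ≠ 0) : ∃ d, v.Lead p d (v.gauss p) :=
  v.exists_lead hp

theorem ge_gauss_C {n : ℤ} {r : R} : v.gauss.Ge n (C r) ↔ v.Ge n r := by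
  rw [ge_gauss_iff]
  refine ⟨fun h => by simpa using h 0, fun h i => ?_⟩
  rw [coeff_C]
  split_ifs <;> simp [h]

theorem Ge.derivative {n : ℤ} {p : R[X]} (h : v.gauss.Ge n p) : v.gauss.Ge n (derivative p) := by
  rw [ge_gauss_iff] at h ⊢
  intro i
  rw [coeff_derivative]
  exact_mod_cast (h (i + 1)).mul_natCast (i + 1)

end IntVal

end ReducedReduction

namespace ReducedReduction

open Polynomial

namespace IntVal

variable {R : Type*} [CommRing R] [IsDomain R] {v : IntVal R}

/-! ### Approximate multiples of a polynomial -/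

/-- The polynomials which are congruent to a multiple of `U`, up to terms of valuation larger than
`t`, the cofactor having valuation at least `t`. -/
def Near (v : IntVal R) (U : R[X]) (t : ℤ) (p : R[X]) : Prop :=
  ∃ q e, p = U * q + e ∧ v.gauss.Ge t q ∧ v.gauss.Ge (t + 1) e

section Near

variable {U p p' q : R[X]} {t s : ℤ}

theorem Near.add (h : v.Near U t p) (h' : v.Near U t p') : v.Near U t (p + p') := by
  obtain ⟨q, e, rfl, hq, he⟩ := h
  obtain ⟨q', e', rfl, hq', he'⟩ := h'
  exact ⟨q + q', e + e', by ring, hq.add hq', he.add he'⟩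

theorem Near.mul (h : v.Near U t p) (hq : v.gauss.Ge s q) : v.Near U (t + s) (p * q) := by
  obtain ⟨a, e, rfl, ha, he⟩ := h
  exact ⟨a * q, e * q, by ring, ha.mul hq, (he.mul hq).mono (by lia)⟩

theorem near_of_ge (h : v.gauss.Ge (t + 1) p) : v.Near U t p := ⟨0, p, by simp, by simp, h⟩

/-- Modulo terms of larger valuation a multiple of a polynomial of positive degree cannot be a
nonzero constant. -/
theorem not_near_C {d : ℕ} (hU : v.Lead U d 0) (hd : 1 ≤ d) {r : R} (hr : r ≠ 0) :
    ¬ v.Near U (v r) (C r) := by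
  rintro ⟨q, e, h, hq, he⟩
  have hUge : v.gauss.Ge 0 U := ge_gauss_iff.mpr hU.ge
  by_cases hq1 : v.gauss.Ge (v r + 1) q
  · have h1 : v.gauss.Ge (v r + 1) (C r) := by
      rw [h]
      exact ((hUge.mul hq1).mono (by lia)).add he
    have := (ge_gauss_C.mp h1).le hr
    lia
  have hq0 : q ≠ 0 := by
    rintro rfl
    simp at hq1
  have hqv : v.gauss q = v r := by
    have := hq.le hq0
    by_contra hne
    exact hq1 (Or.inr (by lia))
  obtain ⟨b, hb⟩ := v.exists_lead_gauss hq0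
  have hl := hU.mul hb
  have h2 : (U * q).coeff (d + b) = -e.coeff (d + b) := by
    have h3 := congrArg (fun p => coeff p (d + b)) h
    simp only [coeff_add] at h3
    rw [coeff_C, if_neg (by lia)] at h3
    exact eq_neg_of_add_eq_zero_left h3.symm
  have h4 := (he.coeff (d + b)).neg
  rw [← h2] at h4
  have h5 := h4.le hl.ne_zero
  rw [hl.eq, hqv] at h5
  lia

/-- A polynomial divisible by the square of `U` up to terms of larger valuation has a derivative
divisible by `U` up to terms of larger valuation. -/
theorem near_of_sq {c : R} {W e : R[X]} (hU : v.gauss.Ge 0 U) (hW : v.gauss.Ge 0 W)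
    (hc : v.Ge t c) (he : v.gauss.Ge (t + 1) e) (h : p = C c * U ^ 2 * W + e) :
    v.Near U t p ∧ v.Near U t (derivative p) := by
  have hcC : v.gauss.Ge t (C c) := ge_gauss_C.mpr hc
  constructor
  · refine ⟨C c * (U * W), e, by rw [h]; ring, ?_, he⟩
    simpa using hcC.mul (hU.mul hW)
  · refine ⟨C c * (2 * (derivative U * W) + U * derivative W), derivative e, ?_, ?_, he.derivative⟩
    · rw [h]
      simp only [derivative_add, derivative_mul, derivative_C, derivative_pow]
      push_cast
      simp only [map_ofNat]
      ring
    · have h1 := (hU.derivative.mul hW).natCast_mul 2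
      have h2 := hcC.mul (h1.add (hU.mul hW.derivative))
      simpa using h2

end Near

/-! ### Valuations of resultants -/

/-- A lower bound for the valuation of a resultant, with the gain coming from `k` leading
coefficients of larger valuation. -/
theorem ge_resultant {f g : R[X]} {m n k : ℕ} {a b : ℤ} (hk : k ≤ m + n)
    (hf : v.gauss.Ge a f) (hg : v.gauss.Ge b g)
    (hf' : ∀ i, m < i + k → v.Ge (a + 1) (f.coeff i))
    (hg' : ∀ i, n < i + k → v.Ge (b + 1) (g.coeff i)) :
    v.Ge (n * a + m * b + k) (resultant f g m n) := by
  have h := ge_det (v := v) (M := sylvester f g m n)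
    (r := fun i => if m + n ≤ (i : ℕ) + k then 1 else 0)
    (c := fun j => j.addCases (fun _ => b) (fun _ => a)) (by
      intro i j
      rw [sylvester, Matrix.of_apply]
      refine j.addCases (fun j => ?_) (fun j => ?_)
      · simp only [Fin.addCases_left]
        split_ifs with h1 h2
        · rw [add_comm]
          refine hg' _ ?_
          have := j.2
          simp only [Set.mem_Icc] at h2
          lia
        · simp
        · rw [zero_add]; exact hg.coeff _
        · simp
      · simp only [Fin.addCases_right]
        split_ifs with h1 h2
        · rw [add_comm]
          refine hf' _ ?_
          have := j.2
          simp only [Set.mem_Icc] at h2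
          lia
        · simp
        · rw [zero_add]; exact hf.coeff _
        · simp)
  refine h.mono (le_of_eq ?_)
  have h1 : (∑ i : Fin (m + n), if m + n ≤ (i : ℕ) + k then (1 : ℤ) else 0) = k := by
    rw [Fin.sum_univ_eq_sum_range (fun i => if m + n ≤ i + k then (1 : ℤ) else 0),
      ← Finset.sum_filter, Finset.sum_const, nsmul_eq_mul, mul_one]
    congr 1
    have : (Finset.range (m + n)).filter (fun i => m + n ≤ i + k) =
        Finset.Ico (m + n - k) (m + n) := by
      ext i
      simp only [Finset.mem_filter, Finset.mem_range, Finset.mem_Ico]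
      lia
    rw [this, Nat.card_Ico]
    lia
  rw [h1, Fin.sum_univ_add]
  simp
  ring

/-- Bézout coefficients for the resultant, with bounds for their valuations. -/
theorem exists_bezout {f g : R[X]} {m n : ℕ} {a b : ℤ} (hm : f.natDegree ≤ m)
    (hn : g.natDegree ≤ n) (hmn : 0 < m + n) (hf : v.gauss.Ge a f) (hg : v.gauss.Ge b g) :
    ∃ A B : R[X], f * A + g * B = C (resultant f g m n) ∧
      v.gauss.Ge (n * a + m * b - a) A ∧ v.gauss.Ge (n * a + m * b - b) B := by
  set M := sylvester f g m n with hM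
  let z : Fin (m + n) := ⟨0, hmn⟩
  let c : Fin (m + n) → ℤ := fun j => j.addCases (fun _ => b) (fun _ => a)
  have hent : ∀ i j, v.Ge (c j) (M i j) := by
    intro i j
    rw [hM, sylvester, Matrix.of_apply]
    refine j.addCases (fun j => ?_) (fun j => ?_)
    · simp only [Fin.addCases_left, c]
      split_ifs
      · exact hg.coeff _
      · simp
    · simp only [Fin.addCases_right, c]
      split_ifs
      · exact hf.coeff _
      · simp
  have hsum : ∑ j, c j = n * a + m * b := by
    rw [Fin.sum_univ_add]
    simp [c]
    ring
  have hadj : ∀ j, v.Ge (n * a + m * b - c j) (M.adjugate j z) := by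
    intro j
    rw [Matrix.adjugate_apply]
    have := ge_det (v := v) (M := M.updateRow z (Pi.single j 1))
      (r := Pi.single z (-c j)) (c := c) (by
        intro i j'
        by_cases hi : i = z
        · subst hi
          rw [Matrix.updateRow_self]
          by_cases hj : j' = j
          · subst hj
            simpa using ge_one
          · simp [hj]
        · rw [Matrix.updateRow_ne hi]
          simpa [hi] using hent i j')
    refine this.mono (le_of_eq ?_)
    rw [hsum, Finset.sum_pi_single']
    simp
    ring
  have hdeg : ∀ (p : R[X]) (d : ℕ), p.natDegree ≤ d → ∀ (i : ℕ) (j : ℕ),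
      (p * X ^ j).coeff i = if i ∈ Set.Icc j (j + d) then p.coeff (i - j) else 0 := by
    intro p d hd i j
    rw [coeff_mul_X_pow']
    simp only [Set.mem_Icc]
    by_cases h1 : j ≤ i
    · by_cases h2 : i ≤ j + d
      · simp [h1, h2]
      · rw [if_pos h1, if_neg (by simp [h2])]
        exact coeff_eq_zero_of_natDegree_lt (by lia)
    · simp [h1]
  refine ⟨∑ j : Fin n, C (M.adjugate (Fin.natAdd m j) z) * X ^ (j : ℕ),
    ∑ j : Fin m, C (M.adjugate (Fin.castAdd n j) z) * X ^ (j : ℕ), ?_, ?_, ?_⟩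
  · ext i
    have hmul : ∀ i : Fin (m + n), ∑ j, M i j * M.adjugate j z = if i = z then M.det else 0 := by
      intro i
      have := congrFun (congrFun (Matrix.mul_adjugate M) i) z
      rw [Matrix.mul_apply] at this
      rw [this, Matrix.smul_apply, Matrix.one_apply]
      split_ifs <;> simp
    simp only [Finset.mul_sum, coeff_add, finsetSum_coeff]
    have e1 : ∀ j : Fin n, (f * (C (M.adjugate (Fin.natAdd m j) z) * X ^ (j : ℕ))).coeff i =
        M.adjugate (Fin.natAdd m j) z *
          if i ∈ Set.Icc (j : ℕ) (j + m) then f.coeff (i - j) else 0 := by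
      intro j
      rw [show f * (C (M.adjugate (Fin.natAdd m j) z) * X ^ (j : ℕ)) =
        C (M.adjugate (Fin.natAdd m j) z) * (f * X ^ (j : ℕ)) by ring, coeff_C_mul, hdeg f m hm]
    have e2 : ∀ j : Fin m, (g * (C (M.adjugate (Fin.castAdd n j) z) * X ^ (j : ℕ))).coeff i =
        M.adjugate (Fin.castAdd n j) z *
          if i ∈ Set.Icc (j : ℕ) (j + n) then g.coeff (i - j) else 0 := by
      intro j
      rw [show g * (C (M.adjugate (Fin.castAdd n j) z) * X ^ (j : ℕ)) =
        C (M.adjugate (Fin.castAdd n j) z) * (g * X ^ (j : ℕ)) by ring, coeff_C_mul, hdeg g n hn]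
    simp only [e1, e2]
    by_cases hi : i < m + n
    · have := hmul ⟨i, hi⟩
      rw [Fin.sum_univ_add] at this
      simp only [hM, sylvester, Matrix.of_apply, Fin.addCases_left, Fin.addCases_right] at this
      rw [coeff_C, add_comm]
      simp only [hM, sylvester, mul_comm] at this ⊢
      rw [this, resultant, sylvester]
      simp [z, Fin.ext_iff]
    · rw [coeff_C, if_neg (by lia), Finset.sum_eq_zero, Finset.sum_eq_zero, add_zero]
      · intro j _
        rw [if_neg, mul_zero]
        have := j.2
        simp only [Set.mem_Icc]
        lia
      · intro j _
        rw [if_neg, mul_zero]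
        have := j.2
        simp only [Set.mem_Icc]
        lia
  · refine Ge.sum fun j _ => ge_gauss_iff.mpr fun i => ?_
    rw [coeff_C_mul, coeff_X_pow]
    have := hadj (Fin.natAdd m j)
    simp only [c, Fin.addCases_right] at this
    split_ifs <;> simp [this]
  · refine Ge.sum fun j _ => ge_gauss_iff.mpr fun i => ?_
    rw [coeff_C_mul, coeff_X_pow]
    have := hadj (Fin.castAdd n j)
    simp only [c, Fin.addCases_left] at this
    split_ifs <;> simp [this]

end IntVal

end ReducedReduction

namespace ReducedReduction

open Polynomial

/-! ### Prime polynomials and the nonvanishing of resultants -/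

section Prime

variable {R : Type*} [CommRing R] [IsDomain R]

theorem exists_C_mul_eq_map (p : (FractionRing R)[X]) :
    ∃ (r : R) (q : R[X]), r ≠ 0 ∧ C (algebraMap R (FractionRing R) r) * p =
      q.map (algebraMap R (FractionRing R)) := by
  obtain ⟨b, hb0, hb⟩ := IsLocalization.integerNormalization_spec (nonZeroDivisors R) p
  refine ⟨b, IsLocalization.integerNormalization (nonZeroDivisors R) p,
    nonZeroDivisors.ne_zero hb0, ?_⟩
  rw [hb, Algebra.smul_def, Polynomial.algebraMap_apply]

theorem not_dvd_C {g : R[X]} (hg1 : 1 ≤ g.natDegree) {r : R} (hr : r ≠ 0) :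
    ¬ g ∣ C r := by
  intro h
  have := natDegree_le_of_dvd h (by simpa using hr)
  rw [natDegree_C] at this
  lia

theorem dvd_of_map_dvd_map {g p : R[X]} (hg : Prime g) (hg1 : 1 ≤ g.natDegree) {k : ℕ}
    (h : g.map (algebraMap R (FractionRing R)) ^ k ∣ p.map (algebraMap R (FractionRing R))) :
    g ^ k ∣ p := by
  obtain ⟨q, hq⟩ := h
  obtain ⟨r, q', hr, hq'⟩ := exists_C_mul_eq_map q
  have h1 : C r * p = g ^ k * q' := by
    apply Polynomial.map_injective _ (IsFractionRing.injective R (FractionRing R))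
    rw [Polynomial.map_mul, Polynomial.map_mul, Polynomial.map_pow, hq, map_C, ← hq']
    ring
  exact hg.pow_dvd_of_dvd_mul_left k (not_dvd_C hg1 hr) (Dvd.intro _ h1.symm)

omit [IsDomain R] in
theorem natDegree_map_fraction (p : R[X]) :
    (p.map (algebraMap R (FractionRing R))).natDegree = p.natDegree :=
  natDegree_map_eq_of_injective (IsFractionRing.injective R (FractionRing R)) p

theorem dvd_of_map_dvd_of_C_mul {g q : R[X]} {u : (FractionRing R)[X]} {r : R} (hr : r ≠ 0)
    (hq : C (algebraMap R (FractionRing R) r) * u = q.map (algebraMap R (FractionRing R)))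
    (h : g ∣ q) : g.map (algebraMap R (FractionRing R)) ∣ u := by
  have h1 := Polynomial.map_dvd (algebraMap R (FractionRing R)) h
  rw [← hq] at h1
  have hr' : algebraMap R (FractionRing R) r ≠ 0 := by simpa using hr
  exact (IsUnit.dvd_mul_left (isUnit_C.mpr hr'.isUnit)).mp h1

theorem prime_map_fraction {g : R[X]} (hg : Prime g) (hg1 : 1 ≤ g.natDegree) :
    Prime (g.map (algebraMap R (FractionRing R))) := by
  refine ⟨(Polynomial.map_ne_zero_iff (IsFractionRing.injective R (FractionRing R))).mpr
    hg.ne_zero, fun h => ?_, fun a b hab => ?_⟩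
  · have := natDegree_eq_zero_of_isUnit h
    rw [natDegree_map_fraction] at this
    lia
  · obtain ⟨r, a', hr, ha⟩ := exists_C_mul_eq_map a
    obtain ⟨s, b', hs, hb⟩ := exists_C_mul_eq_map b
    have h1 : g ^ 1 ∣ a' * b' := by
      apply dvd_of_map_dvd_map hg hg1
      rw [Polynomial.map_mul, ← ha, ← hb, pow_one]
      exact (hab.mul_left (C (algebraMap R (FractionRing R) r) *
        C (algebraMap R (FractionRing R) s))).trans (dvd_of_eq (by ring))
    rw [pow_one] at h1
    exact (hg.dvd_or_dvd h1).imp (dvd_of_map_dvd_of_C_mul hr ha) (dvd_of_map_dvd_of_C_mul hs hb)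

theorem resultant_ne_zero_of_isCoprime {f g : R[X]} {D : ℕ} (hf : f ≠ 0) (hD : g.natDegree ≤ D)
    (h : IsCoprime (f.map (algebraMap R (FractionRing R)))
      (g.map (algebraMap R (FractionRing R)))) : resultant f g f.natDegree D ≠ 0 := by
  obtain ⟨k, rfl⟩ := Nat.exists_eq_add_of_le hD
  rw [resultant_add_right_deg f g f.natDegree g.natDegree k le_rfl]
  have h1 := resultant_ne_zero _ _ h
  rw [natDegree_map_fraction, natDegree_map_fraction, resultant_map_map] at h1
  refine mul_ne_zero (pow_ne_zero _ (by simpa using hf)) fun h2 => h1 ?_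
  rw [h2, map_zero]

theorem dvd_derivative_of_prime [CharZero R] {g p : R[X]} (hg : Prime g) (hg1 : 1 ≤ g.natDegree)
    (h : g ∣ p) (h' : g ∣ derivative p) : g ^ 2 ∣ p := by
  obtain ⟨q, rfl⟩ := h
  rw [derivative_mul] at h'
  have h1 : g ∣ derivative g * q := (dvd_add_left (dvd_mul_right g _)).mp h'
  rcases hg.dvd_or_dvd h1 with h2 | h2
  · have h3 : derivative g ≠ 0 := by
      intro h0
      have := derivative_eq_zero.mp h0
      lia
    have := natDegree_le_of_dvd h2 h3
    have := natDegree_derivative_lt (p := g) (by lia)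
    lia
  · obtain ⟨s, rfl⟩ := h2
    exact ⟨s, by ring⟩

theorem resultant_ne_zero_of_prime {g q : R[X]} {D : ℕ} (hg : Prime g) (hg1 : 1 ≤ g.natDegree)
    (hq : ¬ g ∣ q) (hD : q.natDegree ≤ D) : resultant g q g.natDegree D ≠ 0 := by
  refine resultant_ne_zero_of_isCoprime hg.ne_zero hD ?_
  refine ((prime_map_fraction hg hg1).irreducible.isCoprime_or_dvd _).resolve_right fun h => hq ?_
  have := dvd_of_map_dvd_map hg hg1 (p := q) (k := 1) (by rwa [pow_one])
  rwa [pow_one] at this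

variable [UniqueFactorizationMonoid R]

/-- A polynomial over a factorial domain is a constant times a product of powers of pairwise
non-associated prime polynomials of positive degree. -/
theorem exists_eq_prod_primes (b : R[X]) (hb : b ≠ 0) :
    ∃ (s : Finset R[X]) (m : R[X] → ℕ) (z : R), (∀ g ∈ s, Prime g ∧ 1 ≤ g.natDegree ∧ 1 ≤ m g) ∧
      (∀ g ∈ s, ∀ h ∈ s, g ∣ h → g = h) ∧ z ≠ 0 ∧ b = C z * ∏ g ∈ s, g ^ m g := by
  classical
  induction b using UniqueFactorizationMonoid.induction_on_prime with
  | h₁ => exact absurd rfl hb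
  | h₂ u hu =>
    obtain ⟨z, hz, rfl⟩ := isUnit_iff.mp hu
    exact ⟨∅, fun _ => 0, z, by simp, by simp, hz.ne_zero, by simp⟩
  | h₃ a p ha hp ih =>
    obtain ⟨s, m, z, h1, h2, hz, rfl⟩ := ih ha
    by_cases hp1 : 1 ≤ p.natDegree
    · by_cases hps : ∃ g ∈ s, Associated g p
      · obtain ⟨g, hg, u, rfl⟩ := hps
        obtain ⟨c, hc, hcu⟩ := isUnit_iff.mp u.isUnit
        refine ⟨s, Function.update m g (m g + 1), c * z,
          fun h hh => ⟨(h1 h hh).1, (h1 h hh).2.1, ?_⟩,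
          h2, mul_ne_zero hc.ne_zero hz, ?_⟩
        · by_cases hhg : h = g
          · simp [hhg]
          · simpa [hhg] using (h1 h hh).2.2
        · have h3 : ∏ x ∈ s.erase g, x ^ Function.update m g (m g + 1) x =
              ∏ x ∈ s.erase g, x ^ m x := Finset.prod_congr rfl fun x hx => by
            rw [Function.update_of_ne (Finset.ne_of_mem_erase hx)]
          rw [← Finset.mul_prod_erase s _ hg, ← Finset.mul_prod_erase s _ hg, ← hcu, h3,
            Function.update_self, C_mul, pow_succ]
          ring
      · have hpn : p ∉ s := fun h => hps ⟨p, h, Associated.refl p⟩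
        refine ⟨insert p s, Function.update m p 1, z, ?_, ?_, hz, ?_⟩
        · intro g hg
          rcases Finset.mem_insert.mp hg with rfl | hg
          · exact ⟨hp, hp1, by simp⟩
          · have : g ≠ p := fun h => hpn (h ▸ hg)
            simpa [this] using h1 g hg
        · intro g hg h hh hgh
          rcases Finset.mem_insert.mp hg with rfl | hg' <;>
            rcases Finset.mem_insert.mp hh with rfl | hh'
          · rfl
          · exact absurd ⟨h, hh', (hp.associated_of_dvd (h1 h hh').1 hgh).symm⟩ hps
          · exact absurd ⟨g, hg', (h1 g hg').1.associated_of_dvd hp hgh⟩ hps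
          · exact h2 g hg' h hh' hgh
        · have h3 : ∏ x ∈ s, x ^ Function.update m p 1 x = ∏ x ∈ s, x ^ m x :=
            Finset.prod_congr rfl fun x hx => by
              rw [Function.update_of_ne (fun h : x = p => hpn (h ▸ hx))]
          rw [Finset.prod_insert hpn, Function.update_self, pow_one, h3]
          ring
    · obtain ⟨c, rfl⟩ := natDegree_eq_zero.mp (show p.natDegree = 0 by lia)
      refine ⟨s, m, c * z, h1, h2, mul_ne_zero (fun h => hp.ne_zero (by simp [h])) hz, ?_⟩
      rw [C_mul]
      ring

theorem exists_prime_dvd {b : R[X]} (hb : 1 ≤ b.natDegree) :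
    ∃ g, Prime g ∧ 1 ≤ g.natDegree ∧ g ∣ b := by
  obtain ⟨s, m, z, h1, -, hz, h⟩ := exists_eq_prod_primes b (by rintro rfl; simp at hb)
  have hs : s.Nonempty := by
    by_contra h0
    rw [Finset.not_nonempty_iff_eq_empty] at h0
    subst h0
    rw [h] at hb
    simp at hb
  obtain ⟨g, hg⟩ := hs
  refine ⟨g, (h1 g hg).1, (h1 g hg).2.1, h ▸ Dvd.dvd.mul_left ?_ _⟩
  exact (dvd_pow_self g (by have := (h1 g hg).2.2; lia)).trans (Finset.dvd_prod_of_mem _ hg)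

theorem resultant_derivative_ne_zero [CharZero R] {f : R[X]} (hf : 1 ≤ f.natDegree)
    (hsq : ∀ u : R[X], u ^ 2 ∣ f → u.natDegree = 0) :
    resultant f (derivative f) f.natDegree (f.natDegree - 1) ≠ 0 := by
  have hf0 : f ≠ 0 := by rintro rfl; simp at hf
  refine resultant_ne_zero_of_isCoprime hf0 (natDegree_derivative_le f) ?_
  rw [← derivative_map]
  change (f.map (algebraMap R (FractionRing R))).Separable
  rw [PerfectField.separable_iff_squarefree]
  intro u hu
  have hf0' : f.map (algebraMap R (FractionRing R)) ≠ 0 :=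
    (Polynomial.map_ne_zero_iff (IsFractionRing.injective R (FractionRing R))).mpr hf0
  have hu0 : u ≠ 0 := by rintro rfl; simp at hu; exact hf0' hu
  by_contra hun
  have hud : 1 ≤ u.natDegree := by
    by_contra h
    exact hun (isUnit_iff_degree_eq_zero.mpr (by
      rw [degree_eq_natDegree hu0, show u.natDegree = 0 by lia]; rfl))
  obtain ⟨r, q, hr, hq⟩ := exists_C_mul_eq_map u
  have hr' : algebraMap R (FractionRing R) r ≠ 0 := by simpa using hr
  have hqd : q.natDegree = u.natDegree := by
    rw [← natDegree_map_fraction q, ← hq, natDegree_C_mul hr']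
  obtain ⟨g, hg, hg1, hgq⟩ := exists_prime_dvd (b := q) (by lia)
  have hgu := dvd_of_map_dvd_of_C_mul hr hq hgq
  have := hsq g (dvd_of_map_dvd_map hg hg1 (by rw [pow_two]; exact (mul_dvd_mul hgu hgu).trans hu))
  lia

end Prime

end ReducedReduction

namespace ReducedReduction

open Polynomial

/-! ### Hadamard's inequality and bounds for complex resultants -/

/-- Hadamard's inequality for the columns of a complex matrix. -/
theorem norm_det_le_prod_norm {m : ℕ} (M : Matrix (Fin m) (Fin m) ℂ) :
    ‖M.det‖ ≤ ∏ j, √(∑ i, ‖M i j‖ ^ 2) := by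
  let f : Fin m → EuclideanSpace ℂ (Fin m) := fun j => WithLp.toLp 2 fun i => M i j
  have hf : ∀ j, ‖f j‖ = √(∑ i, ‖M i j‖ ^ 2) := fun j => EuclideanSpace.norm_eq _
  have hd : Module.finrank ℂ (EuclideanSpace ℂ (Fin m)) = Fintype.card (Fin m) := by simp
  let e := InnerProductSpace.gramSchmidtOrthonormalBasis hd f
  let b := EuclideanSpace.basisFun (Fin m) ℂ
  have h1 : b.toBasis.det f = M.det := by
    rw [Module.Basis.det_apply]
    congr 1
  have h2 : b.toBasis.det f = b.toBasis.det e.toBasis * e.toBasis.det f := by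
    rw [Module.Basis.det_apply, Module.Basis.det_apply, Module.Basis.det_apply, ← Matrix.det_mul,
      Module.Basis.toMatrix_mul_toMatrix]
  have h3 : ‖b.toBasis.det e.toBasis‖ = 1 := by
    simp
  rw [← h1, h2, norm_mul, h3, one_mul, InnerProductSpace.gramSchmidtOrthonormalBasis_det, norm_prod]
  refine Finset.prod_le_prod (fun _ _ => norm_nonneg _) fun j _ => ?_
  rw [← hf]
  refine (norm_inner_le_norm _ _).trans ?_
  rw [OrthonormalBasis.norm_eq_one, one_mul]

/-- The resultant of `p` and its derivative, bounded by the Euclidean norm of the coefficients. -/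
theorem norm_resultant_derivative_le (p : ℂ[X]) {d : ℕ} (hd : 1 ≤ d) :
    ‖resultant p (derivative p) d (d - 1)‖ ≤
      (d : ℝ) ^ d * √(∑ i ∈ Finset.range (d + 1), ‖p.coeff i‖ ^ 2) ^ (2 * d - 1) := by
  set N := √(∑ i ∈ Finset.range (d + 1), ‖p.coeff i‖ ^ 2) with hN
  refine (norm_det_le_prod_norm _).trans ?_
  -- The columns are shifted coefficient vectors, possibly of smaller length.
  have hcol : ∀ (q : ℂ[X]) (a : ℕ) (j : ℕ), ∑ i : Fin (d + (d - 1)),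
      ‖if (i : ℕ) ∈ Set.Icc j (j + a) then q.coeff (i - j) else 0‖ ^ 2 ≤
        ∑ i ∈ Finset.range (a + 1), ‖q.coeff i‖ ^ 2 := by
    intro q a j
    rw [Fin.sum_univ_eq_sum_range
      (fun i => ‖if i ∈ Set.Icc j (j + a) then q.coeff (i - j) else 0‖ ^ 2)]
    have h1 : ∀ i, ‖if i ∈ Set.Icc j (j + a) then q.coeff (i - j) else 0‖ ^ 2 =
        if i ∈ Finset.Ico j (j + a + 1) then ‖q.coeff (i - j)‖ ^ 2 else 0 := by
      intro i
      simp only [Set.mem_Icc, Finset.mem_Ico, Nat.lt_succ_iff]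
      split_ifs <;> simp
    simp only [h1]
    rw [← Finset.sum_filter]
    refine (Finset.sum_le_sum_of_subset_of_nonneg (t := Finset.Ico j (j + a + 1)) ?_ ?_).trans ?_
    · intro i hi
      exact (Finset.mem_filter.mp hi).2
    · intros; positivity
    · rw [Finset.sum_Ico_eq_sum_range]
      simp [add_assoc]
  have hder : √(∑ i ∈ Finset.range (d - 1 + 1), ‖(derivative p).coeff i‖ ^ 2) ≤ d * N := by
    rw [hN]
    refine Real.sqrt_le_iff.mpr ⟨by positivity, ?_⟩
    rw [mul_pow, Real.sq_sqrt (by positivity), show d - 1 + 1 = d by lia, Finset.sum_range_succ',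
      mul_add, Finset.mul_sum]
    refine le_add_of_le_of_nonneg (Finset.sum_le_sum fun i hi => ?_) (by positivity)
    rw [coeff_derivative, norm_mul, mul_pow, mul_comm]
    have h2 : ‖((i : ℂ) + 1)‖ ≤ d := by
      have : ((i : ℂ) + 1) = ((i + 1 : ℕ) : ℂ) := by push_cast; rfl
      rw [this, Complex.norm_natCast]
      have := Finset.mem_range.mp hi
      exact_mod_cast this
    gcongr
  rw [Fin.prod_univ_add]
  have hl : ∀ j : Fin d,
      √(∑ i, ‖sylvester p (derivative p) d (d - 1) i (Fin.castAdd (d - 1) j)‖ ^ 2)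
      ≤ d * N := by
    intro j
    refine le_trans (Real.sqrt_le_sqrt ?_) hder
    simpa [sylvester] using hcol (derivative p) (d - 1) j
  have hr : ∀ j : Fin (d - 1), √(∑ i, ‖sylvester p (derivative p) d (d - 1) i (Fin.natAdd d j)‖ ^ 2)
      ≤ N := by
    intro j
    refine Real.sqrt_le_sqrt ?_
    simpa [sylvester] using hcol p d j
  calc _ ≤ (∏ _j : Fin d, (d * N)) * ∏ _j : Fin (d - 1), N := by
        gcongr
        · exact hl _
        · exact hr _
    _ = _ := by
        simp only [Finset.prod_const, Finset.card_univ, Fintype.card_fin]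
        rw [mul_pow, mul_assoc, ← pow_add]
        congr 2
        lia

/-- A resultant bounded in terms of the Mahler measure of the first polynomial and the sum of the
absolute values of the coefficients of the second one. -/
theorem norm_resultant_le_mahlerMeasure (p q : ℂ[X]) {D : ℕ} (hq : q.natDegree ≤ D) :
    ‖resultant p q p.natDegree D‖ ≤
      p.mahlerMeasure ^ D * (∑ i ∈ Finset.range (D + 1), ‖q.coeff i‖) ^ p.natDegree := by
  set S := ∑ i ∈ Finset.range (D + 1), ‖q.coeff i‖ with hS
  rw [resultant_eq_prod_eval p q D hq (IsAlgClosed.splits p), norm_mul, norm_pow]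
  have heval : ∀ x : ℂ, ‖q.eval x‖ ≤ S * max 1 ‖x‖ ^ D := by
    intro x
    rw [eval_eq_sum_range' (Nat.lt_succ_of_le hq), hS, Finset.sum_mul]
    refine (norm_sum_le _ _).trans (Finset.sum_le_sum fun i hi => ?_)
    rw [norm_mul, norm_pow]
    gcongr
    calc ‖x‖ ^ i ≤ max 1 ‖x‖ ^ i := by gcongr; exact le_max_right _ _
      _ ≤ max 1 ‖x‖ ^ D := pow_le_pow_right₀ (le_max_left _ _)
          (by have := Finset.mem_range.mp hi; lia)
  have hprod : ∀ s : Multiset ℂ, ‖(s.map fun x => q.eval x).prod‖ ≤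
      S ^ s.card * (s.map fun x => max 1 ‖x‖).prod ^ D := by
    intro s
    induction s using Multiset.induction_on with
    | empty => simp
    | cons a s ih =>
      rw [Multiset.map_cons, Multiset.prod_cons, Multiset.map_cons, Multiset.prod_cons,
        Multiset.card_cons, norm_mul, pow_succ, mul_pow]
      calc _ ≤ (S * max 1 ‖a‖ ^ D) * (S ^ s.card * (s.map fun x => max 1 ‖x‖).prod ^ D) := by
            gcongr
            exact heval a
        _ = _ := by ring
  have h := hprod p.roots
  rw [IsAlgClosed.card_roots_eq_natDegree] at h
  rw [mahlerMeasure_eq_leadingCoeff_mul_prod_roots, mul_pow]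
  calc _ ≤ ‖p.leadingCoeff‖ ^ D * (S ^ p.natDegree *
      (p.roots.map fun x => max 1 ‖x‖).prod ^ D) := by gcongr
    _ = _ := by ring

end ReducedReduction

namespace ReducedReduction

open Polynomial MeasureTheory

/-! ### Families of complex places and their extension to polynomials -/

/-- The uniform probability measure on the angles parametrising the unit circle. -/
noncomputable def circleMeasure : Measure ℝ :=
  ENNReal.ofReal (2 * Real.pi)⁻¹ • volume.restrict (Set.Ioc 0 (2 * Real.pi))

instance : IsProbabilityMeasure circleMeasure := ⟨by
  have : (0 : ℝ) < 2 * Real.pi := Real.two_pi_pos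
  rw [circleMeasure, Measure.smul_apply, Measure.restrict_apply_univ, Real.volume_Ioc, smul_eq_mul,
    ← ENNReal.ofReal_mul (by positivity), sub_zero, inv_mul_cancel₀ this.ne', ENNReal.ofReal_one]⟩

theorem integral_circleMeasure (f : ℂ → ℝ) :
    ∫ t, f (circleMap 0 1 t) ∂circleMeasure = Real.circleAverage f 0 1 := by
  have : (0 : ℝ) < 2 * Real.pi := Real.two_pi_pos
  rw [circleMeasure, integral_smul_measure, ENNReal.toReal_ofReal (by positivity),
    Real.circleAverage_def, intervalIntegral.integral_of_le this.le]

theorem integrable_circleMeasure {f : ℂ → ℝ} (h : CircleIntegrable f 0 1) :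
    Integrable (fun t => f (circleMap 0 1 t)) circleMeasure := by
  have h1 : IntegrableOn (fun t => f (circleMap 0 1 t)) (Set.Ioc 0 (2 * Real.pi)) := by
    have := h.1
    exact this
  exact Integrable.smul_measure h1 ENNReal.ofReal_ne_top

theorem integrable_log_norm_eval (p : ℂ[X]) :
    Integrable (fun t => Real.log ‖p.eval (circleMap 0 1 t)‖) circleMeasure :=
  integrable_circleMeasure
    (analyticOnNhd_id.aeval_polynomial p).meromorphicOn.circleIntegrable_log_norm

theorem integral_log_norm_eval (p : ℂ[X]) :
    ∫ t, Real.log ‖p.eval (circleMap 0 1 t)‖ ∂circleMeasure = p.logMahlerMeasure := by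
  rw [logMahlerMeasure_def, ← integral_circleMeasure]

theorem integrable_norm_eval_sq (p : ℂ[X]) :
    Integrable (fun t => ‖p.eval (circleMap 0 1 t)‖ ^ 2) circleMeasure := by
  refine integrable_circleMeasure (f := fun z => ‖p.eval z‖ ^ 2)
    (ContinuousOn.circleIntegrable zero_le_one ?_)
  fun_prop

theorem integral_norm_eval_sq (p : ℂ[X]) :
    ∫ t, ‖p.eval (circleMap 0 1 t)‖ ^ 2 ∂circleMeasure = ∑ i ∈ p.support, ‖p.coeff i‖ ^ 2 := by
  rw [p.sum_sq_norm_coeff_eq_circleAverage, ← integral_circleMeasure]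

theorem ae_eval_ne_zero {p : ℂ[X]} (hp : p ≠ 0) :
    ∀ᵐ t ∂circleMeasure, p.eval (circleMap 0 1 t) ≠ 0 := by
  have hc : ({z : ℂ | p.eval z = 0}).Countable := by
    refine (p.roots.toFinset.finite_toSet.subset fun z hz => ?_).countable
    simpa [hp] using hz
  have h1 := (hc.preimage_circleMap 0 one_ne_zero).measure_zero volume
  have h2 : ∀ᵐ t : ℝ, p.eval (circleMap 0 1 t) ≠ 0 := by
    rw [ae_iff]
    simpa using h1
  exact (Measure.smul_absolutelyContinuous.trans
    Measure.restrict_le_self.absolutelyContinuous).ae_le h2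

/-- A family of homomorphisms to `ℂ` indexed by a finite measure space, such that the logarithms of
the absolute values of nonzero elements are integrable. -/
structure ArchData (R : Type*) [CommRing R] (Ω : Type*) [MeasurableSpace Ω] where
  /-- The measure on the index set. -/
  μ : Measure Ω
  finite : IsFiniteMeasure μ
  /-- The homomorphisms to `ℂ`. -/
  ev : Ω → R →+* ℂ
  measurable : ∀ x, Measurable fun ω => ev ω x
  ae_ne : ∀ x, x ≠ 0 → ∀ᵐ ω ∂μ, ev ω x ≠ 0
  integrable : ∀ x, x ≠ 0 → Integrable (fun ω => Real.log ‖ev ω x‖) μ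

namespace ArchData

attribute [instance] ArchData.finite

variable {R Ω : Type*} [CommRing R] [MeasurableSpace Ω] (D : ArchData R Ω)

/-- The integral of the logarithm of the absolute values of an element. -/
noncomputable def m (x : R) : ℝ := ∫ ω, Real.log ‖D.ev ω x‖ ∂D.μ

/-- The total mass. -/
noncomputable def mass : ℝ := D.μ.real Set.univ

theorem mass_nonneg : 0 ≤ D.mass := measureReal_nonneg

theorem m_mul {x y : R} [IsDomain R] (hx : x ≠ 0) (hy : y ≠ 0) : D.m (x * y) = D.m x + D.m y := by
  rw [m, m, m, ← integral_add (D.integrable x hx) (D.integrable y hy)]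
  refine integral_congr_ae ?_
  filter_upwards [D.ae_ne x hx, D.ae_ne y hy] with ω h1 h2
  rw [map_mul, norm_mul, Real.log_mul (by simpa using h1) (by simpa using h2)]

theorem integrable_posLog (x : R) : Integrable (fun ω => Real.posLog ‖D.ev ω x‖) D.μ := by
  by_cases hx : x = 0
  · simp [hx]
  · simp only [← Real.half_mul_log_add_log_abs]
    exact ((D.integrable x hx).add (D.integrable x hx).abs).const_mul _

theorem measurable_sum {σ : Type*} (s : Finset σ) (w : σ → ℝ) (c : σ → R) :
    Measurable fun ω => ∑ i ∈ s, w i * ‖D.ev ω (c i)‖ ^ 2 :=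
  Finset.measurable_sum s fun i _ => ((D.measurable (c i)).norm.pow_const 2).const_mul (w i)

theorem ae_sum_pos {σ : Type*} {s : Finset σ} {w : σ → ℝ} {c : σ → R} (hw : ∀ i ∈ s, 0 ≤ w i)
    (h : ∃ i ∈ s, 0 < w i ∧ c i ≠ 0) : ∀ᵐ ω ∂D.μ, 0 < ∑ i ∈ s, w i * ‖D.ev ω (c i)‖ ^ 2 := by
  obtain ⟨i, hi, hwi, hci⟩ := h
  filter_upwards [D.ae_ne _ hci] with ω hω
  refine Finset.sum_pos' (fun j hj => mul_nonneg (hw j hj) (by positivity)) ⟨i, hi, ?_⟩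
  have : 0 < ‖D.ev ω (c i)‖ := norm_pos_iff.mpr hω
  positivity

theorem integrable_log_sum {σ : Type*} {s : Finset σ} {w : σ → ℝ} {c : σ → R}
    (hw : ∀ i ∈ s, 0 ≤ w i) (h : ∃ i ∈ s, 0 < w i ∧ c i ≠ 0) :
    Integrable (fun ω => Real.log (∑ i ∈ s, w i * ‖D.ev ω (c i)‖ ^ 2)) D.μ := by
  have h' := h
  obtain ⟨i, hi, hwi, hci⟩ := h
  have hub : Integrable (fun ω => Real.log s.card + ∑ j ∈ s, (Real.posLog (w j) +
      2 * Real.posLog ‖D.ev ω (c j)‖)) D.μ := by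
    refine (integrable_const _).add (integrable_finsetSum _ fun j _ => ?_)
    exact (integrable_const _).add ((D.integrable_posLog _).const_mul _)
  have hlb : Integrable (fun ω => Real.log (w i) + 2 * Real.log ‖D.ev ω (c i)‖) D.μ :=
    (integrable_const _).add ((D.integrable _ hci).const_mul _)
  refine (hub.abs.add hlb.abs).mono' (D.measurable_sum s w c).log.aestronglyMeasurable ?_
  filter_upwards [D.ae_ne _ hci, D.ae_sum_pos hw h'] with ω hω hpos
  have h1 : Real.log (w i) + 2 * Real.log ‖D.ev ω (c i)‖ ≤
      Real.log (∑ i ∈ s, w i * ‖D.ev ω (c i)‖ ^ 2) := by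
    have hn : 0 < ‖D.ev ω (c i)‖ := norm_pos_iff.mpr hω
    have : Real.log (w i) + 2 * Real.log ‖D.ev ω (c i)‖ = Real.log (w i * ‖D.ev ω (c i)‖ ^ 2) := by
      rw [Real.log_mul hwi.ne' (by positivity), Real.log_pow]
      push_cast; ring
    rw [this]
    refine Real.log_le_log (by positivity) ?_
    exact Finset.single_le_sum (f := fun i => w i * ‖D.ev ω (c i)‖ ^ 2)
      (fun j hj => mul_nonneg (hw j hj) (by positivity)) hi
  have h2 : Real.log (∑ i ∈ s, w i * ‖D.ev ω (c i)‖ ^ 2) ≤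
      Real.log s.card + ∑ j ∈ s, (Real.posLog (w j) + 2 * Real.posLog ‖D.ev ω (c j)‖) := by
    refine (le_max_right _ _).trans ((Real.posLog_sum s _).trans ?_)
    gcongr with j hj
    refine Real.posLog_mul.trans ?_
    gcongr
    have := Real.posLog_pow 2 ‖D.ev ω (c j)‖
    push_cast at this
    exact this.le
  simp only [Pi.add_apply]
  rw [Real.norm_eq_abs, abs_le]
  constructor
  · have := neg_abs_le (Real.log (w i) + 2 * Real.log ‖D.ev ω (c i)‖)
    have := abs_nonneg
      (Real.log s.card + ∑ j ∈ s, (Real.posLog (w j) + 2 * Real.posLog ‖D.ev ω (c j)‖))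
    linarith
  · have := le_abs_self (Real.log s.card + ∑ j ∈ s, (Real.posLog (w j) +
      2 * Real.posLog ‖D.ev ω (c j)‖))
    have := abs_nonneg (Real.log (w i) + 2 * Real.log ‖D.ev ω (c i)‖)
    linarith

/-- The homomorphism of a polynomial ring given by a homomorphism on coefficients and a point of the
unit circle. -/
noncomputable def polyEv (x : Ω × ℝ) : R[X] →+* ℂ :=
  eval₂RingHom (D.ev x.1) (circleMap 0 1 x.2)

theorem polyEv_apply (x : Ω × ℝ) (p : R[X]) :
    D.polyEv x p = (p.map (D.ev x.1)).eval (circleMap 0 1 x.2) := by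
  rw [polyEv, coe_eval₂RingHom, Polynomial.eval_map]

theorem measurable_polyEv (p : R[X]) : Measurable fun x => D.polyEv x p := by
  simp only [polyEv, coe_eval₂RingHom, eval₂_eq_sum, Polynomial.sum]
  refine Finset.measurable_sum _ fun i _ => ?_
  refine ((D.measurable _).comp measurable_fst).mul (Measurable.pow_const ?_ _)
  exact ((continuous_circleMap 0 1).measurable.comp measurable_snd)

theorem ae_map_ne_zero {p : R[X]} (hp : p ≠ 0) : ∀ᵐ ω ∂D.μ, p.map (D.ev ω) ≠ 0 := by
  filter_upwards [D.ae_ne p.leadingCoeff (by simpa using hp)] with ω hω h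
  apply hω
  have := congrArg (fun q => q.coeff p.natDegree) h
  simpa using this

theorem ae_polyEv_ne_zero {p : R[X]} (hp : p ≠ 0) :
    ∀ᵐ x ∂D.μ.prod circleMeasure, D.polyEv x p ≠ 0 := by
  have hm : MeasurableSet {x : Ω × ℝ | D.polyEv x p ≠ 0} :=
    (D.measurable_polyEv p) (MeasurableSet.singleton 0).compl
  refine (Measure.ae_prod_iff_ae_ae hm).mpr ?_
  filter_upwards [D.ae_map_ne_zero hp] with ω hω
  simpa only [polyEv_apply] using ae_eval_ne_zero hω

theorem integrable_polyEv {p : R[X]} (hp : p ≠ 0) :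
    Integrable (fun x => Real.log ‖D.polyEv x p‖) (D.μ.prod circleMeasure) := by
  have hmeas : Measurable fun x => Real.log ‖D.polyEv x p‖ := (D.measurable_polyEv p).norm.log
  rw [integrable_prod_iff hmeas.aestronglyMeasurable]
  refine ⟨Filter.Eventually.of_forall fun ω => ?_, ?_⟩
  · simpa only [polyEv_apply] using integrable_log_norm_eval (p.map (D.ev ω))
  have hlc : p.leadingCoeff ≠ 0 := by simpa using hp
  have hub : Integrable (fun ω => 2 * (Real.log (p.natDegree + 1 : ℕ) +
      ∑ i ∈ Finset.range (p.natDegree + 1), Real.posLog ‖D.ev ω (p.coeff i)‖) -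
      Real.log ‖D.ev ω p.leadingCoeff‖) D.μ := by
    refine (Integrable.const_mul ((integrable_const _).add
      (integrable_finsetSum _ fun j _ => ?_)) _).sub (D.integrable _ hlc)
    exact D.integrable_posLog _
  refine hub.mono' (hmeas.norm.stronglyMeasurable.integral_prod_right').aestronglyMeasurable ?_
  filter_upwards [D.ae_ne _ hlc] with ω hω
  have hnd : (p.map (D.ev ω)).natDegree = p.natDegree := natDegree_map_of_leadingCoeff_ne_zero _ hω
  have hlc' : (p.map (D.ev ω)).leadingCoeff = D.ev ω p.leadingCoeff :=
    leadingCoeff_map_of_leadingCoeff_ne_zero _ hω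
  simp only [polyEv_apply, Real.norm_eq_abs]
  rw [abs_of_nonneg (integral_nonneg fun _ => abs_nonneg _)]
  set q := p.map (D.ev ω) with hq
  have hint := integrable_log_norm_eval q
  have hpt : ∀ t, |Real.log ‖q.eval (circleMap 0 1 t)‖| ≤ 2 * (Real.log (p.natDegree + 1 : ℕ) +
      ∑ i ∈ Finset.range (p.natDegree + 1), Real.posLog ‖D.ev ω (p.coeff i)‖) -
        Real.log ‖q.eval (circleMap 0 1 t)‖ := by
    intro t
    have h1 : Real.posLog ‖q.eval (circleMap 0 1 t)‖ ≤ Real.log (p.natDegree + 1 : ℕ) +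
        ∑ i ∈ Finset.range (p.natDegree + 1), Real.posLog ‖D.ev ω (p.coeff i)‖ := by
      have h2 : ‖q.eval (circleMap 0 1 t)‖ ≤
          ∑ i ∈ Finset.range (p.natDegree + 1), ‖D.ev ω (p.coeff i)‖ := by
        rw [eval_eq_sum_range, hnd]
        refine (norm_sum_le _ _).trans (Finset.sum_le_sum fun i _ => ?_)
        rw [norm_mul, norm_pow]
        simp [hq]
      refine (Real.posLog_le_posLog (norm_nonneg _) h2).trans ((Real.posLog_sum _ _).trans ?_)
      simp
    rw [← Real.half_mul_log_add_log_abs] at h1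
    linarith
  calc ∫ t, |Real.log ‖q.eval (circleMap 0 1 t)‖| ∂circleMeasure
      ≤ ∫ t, (2 * (Real.log (p.natDegree + 1 : ℕ) +
          ∑ i ∈ Finset.range (p.natDegree + 1), Real.posLog ‖D.ev ω (p.coeff i)‖) -
          Real.log ‖q.eval (circleMap 0 1 t)‖) ∂circleMeasure :=
        integral_mono hint.abs ((integrable_const _).sub hint) hpt
    _ = 2 * (Real.log (p.natDegree + 1 : ℕ) +
          ∑ i ∈ Finset.range (p.natDegree + 1), Real.posLog ‖D.ev ω (p.coeff i)‖) -
          q.logMahlerMeasure := by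
        rw [integral_sub (integrable_const _) hint, integral_log_norm_eval]
        simp
    _ ≤ _ := by
        gcongr
        rw [← hlc', logMahlerMeasure_eq_log_MahlerMeasure]
        exact Real.log_le_log (by rw [hlc']; exact norm_pos_iff.mpr hω)
          (leadingCoeff_le_mahlerMeasure q)

/-- The extension of a family of complex places to the polynomial ring, by evaluation of the
variable at the points of the unit circle. -/
noncomputable def poly : ArchData R[X] (Ω × ℝ) where
  μ := D.μ.prod circleMeasure
  finite := inferInstance
  ev := D.polyEv
  measurable := D.measurable_polyEv
  ae_ne _ := D.ae_polyEv_ne_zero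
  integrable _ := D.integrable_polyEv

theorem poly_mass : D.poly.mass = D.mass := by
  simp [mass, poly, Measure.real, Measure.prod_apply]

theorem integrable_logMahlerMeasure {p : R[X]} (hp : p ≠ 0) :
    Integrable (fun ω => (p.map (D.ev ω)).logMahlerMeasure) D.μ := by
  have := (D.integrable_polyEv hp).integral_prod_left
  simpa only [polyEv_apply, integral_log_norm_eval] using this

theorem poly_m {p : R[X]} (hp : p ≠ 0) :
    D.poly.m p = ∫ ω, (p.map (D.ev ω)).logMahlerMeasure ∂D.μ := by
  rw [m, poly, integral_prod _ (D.integrable_polyEv hp)]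
  simp only [polyEv_apply, integral_log_norm_eval]

theorem m_leadingCoeff_le {p : R[X]} (hp : p ≠ 0) : D.m p.leadingCoeff ≤ D.poly.m p := by
  have hlc : p.leadingCoeff ≠ 0 := by simpa using hp
  rw [D.poly_m hp, m]
  refine integral_mono_ae (D.integrable _ hlc) (D.integrable_logMahlerMeasure hp) ?_
  filter_upwards [D.ae_ne _ hlc] with ω hω
  rw [← leadingCoeff_map_of_leadingCoeff_ne_zero _ hω, logMahlerMeasure_eq_log_MahlerMeasure]
  refine Real.log_le_log ?_ (leadingCoeff_le_mahlerMeasure _)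
  rw [leadingCoeff_map_of_leadingCoeff_ne_zero _ hω]
  exact norm_pos_iff.mpr hω

end ArchData

end ReducedReduction

namespace ReducedReduction

open Polynomial MeasureTheory

/-! ### Splitting off the first variable -/

/-- Polynomials in `s + 1` variables as polynomials in the last `s` variables, whose coefficients
are polynomials in the first variable. -/
noncomputable def splitEquiv (s : ℕ) (R : Type*) [CommRing R] :
    MvPolynomial (Fin (s + 1)) R ≃ₐ[R] MvPolynomial (Fin s) R[X] :=
  (MvPolynomial.renameEquiv R (finSuccEquiv s)).trans (MvPolynomial.optionEquivRight R (Fin s))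

section Split

variable {R : Type*} [CommRing R] {s : ℕ}

theorem splitEquiv_C (r : R) :
    splitEquiv s R (MvPolynomial.C r) = MvPolynomial.C (Polynomial.C r) := by
  simp [splitEquiv]

theorem splitEquiv_X_zero :
    splitEquiv s R (MvPolynomial.X 0) = MvPolynomial.C Polynomial.X := by
  simp [splitEquiv]

theorem splitEquiv_X_succ (i : Fin s) :
    splitEquiv s R (MvPolynomial.X i.succ) = MvPolynomial.X i := by
  simp [splitEquiv]

theorem splitEquiv_monomial (α : Fin (s + 1) →₀ ℕ) (r : R) :
    splitEquiv s R (MvPolynomial.monomial α r) =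
      MvPolynomial.monomial α.tail (Polynomial.monomial (α 0) r) := by
  rw [MvPolynomial.monomial_eq, Finsupp.prod_fintype _ _ (by simp), Fin.prod_univ_succ, map_mul,
    map_mul, map_pow, map_prod, splitEquiv_C, splitEquiv_X_zero]
  simp only [map_pow, splitEquiv_X_succ]
  rw [MvPolynomial.monomial_eq, Finsupp.prod_fintype _ _ (by simp), ← mul_assoc, ← map_pow,
    ← map_mul, C_mul_X_pow_eq_monomial]
  rfl

theorem coeff_splitEquiv (F : MvPolynomial (Fin (s + 1)) R) (β : Fin s →₀ ℕ) (l : ℕ) :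
    ((splitEquiv s R F).coeff β).coeff l = F.coeff (Finsupp.cons l β) := by
  classical
  induction F using MvPolynomial.induction_on' with
  | monomial α r =>
    rw [splitEquiv_monomial, MvPolynomial.coeff_monomial, MvPolynomial.coeff_monomial]
    by_cases h : α = Finsupp.cons l β
    · subst h
      simp
    · rw [if_neg h]
      split_ifs with h1
      · rw [Polynomial.coeff_monomial, if_neg]
        rintro rfl
        exact h (by rw [← h1, Finsupp.cons_tail])
      · simp
  | add p q hp hq => simp [hp, hq]

theorem degree_cons (l : ℕ) (β : Fin s →₀ ℕ) :
    (Finsupp.cons l β).degree = l + β.degree := by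
  rw [Finsupp.degree_eq_sum, Finsupp.degree_eq_sum, Fin.sum_univ_succ]
  simp

theorem sum_support_splitEquiv {M : Type*} [AddCommMonoid M] (F : MvPolynomial (Fin (s + 1)) R)
    (f : (Fin (s + 1) →₀ ℕ) → M) :
    ∑ α ∈ F.support, f α = ∑ β ∈ (splitEquiv s R F).support,
      ∑ l ∈ ((splitEquiv s R F).coeff β).support, f (Finsupp.cons l β) := by
  rw [Finset.sum_sigma']
  refine (Finset.sum_nbij' (fun x => Finsupp.cons x.2 x.1) (fun α => ⟨α.tail, α 0⟩) ?_ ?_ ?_ ?_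
    ?_).symm
  · rintro ⟨β, l⟩ h
    simp only [Finset.mem_sigma, Polynomial.mem_support_iff, coeff_splitEquiv] at h
    exact MvPolynomial.mem_support_iff.mpr h.2
  · intro α hα
    have h1 : ((splitEquiv s R F).coeff α.tail).coeff (α 0) ≠ 0 := by
      rw [coeff_splitEquiv, Finsupp.cons_tail]
      exact MvPolynomial.mem_support_iff.mp hα
    simp only [Finset.mem_sigma, MvPolynomial.mem_support_iff, Polynomial.mem_support_iff]
    exact ⟨fun h => h1 (by rw [h, Polynomial.coeff_zero]), h1⟩
  · rintro ⟨β, l⟩ -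
    simp
  · intro α _
    simp
  · rintro ⟨β, l⟩ -
    rfl

end Split

/-! ### Archimedean bounds for the coefficients of a polynomial -/

theorem sum_choose (j M : ℕ) :
    ∑ l ∈ Finset.range (M + 1), (j + (M - l)).choose j = (j + 1 + M).choose (j + 1) := by
  rw [← Finset.sum_range_reflect]
  have := Nat.sum_range_add_choose M j
  rw [show j + 1 + M = M + j + 1 by ring, ← this]
  refine Finset.sum_congr rfl fun i hi => ?_
  have := Finset.mem_range.mp hi
  congr 1
  lia

theorem sum_mul_choose (j M : ℕ) :
    ∑ l ∈ Finset.range (M + 1), (l + 1) * (j + (M - l)).choose j = (j + 2 + M).choose (j + 2) := by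
  induction M with
  | zero => simp
  | succ M ih =>
    have h1 := sum_choose j M
    rw [Finset.sum_range_succ']
    have h2 : ∀ l ∈ Finset.range (M + 1), (l + 1 + 1) * (j + (M + 1 - (l + 1))).choose j =
        (l + 1) * (j + (M - l)).choose j + (j + (M - l)).choose j := by
      intro l _
      rw [Nat.add_sub_add_right]
      ring
    rw [Finset.sum_congr rfl h2, Finset.sum_add_distrib, ih, h1]
    rw [show j + 2 + (M + 1) = (j + 2 + M) + 1 by ring, show j + 2 = (j + 1) + 1 by ring,
      Nat.choose_succ_succ (j + 1 + 1 + M)]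
    rw [show j + 1 + 1 + M = (j + 1 + M) + 1 by ring, Nat.choose_succ_succ (j + 1 + M) j]
    simp only [zero_add, one_mul, Nat.sub_zero]
    rw [show j + (M + 1) = j + 1 + M by ring]
    simp only [Nat.succ_eq_add_one]
    ring

/-- Jensen's inequality for the logarithm. -/
theorem integral_log_le {Ω : Type*} [MeasurableSpace Ω] {ν : Measure Ω} [IsProbabilityMeasure ν]
    {f : Ω → ℝ} (hf : Integrable f ν) (hlog : Integrable (fun x => Real.log (f x)) ν)
    (hpos : ∀ᵐ x ∂ν, 0 < f x) : ∫ x, Real.log (f x) ∂ν ≤ Real.log (∫ x, f x ∂ν) := by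
  have hc : 0 < ∫ x, f x ∂ν := by
    rw [integral_pos_iff_support_of_nonneg_ae (hpos.mono fun x hx => hx.le) hf]
    have : Function.support f =ᵐ[ν] Set.univ := by
      filter_upwards [hpos] with x hx
      exact propext ⟨fun _ => trivial, fun _ => hx.ne'⟩
    rw [measure_congr this]
    simp
  set c := ∫ x, f x ∂ν with hcdef
  calc ∫ x, Real.log (f x) ∂ν ≤ ∫ x, (f x / c - 1 + Real.log c) ∂ν := by
        refine integral_mono_ae hlog (((hf.div_const c).sub (integrable_const 1)).add
          (integrable_const _)) ?_
        filter_upwards [hpos] with x hx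
        have h1 := Real.log_le_sub_one_of_pos (div_pos hx hc)
        rw [Real.log_div hx.ne' hc.ne'] at h1
        linarith
    _ = Real.log c := by
        rw [integral_add (f := fun x => f x / c - 1) ((hf.div_const c).sub (integrable_const 1))
            (integrable_const _),
          integral_sub (hf.div_const c) (integrable_const 1), integral_div]
        simp [← hcdef, hc.ne']

namespace ArchData

variable {R Ω : Type*} [CommRing R] [MeasurableSpace Ω] (D : ArchData R Ω) {s : ℕ}

/-- A bound for all weighted Euclidean norms of the coefficients of a polynomial of degree at most
`δ`. The weight of a monomial of degree `i` is compared with the number of monomials of degree at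
most `δ - i` in `j` further variables. -/
def Bound (F : MvPolynomial (Fin s) R) (A : ℝ) (j δ : ℕ) : Prop :=
  ∀ w : (Fin s →₀ ℕ) → ℝ, (∀ α, 0 ≤ w α) → (∃ α ∈ F.support, 0 < w α) →
    ∫ ω, 2⁻¹ * Real.log (∑ α ∈ F.support, w α * ‖D.ev ω (F.coeff α)‖ ^ 2) ∂D.μ ≤
      A + 2⁻¹ * D.mass * Real.log (∑ α ∈ F.support, w α * (j + (δ - α.degree)).choose j)

variable {D}

/-- By Jensen's inequality and Parseval's identity, the bound for the coefficients is inherited when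
a variable is moved to the coefficients. -/
theorem Bound.split {F : MvPolynomial (Fin (s + 1)) R} {A : ℝ} {j δ : ℕ} (h : D.Bound F A j δ)
    (hδ : ∀ α ∈ F.support, α.degree ≤ δ) : D.poly.Bound (splitEquiv s R F) A (j + 1) δ := by
  intro w hw ⟨β₀, hβ₀, hwβ₀⟩
  set F' := splitEquiv s R F with hF'
  obtain ⟨l₀, hl₀⟩ : ∃ l, (F'.coeff β₀).coeff l ≠ 0 :=
    IntVal.exists_coeff_ne_zero (MvPolynomial.mem_support_iff.mp hβ₀)
  have hα₀ : Finsupp.cons l₀ β₀ ∈ F.support := by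
    rw [MvPolynomial.mem_support_iff, ← coeff_splitEquiv]
    exact hl₀
  have hex : ∃ α ∈ F.support, 0 < w α.tail ∧ F.coeff α ≠ 0 :=
    ⟨_, hα₀, by simpa using hwβ₀, MvPolynomial.mem_support_iff.mp hα₀⟩
  have hex' : ∃ β ∈ F'.support, 0 < w β ∧ F'.coeff β ≠ 0 :=
    ⟨β₀, hβ₀, hwβ₀, MvPolynomial.mem_support_iff.mp hβ₀⟩
  have hint := D.poly.integrable_log_sum (s := F'.support) (w := w) (c := fun β => F'.coeff β)
    (fun i _ => hw i) hex'
  have hint' := D.integrable_log_sum (s := F.support) (w := fun α => w α.tail)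
    (c := fun α => F.coeff α) (fun i _ => hw _) hex
  have hpars : ∀ ω, ∫ t, ∑ β ∈ F'.support, w β * ‖D.polyEv (ω, t) (F'.coeff β)‖ ^ 2
      ∂circleMeasure = ∑ α ∈ F.support, w α.tail * ‖D.ev ω (F.coeff α)‖ ^ 2 := by
    intro ω
    rw [integral_finsetSum _ fun β _ => ?_, sum_support_splitEquiv]
    · refine Finset.sum_congr rfl fun β _ => ?_
      rw [integral_const_mul]
      simp only [polyEv_apply]
      rw [integral_norm_eval_sq, Finset.mul_sum]
      simp only [Finsupp.tail_cons, ← coeff_splitEquiv, Polynomial.coeff_map]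
      refine Finset.sum_subset (support_map_subset _ _) fun i _ hi => ?_
      rw [Polynomial.notMem_support_iff, Polynomial.coeff_map] at hi
      simp [hi]
    · simp only [polyEv_apply]
      exact (integrable_norm_eval_sq _).const_mul _
  have h1 : ∫ x, 2⁻¹ * Real.log (∑ β ∈ F'.support, w β * ‖D.poly.ev x (F'.coeff β)‖ ^ 2) ∂D.poly.μ ≤
      ∫ ω, 2⁻¹ * Real.log (∑ α ∈ F.support, w α.tail * ‖D.ev ω (F.coeff α)‖ ^ 2) ∂D.μ := by
    change Integrable _ (D.μ.prod circleMeasure) at hint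
    rw [integral_const_mul, integral_const_mul]
    refine mul_le_mul_of_nonneg_left ?_ (by norm_num)
    change ∫ x, _ ∂(D.μ.prod circleMeasure) ≤ _
    rw [integral_prod _ hint]
    refine integral_mono_ae hint.integral_prod_left hint' ?_
    have hpos : ∀ᵐ x ∂D.μ.prod circleMeasure, 0 < ∑ β ∈ F'.support, w β *
        ‖D.polyEv x (F'.coeff β)‖ ^ 2 :=
      D.poly.ae_sum_pos (fun i _ => hw i) hex'
    filter_upwards [Measure.ae_ae_of_ae_prod hpos, hint.prod_right_ae] with ω h2 h3
    rw [← hpars]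
    refine integral_log_le ?_ h3 h2
    refine integrable_finsetSum _ fun β _ => ?_
    change Integrable (fun t => w β * ‖D.polyEv (ω, t) (F'.coeff β)‖ ^ 2) circleMeasure
    simp only [polyEv_apply]
    exact (integrable_norm_eval_sq _).const_mul _
  refine h1.trans ((h (fun α => w α.tail) (fun α => hw _)
    ⟨_, hα₀, by simpa using hwβ₀⟩).trans ?_)
  rw [poly_mass]
  have hmass := D.mass_nonneg
  gcongr
  · refine Finset.sum_pos' (fun α _ => mul_nonneg (hw _) (by positivity)) ⟨_, hα₀, ?_⟩
    have : 0 < (j + (δ - (Finsupp.cons l₀ β₀).degree)).choose j := Nat.choose_pos (by lia)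
    rw [Finsupp.tail_cons]
    positivity
  · rw [sum_support_splitEquiv]
    refine Finset.sum_le_sum fun β hβ => ?_
    simp only [Finsupp.tail_cons]
    rw [← Finset.mul_sum]
    refine mul_le_mul_of_nonneg_left ?_ (hw β)
    have hdeg : ∀ l ∈ (F'.coeff β).support, l + β.degree ≤ δ := by
      intro l hl
      rw [← degree_cons]
      apply hδ
      rw [MvPolynomial.mem_support_iff, ← coeff_splitEquiv]
      exact Polynomial.mem_support_iff.mp hl
    rw [← sum_choose]
    push_cast
    refine (Finset.sum_le_sum_of_subset_of_nonneg (t := Finset.range (δ - β.degree + 1))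
      (fun l hl => ?_) (fun _ _ _ => by positivity)).trans (le_of_eq ?_)
    · have := hdeg l hl
      rw [Finset.mem_range]
      lia
    · refine Finset.sum_congr rfl fun l _ => ?_
      rw [degree_cons, add_comm l, Nat.sub_add_eq]

end ArchData

end ReducedReduction

namespace ReducedReduction

open Polynomial MeasureTheory

theorem choose_add_le_choose_add {j M n δ : ℕ} (hj : j ≤ n) (hM : M ≤ δ) :
    (j + M).choose j ≤ (n + δ).choose n := by
  calc (j + M).choose j = (j + M).choose M := Nat.choose_symm_add
    _ ≤ (n + M).choose M := Nat.choose_le_choose _ (by lia)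
    _ = (n + M).choose n := Nat.choose_symm_add.symm
    _ ≤ (n + δ).choose n := Nat.choose_le_choose _ (by lia)

theorem sum_sq_div_le (d : ℕ) :
    ∑ i ∈ Finset.range (d + 1), (i : ℝ) ^ 2 / (i + 1) ≤ (d : ℝ) * (d + 1) / 2 := by
  induction d with
  | zero => simp
  | succ d ih =>
    rw [Finset.sum_range_succ]
    have : ((d + 1 : ℕ) : ℝ) ^ 2 / ((d + 1 : ℕ) + 1) ≤ (d + 1 : ℕ) := by
      rw [div_le_iff₀ (by positivity)]
      push_cast
      nlinarith
    push_cast at this ⊢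
    linarith

/-- The sum of the absolute values of the coefficients, by the Cauchy-Schwarz inequality. -/
theorem sum_norm_coeff_le (p : ℂ[X]) {d δ : ℕ} (hd : d ≤ δ) (hδ : 2 ≤ δ) :
    ∑ i ∈ Finset.range (d + 1), ‖p.coeff i‖ ≤
      δ * √(∑ i ∈ Finset.range (d + 1), ((i : ℝ) + 1) * ‖p.coeff i‖ ^ 2) := by
  rw [← abs_of_nonneg (Finset.sum_nonneg fun i _ => norm_nonneg (p.coeff i)),
    ← Real.sqrt_sq_eq_abs, ← Real.sqrt_sq (Nat.cast_nonneg δ), ← Real.sqrt_mul (by positivity)]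
  refine Real.sqrt_le_sqrt ?_
  have h1 := Finset.sum_mul_sq_le_sq_mul_sq (Finset.range (d + 1))
    (fun i => (√((i : ℝ) + 1))⁻¹) (fun i => √((i : ℝ) + 1) * ‖p.coeff i‖)
  have h2 : ∀ i : ℕ, (√((i : ℝ) + 1))⁻¹ * (√((i : ℝ) + 1) * ‖p.coeff i‖) = ‖p.coeff i‖ := by
    intro i
    rw [← mul_assoc, inv_mul_cancel₀ (by positivity), one_mul]
  simp only [h2, mul_pow, inv_pow] at h1
  have h3 : ∀ i : ℕ, √((i : ℝ) + 1) ^ 2 = i + 1 := fun i => Real.sq_sqrt (by positivity)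
  simp only [h3] at h1
  refine h1.trans (mul_le_mul_of_nonneg_right ?_ (by positivity))
  calc ∑ i ∈ Finset.range (d + 1), ((i : ℝ) + 1)⁻¹ ≤ ∑ i ∈ Finset.range (d + 1), (1 : ℝ) :=
        Finset.sum_le_sum fun i _ => inv_le_one_of_one_le₀ (by simp)
    _ = d + 1 := by simp
    _ ≤ δ ^ 2 := by
        have : (d : ℝ) ≤ δ := by exact_mod_cast hd
        have : (2 : ℝ) ≤ δ := by exact_mod_cast hδ
        nlinarith

theorem sum_norm_coeff_derivative_le (p : ℂ[X]) {d δ : ℕ} (hd : d ≤ δ) (hd1 : 1 ≤ d) (hδ : 2 ≤ δ) :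
    ∑ i ∈ Finset.range (d - 1 + 1), ‖(derivative p).coeff i‖ ≤
      δ * √(∑ i ∈ Finset.range (d + 1), ((i : ℝ) + 1) * ‖p.coeff i‖ ^ 2) := by
  have h0 : ∑ i ∈ Finset.range (d - 1 + 1), ‖(derivative p).coeff i‖ =
      ∑ i ∈ Finset.range (d + 1), (i : ℝ) * ‖p.coeff i‖ := by
    rw [Finset.sum_range_succ' _ d, show d - 1 + 1 = d by lia]
    simp only [Nat.cast_zero, zero_mul, add_zero]
    refine Finset.sum_congr rfl fun i _ => ?_
    rw [coeff_derivative, norm_mul, mul_comm]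
    congr 1
    have : ((i : ℂ) + 1) = ((i + 1 : ℕ) : ℂ) := by push_cast; rfl
    rw [this, Complex.norm_natCast]
  rw [h0, ← abs_of_nonneg (Finset.sum_nonneg fun i _ => mul_nonneg (Nat.cast_nonneg i)
    (norm_nonneg (p.coeff i))), ← Real.sqrt_sq_eq_abs, ← Real.sqrt_sq (Nat.cast_nonneg δ),
    ← Real.sqrt_mul (by positivity)]
  refine Real.sqrt_le_sqrt ?_
  have h1 := Finset.sum_mul_sq_le_sq_mul_sq (Finset.range (d + 1))
    (fun i => (i : ℝ) / √((i : ℝ) + 1)) (fun i => √((i : ℝ) + 1) * ‖p.coeff i‖)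
  have h2 : ∀ i : ℕ, (i : ℝ) / √((i : ℝ) + 1) * (√((i : ℝ) + 1) * ‖p.coeff i‖) =
      i * ‖p.coeff i‖ := by
    intro i
    have : √((i : ℝ) + 1) ≠ 0 := by positivity
    field_simp
  simp only [h2, mul_pow, div_pow] at h1
  have h3 : ∀ i : ℕ, √((i : ℝ) + 1) ^ 2 = i + 1 := fun i => Real.sq_sqrt (by positivity)
  simp only [h3] at h1
  refine h1.trans (mul_le_mul_of_nonneg_right ?_ (by positivity))
  refine (sum_sq_div_le d).trans ?_
  have h4 : (d : ℝ) ≤ δ := by exact_mod_cast hd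
  have h5 : (2 : ℝ) ≤ δ := by exact_mod_cast hδ
  have h6 : (0 : ℝ) ≤ d := Nat.cast_nonneg d
  nlinarith

namespace ArchData

variable {R Ω : Type*} [CommRing R] [MeasurableSpace Ω] {D : ArchData R Ω} {s : ℕ}

theorem Bound.m_coeff_le {F : MvPolynomial (Fin s) R} {A : ℝ} {j δ n : ℕ} (h : D.Bound F A j δ)
    (hjn : j ≤ n) {α : Fin s →₀ ℕ} (hα : α ∈ F.support) :
    D.m (F.coeff α) ≤ A + 2⁻¹ * D.mass * Real.log ((n + δ).choose n) := by
  classical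
  have h1 := h (Pi.single α 1) (fun β => by
    by_cases hβ : β = α
    · simp [hβ]
    · simp [hβ]) ⟨α, hα, by simp⟩
  have h2 : ∀ f : (Fin s →₀ ℕ) → ℝ,
      ∑ β ∈ F.support, (Pi.single α 1 : (Fin s →₀ ℕ) → ℝ) β * f β = f α := by
    intro f
    rw [Finset.sum_eq_single_of_mem α hα]
    · simp
    · intro β _ hβ
      simp [hβ]
  simp only [h2] at h1
  have h3 : ∀ ω, 2⁻¹ * Real.log (‖D.ev ω (F.coeff α)‖ ^ 2) = Real.log ‖D.ev ω (F.coeff α)‖ := by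
    intro ω
    rw [Real.log_pow]
    push_cast; ring
  simp only [h3] at h1
  refine h1.trans ?_
  have hmass := D.mass_nonneg
  have h4 : (0 : ℝ) < ((j + (δ - α.degree)).choose j : ℕ) := by
    exact_mod_cast Nat.choose_pos (by lia)
  gcongr
  exact choose_add_le_choose_add hjn (by lia)

/-- The bound for the coefficients of a polynomial, applied to one of the one-variable polynomials
obtained by splitting off the first variable. -/
theorem Bound.integral_coeff_le {F : MvPolynomial (Fin (s + 1)) R} {A : ℝ} {j δ : ℕ}
    (h : D.Bound F A j δ) {β : Fin s →₀ ℕ} (hβ : β ∈ (splitEquiv s R F).support) {u : ℕ → ℝ}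
    (hu : ∀ l, 0 < u l) :
    ∫ ω, 2⁻¹ * Real.log (∑ l ∈ ((splitEquiv s R F).coeff β).support,
      u l * ‖D.ev ω (((splitEquiv s R F).coeff β).coeff l)‖ ^ 2) ∂D.μ ≤
    A + 2⁻¹ * D.mass * Real.log (∑ l ∈ ((splitEquiv s R F).coeff β).support,
      u l * (j + (δ - (l + β.degree))).choose j) := by
  classical
  obtain ⟨l₀, hl₀⟩ := IntVal.exists_coeff_ne_zero (MvPolynomial.mem_support_iff.mp hβ)
  have h1 := h (fun α => if α.tail = β then u (α 0) else 0)
    (fun α => by split_ifs <;> simp [(hu _).le])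
    ⟨Finsupp.cons l₀ β, by rwa [MvPolynomial.mem_support_iff, ← coeff_splitEquiv], by simp [hu]⟩
  have h2 : ∀ f : (Fin (s + 1) →₀ ℕ) → ℝ, ∑ α ∈ F.support,
      (if α.tail = β then u (α 0) else 0) * f α =
        ∑ l ∈ ((splitEquiv s R F).coeff β).support, u l * f (Finsupp.cons l β) := by
    intro f
    rw [sum_support_splitEquiv, Finset.sum_eq_single_of_mem β hβ]
    · simp
    · intro γ _ hγ
      simp [hγ]
  simp only [h2] at h1
  simpa only [coeff_splitEquiv, degree_cons] using h1

/-- A bound for the discriminant-like resultant of a polynomial in one variable. -/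
theorem m_resultant_derivative_le {p : R[X]} (hp : 1 ≤ p.natDegree)
    (hS : resultant p (derivative p) p.natDegree (p.natDegree - 1) ≠ 0) :
    D.m (resultant p (derivative p) p.natDegree (p.natDegree - 1)) ≤
      p.natDegree * (D.mass * Real.log p.natDegree) + (2 * p.natDegree - 1) *
        ∫ ω, 2⁻¹ * Real.log (∑ l ∈ p.support, 1 * ‖D.ev ω (p.coeff l)‖ ^ 2) ∂D.μ := by
  set d := p.natDegree with hd
  have hex : ∃ i ∈ p.support, (0 : ℝ) < 1 ∧ p.coeff i ≠ 0 := by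
    have hlc : p.coeff d ≠ 0 := by
      rw [coeff_natDegree]
      intro h
      rw [leadingCoeff_eq_zero] at h
      rw [hd, h] at hp
      simp at hp
    exact ⟨d, Polynomial.mem_support_iff.mpr hlc, one_pos, hlc⟩
  have hint := (D.integrable_log_sum (s := p.support) (w := fun _ => 1) (c := p.coeff)
    (fun _ _ => zero_le_one) hex).const_mul (2⁻¹ : ℝ)
  have hcalc : ∀ᵐ ω ∂D.μ, Real.log ‖D.ev ω (resultant p (derivative p) d (d - 1))‖ ≤
      d * Real.log d + (2 * d - 1) *
        (2⁻¹ * Real.log (∑ l ∈ p.support, 1 * ‖D.ev ω (p.coeff l)‖ ^ 2)) := by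
    filter_upwards [D.ae_ne _ hS, D.ae_sum_pos (s := p.support) (w := fun _ => 1) (c := p.coeff)
      (fun _ _ => zero_le_one) hex] with ω h1 h2
    have h3 := norm_resultant_derivative_le (p.map (D.ev ω)) hp
    rw [derivative_map, resultant_map_map] at h3
    simp only [Polynomial.coeff_map] at h3
    have h4 : ∑ i ∈ Finset.range (d + 1), ‖D.ev ω (p.coeff i)‖ ^ 2 =
        ∑ l ∈ p.support, 1 * ‖D.ev ω (p.coeff l)‖ ^ 2 := by
      simp only [one_mul]
      refine (Finset.sum_subset (fun i hi => ?_) fun i _ hi => ?_).symm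
      · rw [Finset.mem_range]
        exact Nat.lt_succ_of_le (le_natDegree_of_mem_supp i hi)
      · rw [Polynomial.notMem_support_iff] at hi
        simp [hi]
    rw [h4] at h3
    set Q := ∑ l ∈ p.support, 1 * ‖D.ev ω (p.coeff l)‖ ^ 2
    have hdpos : (0 : ℝ) < d := by exact_mod_cast hp
    refine (Real.log_le_log (norm_pos_iff.mpr h1) h3).trans (le_of_eq ?_)
    rw [Real.log_mul (by positivity) (by positivity), Real.log_pow, Real.log_pow,
      Real.log_sqrt h2.le, Nat.cast_sub (by lia)]
    push_cast
    ring
  have hint2 : Integrable (fun ω => (2 * (d : ℝ) - 1) *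
      (2⁻¹ * Real.log (∑ l ∈ p.support, 1 * ‖D.ev ω (p.coeff l)‖ ^ 2))) D.μ := hint.const_mul _
  refine (integral_mono_ae (D.integrable _ hS) ((integrable_const _).add hint2) hcalc).trans
    (le_of_eq ?_)
  simp only [Pi.add_apply]
  rw [integral_add (integrable_const _) hint2, integral_const_mul (2 * (d : ℝ) - 1), integral_const]
  simp only [smul_eq_mul, mass]
  ring

theorem m_resultant_le {g q c : R[X]} {E δ : ℕ} (hc : c ≠ 0) (hg : g ≠ 0) (hq : q.natDegree ≤ E)
    (hδ : 1 ≤ δ) (hρ : resultant g q g.natDegree E ≠ 0)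
    (hb : ∀ φ : R →+* ℂ, ∑ i ∈ Finset.range (E + 1), ‖φ (q.coeff i)‖ ≤
      δ * √(∑ l ∈ c.support, ((l : ℝ) + 1) * ‖φ (c.coeff l)‖ ^ 2)) :
    D.m (resultant g q g.natDegree E) ≤ E * D.poly.m g + g.natDegree * (D.mass * Real.log δ +
      ∫ ω, 2⁻¹ * Real.log (∑ l ∈ c.support, ((l : ℝ) + 1) * ‖D.ev ω (c.coeff l)‖ ^ 2) ∂D.μ) := by
  set e := g.natDegree with he
  have hex : ∃ i ∈ c.support, (0 : ℝ) < (i : ℝ) + 1 ∧ c.coeff i ≠ 0 := by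
    obtain ⟨i, hi⟩ := IntVal.exists_coeff_ne_zero hc
    exact ⟨i, Polynomial.mem_support_iff.mpr hi, by positivity, hi⟩
  have hint := (D.integrable_log_sum (s := c.support) (w := fun l => (l : ℝ) + 1) (c := c.coeff)
    (fun _ _ => by positivity) hex).const_mul (2⁻¹ : ℝ)
  have hlc : g.leadingCoeff ≠ 0 := by simpa using hg
  have hcalc : ∀ᵐ ω ∂D.μ, Real.log ‖D.ev ω (resultant g q e E)‖ ≤
      E * (g.map (D.ev ω)).logMahlerMeasure + e * (Real.log δ +
        2⁻¹ * Real.log (∑ l ∈ c.support, ((l : ℝ) + 1) * ‖D.ev ω (c.coeff l)‖ ^ 2)) := by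
    filter_upwards [D.ae_ne _ hρ, D.ae_ne _ hlc, D.ae_map_ne_zero hg,
      D.ae_sum_pos (s := c.support) (w := fun l => (l : ℝ) + 1) (c := c.coeff)
      (fun _ _ => by positivity) hex] with ω h1 h2 h0 h3
    have h4 := norm_resultant_le_mahlerMeasure (g.map (D.ev ω)) (q.map (D.ev ω))
      (natDegree_map_le.trans hq)
    rw [natDegree_map_of_leadingCoeff_ne_zero _ h2, resultant_map_map] at h4
    simp only [Polynomial.coeff_map] at h4
    have h5 := hb (D.ev ω)
    set Q := ∑ l ∈ c.support, ((l : ℝ) + 1) * ‖D.ev ω (c.coeff l)‖ ^ 2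
    have hM := mahlerMeasure_pos_of_ne_zero h0
    have h6 : ‖D.ev ω (resultant g q e E)‖ ≤
        (g.map (D.ev ω)).mahlerMeasure ^ E * (δ * √Q) ^ e := by
      refine h4.trans ?_
      gcongr
    have hδ' : (0 : ℝ) < δ := by exact_mod_cast hδ
    refine (Real.log_le_log (norm_pos_iff.mpr h1) h6).trans (le_of_eq ?_)
    rw [Real.log_mul (by positivity) (by positivity), Real.log_pow, Real.log_pow,
      Real.log_mul (by positivity) (by positivity), Real.log_sqrt h3.le,
      logMahlerMeasure_eq_log_MahlerMeasure]
    ring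
  have hint1 := (D.integrable_logMahlerMeasure hg).const_mul (E : ℝ)
  have hint2 : Integrable (fun ω => (e : ℝ) * (Real.log δ +
      2⁻¹ * Real.log (∑ l ∈ c.support, ((l : ℝ) + 1) * ‖D.ev ω (c.coeff l)‖ ^ 2))) D.μ :=
    ((integrable_const _).add hint).const_mul _
  refine (integral_mono_ae (D.integrable _ hρ) (hint1.add hint2) hcalc).trans (le_of_eq ?_)
  simp only [Pi.add_apply]
  rw [integral_add hint1 hint2, integral_const_mul (E : ℝ), integral_const_mul (e : ℝ),
    integral_add (integrable_const _) hint, integral_const, ← D.poly_m hg]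
  simp only [smul_eq_mul, mass]

theorem sum_range_eq_sum_support (φ : R →+* ℂ) (c : R[X]) {d : ℕ} (hd : c.natDegree ≤ d)
    (u : ℕ → ℝ) : ∑ i ∈ Finset.range (d + 1), u i * ‖φ (c.coeff i)‖ ^ 2 =
      ∑ l ∈ c.support, u l * ‖φ (c.coeff l)‖ ^ 2 := by
  refine (Finset.sum_subset (fun i hi => ?_) fun i _ hi => ?_).symm
  · rw [Finset.mem_range]
    exact Nat.lt_succ_of_le ((le_natDegree_of_mem_supp i hi).trans hd)
  · rw [Polynomial.notMem_support_iff] at hi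
    simp [hi]

/-- A bound for the resultant of a polynomial with a coefficient polynomial, or with the derivative
of a coefficient polynomial, of a polynomial in several variables. -/
theorem Bound.m_resultant_le {F : MvPolynomial (Fin (s + 1)) R} {A : ℝ} {j δ n d r : ℕ}
    (h : D.Bound F A j δ) (hjn : j + 2 ≤ n) (hδ2 : 2 ≤ δ) {β : Fin s →₀ ℕ}
    (hβ : β ∈ (splitEquiv s R F).support) (hr : r ≤ 1) (hrd : r ≤ d) (hdδ : d + β.degree ≤ δ)
    (hd : ((splitEquiv s R F).coeff β).natDegree ≤ d) {g : R[X]} (hg : g ≠ 0)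
    (hρ : resultant g (derivative^[r] ((splitEquiv s R F).coeff β)) g.natDegree (d - r) ≠ 0) :
    D.m (resultant g (derivative^[r] ((splitEquiv s R F).coeff β)) g.natDegree (d - r)) ≤
      (d - r : ℕ) * D.poly.m g + g.natDegree * (D.mass * Real.log δ +
        (A + 2⁻¹ * D.mass * Real.log ((n + δ).choose n))) := by
  set c := (splitEquiv s R F).coeff β with hc
  have hc0 : c ≠ 0 := MvPolynomial.mem_support_iff.mp hβ
  have hq : (derivative^[r] c).natDegree ≤ d - r :=
    (natDegree_iterate_derivative c r).trans (by lia)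
  refine (ArchData.m_resultant_le (δ := δ) hc0 hg hq (by lia) hρ fun φ => ?_).trans ?_
  · rw [← sum_range_eq_sum_support φ c hd]
    interval_cases r
    · simpa using sum_norm_coeff_le (c.map φ) (d := d) (by lia) hδ2
    · have := sum_norm_coeff_derivative_le (c.map φ) (d := d) (by lia) hrd hδ2
      rw [derivative_map] at this
      simpa using this
  · have hmass := D.mass_nonneg
    gcongr
    refine (h.integral_coeff_le hβ (u := fun l => (l : ℝ) + 1) (fun l => by positivity)).trans ?_
    have hle : ∀ l ∈ c.support, l ≤ δ - β.degree := fun l hl => by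
      have := le_natDegree_of_mem_supp l hl
      lia
    gcongr
    · obtain ⟨l, hl⟩ := IntVal.exists_coeff_ne_zero hc0
      refine Finset.sum_pos' (fun l _ => by positivity) ⟨l, Polynomial.mem_support_iff.mpr hl, ?_⟩
      have : 0 < (j + (δ - (l + β.degree))).choose j := Nat.choose_pos (by lia)
      positivity
    · calc ∑ l ∈ c.support, ((l : ℝ) + 1) * ((j + (δ - (l + β.degree))).choose j : ℕ)
          ≤ ∑ l ∈ Finset.range (δ - β.degree + 1),
            ((l : ℝ) + 1) * ((j + (δ - (l + β.degree))).choose j : ℕ) :=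
          Finset.sum_le_sum_of_subset_of_nonneg (fun l hl => by
            have := hle l hl
            rw [Finset.mem_range]
            lia) fun _ _ _ => by positivity
        _ = ((j + 2 + (δ - β.degree)).choose (j + 2) : ℕ) := by
          rw [← sum_mul_choose]
          push_cast
          refine Finset.sum_congr rfl fun l _ => ?_
          rw [add_comm l, Nat.sub_add_eq]
        _ ≤ ((n + δ).choose n : ℕ) := by
          exact_mod_cast choose_add_le_choose_add hjn (by lia)

/-- A bound for the resultant of a polynomial in one variable with its derivative. -/
theorem Bound.m_resultant_derivative_le {F : MvPolynomial (Fin 1) R} {A : ℝ} {j δ n : ℕ}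
    (h : D.Bound F A j δ) (hjn : j + 1 ≤ n)
    (hdδ : ((splitEquiv 0 R F).coeff 0).natDegree ≤ δ)
    (hd : 1 ≤ ((splitEquiv 0 R F).coeff 0).natDegree) {p : R[X]}
    (hp : p = (splitEquiv 0 R F).coeff 0)
    (hS : resultant p (derivative p) p.natDegree (p.natDegree - 1) ≠ 0) :
    D.m (resultant p (derivative p) p.natDegree (p.natDegree - 1)) ≤
      p.natDegree * (D.mass * Real.log δ) + (2 * p.natDegree - 1) *
        (A + 2⁻¹ * D.mass * Real.log ((n + δ).choose n)) := by
  rw [← hp] at hd hdδ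
  have hp0 : p ≠ 0 := by rintro rfl; simp at hd
  have hβ : (0 : Fin 0 →₀ ℕ) ∈ (splitEquiv 0 R F).support := by
    rw [MvPolynomial.mem_support_iff, ← hp]
    exact hp0
  refine (ArchData.m_resultant_derivative_le hd hS).trans ?_
  have hmass := D.mass_nonneg
  have hd' : (1 : ℝ) ≤ p.natDegree := by exact_mod_cast hd
  have h1 := h.integral_coeff_le hβ (u := fun _ => 1) (fun l => by positivity)
  rw [← hp] at h1
  have h2 : A + 2⁻¹ * D.mass * Real.log (∑ l ∈ p.support, 1 *
      ((j + (δ - (l + (0 : Fin 0 →₀ ℕ).degree))).choose j : ℕ)) ≤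
      A + 2⁻¹ * D.mass * Real.log ((n + δ).choose n) := by
    gcongr
    · obtain ⟨l, hl⟩ := IntVal.exists_coeff_ne_zero hp0
      refine Finset.sum_pos' (fun l _ => by positivity) ⟨l, Polynomial.mem_support_iff.mpr hl, ?_⟩
      have : 0 < (j + (δ - (l + (0 : Fin 0 →₀ ℕ).degree))).choose j := Nat.choose_pos (by lia)
      positivity
    · calc ∑ l ∈ p.support, (1 : ℝ) * ((j + (δ - (l + (0 : Fin 0 →₀ ℕ).degree))).choose j : ℕ)
          ≤ ∑ l ∈ Finset.range (δ + 1), (1 : ℝ) * ((j + (δ - l)).choose j : ℕ) := by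
            simp only [map_zero, add_zero]
            refine Finset.sum_le_sum_of_subset_of_nonneg (fun l hl => ?_) fun _ _ _ => by positivity
            have := le_natDegree_of_mem_supp l hl
            rw [Finset.mem_range]
            lia
        _ = ((j + 1 + δ).choose (j + 1) : ℕ) := by
          rw [← sum_choose]
          push_cast
          simp
        _ ≤ ((n + δ).choose n : ℕ) := by
          exact_mod_cast choose_add_le_choose_add hjn le_rfl
  have h3 := h1.trans h2
  have h4 : (0 : ℝ) ≤ 2 * p.natDegree - 1 := by linarith
  have h5 : (p.natDegree : ℝ) ≤ δ := by exact_mod_cast hdδ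
  gcongr

end ArchData

end ReducedReduction

namespace ReducedReduction

open Polynomial MeasureTheory Filter

/-! ### Families of places satisfying a product inequality -/

/-- The valuation given by the multiplicity of a prime element. -/
noncomputable def primeVal {R : Type*} [CommRing R] [IsDomain R] [WfDvdMonoid R] (g : R)
    (hg : Prime g) : IntVal R where
  toFun x := multiplicity g x
  map_mul' x y hx hy := by
    rw [multiplicity_mul hg (FiniteMultiplicity.of_not_isUnit hg.not_isUnit (mul_ne_zero hx hy))]
    push_cast
    rfl
  map_add' x y n hx hy hxy h1 h2 := by
    rcases le_or_gt n 0 with hn | hn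
    · exact hn.trans (by positivity)
    lift n to ℕ using hn.le
    have hf : ∀ {z : R}, z ≠ 0 → FiniteMultiplicity g z := fun hz =>
      FiniteMultiplicity.of_not_isUnit hg.not_isUnit hz
    rw [Nat.cast_le, ← (hf hx).pow_dvd_iff_le_multiplicity] at h1
    rw [Nat.cast_le, ← (hf hy).pow_dvd_iff_le_multiplicity] at h2
    rw [Nat.cast_le, ← (hf hxy).pow_dvd_iff_le_multiplicity]
    exact dvd_add h1 h2

section PrimeVal

variable {R : Type*} [CommRing R] [IsDomain R] [WfDvdMonoid R] {g : R} (hg : Prime g)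

theorem primeVal_apply (x : R) : primeVal g hg x = multiplicity g x := rfl

theorem le_primeVal {x : R} (hx : x ≠ 0) {k : ℕ} : (k : ℤ) ≤ primeVal g hg x ↔ g ^ k ∣ x := by
  rw [primeVal_apply, Nat.cast_le,
    (FiniteMultiplicity.of_not_isUnit hg.not_isUnit hx).pow_dvd_iff_le_multiplicity]

theorem primeVal_ge {x : R} {k : ℕ} : (primeVal g hg).Ge k x ↔ g ^ k ∣ x := by
  by_cases hx : x = 0
  · simp [hx]
  · exact ⟨fun h => (le_primeVal hg hx).mp (h.le hx), fun h => Or.inr ((le_primeVal hg hx).mpr h)⟩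

end PrimeVal

/-- A family of discrete and of complex places of a domain, with the inequality half of a product
formula. The sums over the discrete places have finitely many nonzero terms. -/
structure HeightData (R : Type*) [CommRing R] (ι Ω : Type*) [MeasurableSpace Ω] extends
    ArchData R Ω where
  /-- The discrete places. -/
  v : ι → IntVal R
  /-- The weights of the discrete places. -/
  w : ι → ℝ
  w_nonneg : ∀ i, 0 ≤ w i
  finite_support : ∀ x, x ≠ 0 → {i | v i x ≠ 0}.Finite
  sum_le : ∀ x, x ≠ 0 → ∑ᶠ i, w i * v i x ≤ toArchData.m x

namespace HeightData

variable {R ι Ω : Type*} [CommRing R] [MeasurableSpace Ω] (H : HeightData R ι Ω)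

/-- The sum over all discrete places. -/
noncomputable def tot (x : R) : ℝ := ∑ᶠ i, H.w i * H.v i x

theorem finite_support_mul {x : R} (hx : x ≠ 0) :
    (Function.support fun i => H.w i * H.v i x).Finite := by
  refine (H.finite_support x hx).subset fun i hi => ?_
  intro h
  apply hi
  simp [h]

theorem eventually_sum_eq {x : R} (hx : x ≠ 0) :
    ∀ᶠ T in (atTop : Filter (Finset ι)), ∑ i ∈ T, H.w i * H.v i x = H.tot x := by
  filter_upwards [eventually_ge_atTop (H.finite_support_mul hx).toFinset] with T hT
  rw [tot, finsum_eq_sum_of_support_subset]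
  intro i hi
  exact hT (by simpa using hi)

theorem eventually_sum_le {x : R} (hx : x ≠ 0) :
    ∀ᶠ T in (atTop : Filter (Finset ι)), ∑ i ∈ T, H.w i * H.v i x ≤ H.m x := by
  filter_upwards [H.eventually_sum_eq hx] with T hT
  rw [hT]
  exact H.sum_le x hx

/-- The defect of an element in the product inequality. -/
noncomputable def defect (x : R) : ℝ := H.m x - H.tot x

theorem defect_nonneg {x : R} (hx : x ≠ 0) : 0 ≤ H.defect x := sub_nonneg.mpr (H.sum_le x hx)

theorem defect_mul [IsDomain R] {x y : R} (hx : x ≠ 0) (hy : y ≠ 0) :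
    H.defect (x * y) = H.defect x + H.defect y := by
  have h : H.tot (x * y) = H.tot x + H.tot y := by
    rw [tot, tot, tot, ← finsum_add_distrib (H.finite_support_mul hx) (H.finite_support_mul hy)]
    refine finsum_congr fun i => ?_
    rw [IntVal.map_mul _ hx hy]
    push_cast
    ring
  rw [defect, H.m_mul hx hy, h, defect, defect]
  ring

theorem defect_one [IsDomain R] : H.defect 1 = 0 := by
  have := H.defect_mul (one_ne_zero (α := R)) one_ne_zero
  rw [mul_one] at this
  linarith

theorem defect_pow [IsDomain R] {x : R} (hx : x ≠ 0) (k : ℕ) :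
    H.defect (x ^ k) = k * H.defect x := by
  induction k with
  | zero => simp [defect_one]
  | succ k ih => rw [pow_succ, H.defect_mul (pow_ne_zero _ hx) hx, ih]; push_cast; ring

theorem finite_support_gauss [IsDomain R] {p : R[X]} (hp : p ≠ 0) :
    {i | (H.v i).gauss p ≠ 0}.Finite := by
  have hfin : (⋃ l ∈ p.support, {i | H.v i (p.coeff l) ≠ 0}).Finite :=
    p.support.finite_toSet.biUnion fun l hl =>
      H.finite_support _ (Polynomial.mem_support_iff.mp hl)
  refine hfin.subset fun i hi => ?_
  obtain ⟨d, hd⟩ := (H.v i).exists_lead_gauss hp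
  simp only [Set.mem_iUnion]
  refine ⟨d, Polynomial.mem_support_iff.mpr hd.ne_zero, ?_⟩
  change H.v i (p.coeff d) ≠ 0
  rw [hd.eq]
  exact hi

/-- The extension of a family of places to the polynomial ring: the Gauss extensions of the discrete
places, and the complex places with the variable on the unit circle. -/
noncomputable def poly [IsDomain R] : HeightData R[X] ι (Ω × ℝ) where
  toArchData := H.toArchData.poly
  v i := (H.v i).gauss
  w := H.w
  w_nonneg := H.w_nonneg
  finite_support _ hp := H.finite_support_gauss hp
  sum_le p hp := by
    classical
    have hlc : p.leadingCoeff ≠ 0 := by simpa using hp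
    refine le_trans ?_ ((H.sum_le _ hlc).trans (H.toArchData.m_leadingCoeff_le hp))
    rw [finsum_eq_sum_of_support_subset (s := (H.finite_support_gauss hp).toFinset ∪
        (H.finite_support _ hlc).toFinset) _ fun i hi => ?_,
      finsum_eq_sum_of_support_subset (s := (H.finite_support_gauss hp).toFinset ∪
        (H.finite_support _ hlc).toFinset) _ fun i hi => ?_]
    · refine Finset.sum_le_sum fun i _ => mul_le_mul_of_nonneg_left ?_ (H.w_nonneg i)
      exact_mod_cast (((H.v i).gauss.ge_self p).coeff p.natDegree).le (by rwa [coeff_natDegree])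
    · have : H.v i p.leadingCoeff ≠ 0 := fun h => hi (by simp [h])
      simp [this]
    · have : (H.v i).gauss p ≠ 0 := fun h => hi (by simp [h])
      simp [this]

variable [IsDomain R]

theorem exists_eq_prod_pow_mul {s : Finset R} (hs : ∀ g ∈ s, Prime g)
    (hs' : ∀ g ∈ s, ∀ h ∈ s, g ∣ h → g = h) {x : R} (hx : x ≠ 0) :
    ∃ y, y ≠ 0 ∧ x = (∏ g ∈ s, g ^ multiplicity g x) * y := by
  classical
  induction s using Finset.induction_on with
  | empty => exact ⟨x, hx, by simp⟩
  | insert g s hg ih =>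
    obtain ⟨y, hy, hxy⟩ := ih (fun h hh => hs h (by simp [hh]))
      (fun h hh k hk => hs' h (by simp [hh]) k (by simp [hk]))
    have hgp := hs g (by simp)
    have h1 : g ^ multiplicity g x ∣ (∏ h ∈ s, h ^ multiplicity h x) * y :=
      hxy ▸ pow_multiplicity_dvd g x
    have h2 : ¬ g ∣ ∏ h ∈ s, h ^ multiplicity h x := by
      intro h
      obtain ⟨k, hk, hgk⟩ := (hgp.dvd_finsetProd_iff _).mp h
      have := hs' g (by simp) k (by simp [hk]) (hgp.dvd_of_dvd_pow hgk)
      exact hg (this ▸ hk)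
    obtain ⟨z, rfl⟩ := hgp.pow_dvd_of_dvd_mul_left _ h2 h1
    refine ⟨z, right_ne_zero_of_mul hy, ?_⟩
    rw [Finset.prod_insert hg]
    conv_lhs => rw [hxy]
    ring

theorem sum_defect_le {s : Finset R} (hs : ∀ g ∈ s, Prime g)
    (hs' : ∀ g ∈ s, ∀ h ∈ s, g ∣ h → g = h) {x : R} (hx : x ≠ 0) :
    ∑ g ∈ s, H.defect g * multiplicity g x ≤ H.defect x := by
  classical
  obtain ⟨y, hy, hxy⟩ := exists_eq_prod_pow_mul hs hs' hx
  have key : ∀ (t : Finset R) (k : R → ℕ), (∀ g ∈ t, Prime g) →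
      H.defect (∏ g ∈ t, g ^ k g) = ∑ g ∈ t, H.defect g * k g := by
    intro t k ht
    induction t using Finset.induction_on with
    | empty => simp [defect_one]
    | insert g t hg ih =>
      have hg0 := (ht g (by simp)).ne_zero
      rw [Finset.prod_insert hg, Finset.sum_insert hg, H.defect_mul (pow_ne_zero _ hg0),
        ih fun h hh => ht h (by simp [hh]), H.defect_pow hg0, mul_comm]
      exact Finset.prod_ne_zero_iff.mpr fun h hh => pow_ne_zero _ (ht h (by simp [hh])).ne_zero
  have h1 : H.defect x = H.defect (∏ g ∈ s, g ^ multiplicity g x) + H.defect y := by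
    conv_lhs => rw [hxy]
    exact H.defect_mul (Finset.prod_ne_zero_iff.mpr fun h hh => pow_ne_zero _ (hs h hh).ne_zero) hy
  rw [h1, key s (fun g => multiplicity g x) hs]
  exact le_add_of_nonneg_right (H.defect_nonneg hy)

variable [WfDvdMonoid R]

/-- The family of places obtained by adding the multiplicities of finitely many prime elements. The
weight of a prime element is its defect in the product inequality. -/
noncomputable def adjoin (s : Finset R) (hs : ∀ g ∈ s, Prime g)
    (hs' : ∀ g ∈ s, ∀ h ∈ s, g ∣ h → g = h) : HeightData R (ι ⊕ s) Ω where
  toArchData := H.toArchData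
  v := Sum.elim H.v fun g => primeVal g.1 (hs g.1 g.2)
  w := Sum.elim H.w fun g => H.defect g.1
  w_nonneg := by
    rintro (i | g)
    · exact H.w_nonneg i
    · exact H.defect_nonneg (hs g.1 g.2).ne_zero
  finite_support x hx := by
    refine (((H.finite_support x hx).image Sum.inl).union
      (Set.finite_range Sum.inr)).subset ?_
    rintro (i | g) hi
    · exact Or.inl ⟨i, hi, rfl⟩
    · exact Or.inr ⟨g, rfl⟩
  sum_le x hx := by
    classical
    set f : ι ⊕ s → ℝ := fun i => Sum.elim H.w (fun g => H.defect g.1) i *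
      ((Sum.elim H.v fun g => primeVal g.1 (hs g.1 g.2)) i x : ℤ) with hf
    have h1 : ∑ᶠ i, f i = H.tot x + ∑ g : s, f (Sum.inr g) := by
      have hsupp : Function.support f ⊆
          (((H.finite_support_mul hx).toFinset.disjSum Finset.univ : Finset (ι ⊕ s)) : Set _) := by
        rintro (i | g) hi
        · simpa [hf] using hi
        · simp
      rw [finsum_eq_sum_of_support_subset _ hsupp, Finset.sum_disjSum, tot,
        finsum_eq_sum_of_support_subset (fun i => H.w i * (H.v i x : ℝ))
          (s := (H.finite_support_mul hx).toFinset) (by simp)]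
      simp [hf]
    have h2 := H.sum_defect_le hs hs' hx
    have h3 : ∑ g : s, f (Sum.inr g) = ∑ g ∈ s, H.defect g * multiplicity g x := by
      rw [← Finset.sum_coe_sort s]
      simp [hf, primeVal_apply]
    rw [h1, h3]
    rw [defect] at h2
    linarith

end HeightData

end ReducedReduction

namespace ReducedReduction

open Polynomial

/-! ### Valuations of polynomials in several variables -/

namespace IntVal

variable {R : Type*} [CommRing R] {s : ℕ}

/-- The least valuation of a coefficient of a polynomial in several variables. -/
noncomputable def mv (v : IntVal R) (F : MvPolynomial (Fin s) R) : ℤ := v.minVal fun α => F.coeff α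

/-- The coefficients of the monomials of degree larger than `N - k` do not have the least
valuation. Here `N` is meant to be the degree of the polynomial. -/
def TopSmall (v : IntVal R) (F : MvPolynomial (Fin s) R) (N k : ℕ) : Prop :=
  k ≤ N ∧ ∀ α : Fin s →₀ ℕ, N < α.degree + k → v.Ge (v.mv F + 1) (F.coeff α)

/-- Up to terms of larger valuation, the polynomial is divisible by the square of a polynomial which
is not congruent to a constant. -/
def NearSquare (v : IntVal R) (F : MvPolynomial (Fin s) R) : Prop :=
  ∃ (c : R) (U W : MvPolynomial (Fin s) R), v.Ge (v.mv F) c ∧ (∀ α, v.Ge 0 (U.coeff α)) ∧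
    (∀ α, v.Ge 0 (W.coeff α)) ∧
    (∀ α, v.Ge (v.mv F + 1) ((F - MvPolynomial.C c * U ^ 2 * W).coeff α)) ∧
    ∃ α, α ≠ 0 ∧ U.coeff α ≠ 0 ∧ v (U.coeff α) = 0

variable {v : IntVal R}

theorem finite_support_mv (F : MvPolynomial (Fin s) R) :
    (Function.support fun α => F.coeff α).Finite :=
  F.support.finite_toSet.subset fun i hi => by simpa using hi

theorem ge_mv (v : IntVal R) (F : MvPolynomial (Fin s) R) (α : Fin s →₀ ℕ) :
    v.Ge (v.mv F) (F.coeff α) :=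
  ge_minVal (finite_support_mv F) α

theorem exists_eq_mv (v : IntVal R) {F : MvPolynomial (Fin s) R} (hF : F ≠ 0) :
    ∃ α, F.coeff α ≠ 0 ∧ v (F.coeff α) = v.mv F := by
  obtain ⟨j, hj⟩ := MvPolynomial.ne_zero_iff.mp hF
  exact exists_eq_minVal (finite_support_mv F) hj

theorem mv_eq_of {F : MvPolynomial (Fin s) R} {t : ℤ} {α : Fin s →₀ ℕ} (hα : F.coeff α ≠ 0)
    (h : v (F.coeff α) = t) (hge : ∀ β, v.Ge t (F.coeff β)) : v.mv F = t := by
  rw [mv, minVal_eq (finite_support_mv F) hα, h]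
  rwa [h]

theorem TopSmall.mono {F : MvPolynomial (Fin s) R} {N k k' : ℕ} (h : v.TopSmall F N k)
    (hk : k' ≤ k) : v.TopSmall F N k' :=
  ⟨hk.trans h.1, fun α hα => h.2 α (by lia)⟩

theorem topSmall_zero {F : MvPolynomial (Fin s) R} {N : ℕ} (hN : ∀ α ∈ F.support, α.degree ≤ N) :
    v.TopSmall F N 0 := by
  refine ⟨Nat.zero_le _, fun α hα => Or.inl ?_⟩
  by_contra h
  have := hN α (MvPolynomial.mem_support_iff.mpr h)
  lia

variable [IsDomain R]

theorem mul_ge {P Q : MvPolynomial (Fin s) R} {a b : ℤ} (hP : ∀ α, v.Ge a (P.coeff α))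
    (hQ : ∀ α, v.Ge b (Q.coeff α)) (α : Fin s →₀ ℕ) : v.Ge (a + b) ((P * Q).coeff α) := by
  classical
  rw [MvPolynomial.coeff_mul]
  exact Ge.sum fun x _ => (hP _).mul (hQ _)

omit [IsDomain R] in
theorem C_ge {r : R} {a : ℤ} (hr : v.Ge a r) (α : Fin s →₀ ℕ) :
    v.Ge a ((MvPolynomial.C r : MvPolynomial (Fin s) R).coeff α) := by
  classical
  rw [MvPolynomial.coeff_C]
  split_ifs <;> simp [hr]

theorem splitEquiv_ge {F : MvPolynomial (Fin (s + 1)) R} {t : ℤ} :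
    (∀ β, v.gauss.Ge t ((splitEquiv s R F).coeff β)) ↔ ∀ α, v.Ge t (F.coeff α) := by
  constructor
  · intro h α
    have := (h α.tail).coeff (α 0)
    rwa [coeff_splitEquiv, Finsupp.cons_tail] at this
  · intro h β
    refine ge_gauss_iff.mpr fun i => ?_
    rw [coeff_splitEquiv]
    exact h _

theorem mv_splitEquiv {F : MvPolynomial (Fin (s + 1)) R} (hF : F ≠ 0) :
    v.gauss.mv (splitEquiv s R F) = v.mv F := by
  obtain ⟨α, hα, hα'⟩ := v.exists_eq_mv hF
  have h1 : ((splitEquiv s R F).coeff α.tail).coeff (α 0) = F.coeff α := by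
    rw [coeff_splitEquiv, Finsupp.cons_tail]
  have h2 : (splitEquiv s R F).coeff α.tail ≠ 0 := by
    intro h
    rw [h, Polynomial.coeff_zero] at h1
    exact hα h1.symm
  have h3 : ∀ β, v.gauss.Ge (v.mv F) ((splitEquiv s R F).coeff β) :=
    splitEquiv_ge.mpr (v.ge_mv F)
  refine mv_eq_of h2 (le_antisymm ?_ ((h3 _).le h2)) h3
  have h4 := ((v.gauss.ge_self ((splitEquiv s R F).coeff α.tail)).coeff (α 0))
  rw [h1] at h4
  exact (h4.le hα).trans hα'.le

/-- All coefficients of a polynomial with coefficients in `R[X]`, and their derivatives, are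
divisible by a polynomial of positive degree up to terms of larger valuation. -/
def NearCoeffs (v : IntVal R) (F : MvPolynomial (Fin s) R[X]) : Prop :=
  ∃ (U : R[X]) (d : ℕ), v.Lead U d 0 ∧ 1 ≤ d ∧
    ∀ β, v.Near U (v.gauss.mv F) (F.coeff β) ∧ v.Near U (v.gauss.mv F) (derivative (F.coeff β))

/-- If an approximate square factor is lost when the first variable is moved to the coefficients,
then it is an approximate factor of all coefficients and of their derivatives. -/
theorem NearSquare.split {F : MvPolynomial (Fin (s + 1)) R} (hF : F ≠ 0) (h : v.NearSquare F) :
    v.gauss.NearSquare (splitEquiv s R F) ∨ v.NearCoeffs (splitEquiv s R F) := by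
  obtain ⟨c, U, W, hc, hU, hW, hE, α, hα0, hα, hα'⟩ := h
  refine or_iff_not_imp_left.mpr fun hns => ?_
  set F' := splitEquiv s R F with hF'
  set U' := splitEquiv s R U
  set W' := splitEquiv s R W
  have hmv : v.gauss.mv F' = v.mv F := mv_splitEquiv hF
  have hU' : ∀ β, v.gauss.Ge 0 (U'.coeff β) := splitEquiv_ge.mpr hU
  have hW' : ∀ β, v.gauss.Ge 0 (W'.coeff β) := splitEquiv_ge.mpr hW
  have hc' : v.gauss.Ge (v.mv F) (C c) := ge_gauss_C.mpr hc
  have hE' : ∀ β, v.gauss.Ge (v.mv F + 1) ((F' - MvPolynomial.C (C c) * U' ^ 2 * W').coeff β) := by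
    have := splitEquiv_ge.mpr hE
    simpa only [map_sub, _root_.map_mul, _root_.map_pow, splitEquiv_C] using this
  have hU1 : ∀ β, β ≠ 0 → v.gauss.Ge 1 (U'.coeff β) := by
    intro β hβ
    by_contra h1
    have h2 : U'.coeff β ≠ 0 := fun h => h1 (Or.inl h)
    refine hns ⟨C c, U', W', by rwa [hmv], hU', hW', by rwa [hmv], β, hβ, h2, ?_⟩
    have h3 := (hU' β).le h2
    have h4 : ¬ 1 ≤ v.gauss (U'.coeff β) := fun h => h1 (Or.inr h)
    lia
  have hcoef : (U'.coeff α.tail).coeff (α 0) = U.coeff α := by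
    rw [coeff_splitEquiv, Finsupp.cons_tail]
  have htail : α.tail = 0 := by
    by_contra h0
    have h1 := (hU1 _ h0).coeff (α 0)
    rw [hcoef] at h1
    have := h1.le hα
    lia
  have hl : 1 ≤ α 0 := by
    by_contra h0
    apply hα0
    rw [← Finsupp.cons_tail α, htail, show α 0 = 0 by lia, Finsupp.cons_zero_zero]
  rw [htail] at hcoef
  set U0 := U'.coeff 0 with hU0
  have hU0ne : U0 ≠ 0 := by
    intro h
    rw [h, Polynomial.coeff_zero] at hcoef
    exact hα hcoef.symm
  have hg0 : v.gauss U0 = 0 := by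
    refine le_antisymm ?_ ((hU' 0).le hU0ne)
    have := ((v.gauss.ge_self U0).coeff (α 0))
    rw [hcoef] at this
    exact (this.le hα).trans hα'.le
  obtain ⟨d, hd⟩ := v.exists_lead_gauss hU0ne
  rw [hg0] at hd
  refine ⟨U0, d, hd, ?_, fun β => ?_⟩
  · by_contra h0
    have := hd.gt (α 0) (by lia)
    rw [hcoef] at this
    have := this.le hα
    lia
  -- The difference between the squares of `U'` and of its constant coefficient is negligible.
  have hdiff : ∀ β, v.gauss.Ge 1 ((U' - MvPolynomial.C U0).coeff β) := by
    intro β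
    by_cases h0 : β = 0
    · subst h0
      simp [hU0]
    · rw [MvPolynomial.coeff_sub, MvPolynomial.coeff_C, if_neg (Ne.symm h0), sub_zero]
      exact hU1 β h0
  have hsum : ∀ β, v.gauss.Ge 0 ((U' + MvPolynomial.C U0).coeff β) := by
    intro β
    rw [MvPolynomial.coeff_add]
    exact (hU' β).add (C_ge (hU' 0) β)
  have hE2 : v.gauss.Ge (v.mv F + 1) ((F' - MvPolynomial.C (C c) * U' ^ 2 * W').coeff β +
      (MvPolynomial.C (C c) *
        ((U' - MvPolynomial.C U0) * (U' + MvPolynomial.C U0) * W')).coeff β) := by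
    refine (hE' β).add ((mul_ge (C_ge hc') (mul_ge (mul_ge hdiff hsum) hW') β).mono ?_)
    lia
  rw [hmv]
  refine near_of_sq (c := c) (W := W'.coeff β) (hU' 0) (hW' β) hc hE2 ?_
  rw [← MvPolynomial.coeff_add]
  have h5 : C c * U0 ^ 2 * W'.coeff β = (MvPolynomial.C (C c * U0 ^ 2) * W').coeff β := by
    rw [MvPolynomial.coeff_C_mul]
  rw [h5, ← MvPolynomial.coeff_add]
  congr 1
  simp only [_root_.map_mul, _root_.map_pow]
  ring

/-- An approximate equality of two elements whose valuation is at least `t`. -/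
def Congr (v : IntVal R) (U : R[X]) (t : ℤ) (x y : R[X]) : Prop :=
  v.gauss.Ge t x ∧ v.gauss.Ge t y ∧ v.Near U t (x - y)

theorem Congr.mul {U x y x' y' : R[X]} {t t' : ℤ} (h : v.Congr U t x y) (h' : v.Congr U t' x' y') :
    v.Congr U (t + t') (x * x') (y * y') := by
  refine ⟨h.1.mul h'.1, h.2.1.mul h'.2.1, ?_⟩
  have h1 := h.2.2.mul h'.1
  have h2 := h'.2.2.mul h.2.1
  rw [add_comm] at h2
  have h3 := h1.add h2
  convert h3 using 1
  ring

theorem congr_one (U : R[X]) : v.Congr U 0 1 1 :=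
  ⟨ge_one, ge_one, by rw [sub_self]; exact near_of_ge (by simp)⟩

theorem Congr.pow {U x y : R[X]} {t : ℤ} (h : v.Congr U t x y) (k : ℕ) :
    v.Congr U (k * t) (x ^ k) (y ^ k) := by
  induction k with
  | zero => simpa using congr_one U
  | succ k ih =>
    rw [pow_succ, pow_succ]
    convert ih.mul h using 1
    push_cast
    ring

theorem Congr.prod {U : R[X]} {ι : Type*} {s : Finset ι} {x y : ι → R[X]} {t : ι → ℤ}
    (h : ∀ i ∈ s, v.Congr U (t i) (x i) (y i)) :
    v.Congr U (∑ i ∈ s, t i) (∏ i ∈ s, x i) (∏ i ∈ s, y i) := by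
  classical
  induction s using Finset.induction_on with
  | empty => simpa using congr_one U
  | insert a s ha ih =>
    rw [Finset.sum_insert ha, Finset.prod_insert ha, Finset.prod_insert ha]
    exact (h a (by simp)).mul (ih fun i hi => h i (by simp [hi]))

theorem Lead.pow {p : R[X]} {d : ℕ} {a : ℤ} (h : v.Lead p d a) (k : ℕ) :
    v.Lead (p ^ k) (k * d) (k * a) := by
  induction k with
  | zero =>
    refine ⟨by simp, by simp, fun i => ?_, fun i hi => ?_⟩
    · rw [pow_zero, coeff_one]
      split_ifs
      · simpa using ge_one
      · simp
    · rw [pow_zero, coeff_one, if_neg (by lia)]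
      simp
  | succ k ih =>
    rw [pow_succ]
    convert ih.mul h using 1
    · ring
    · push_cast; ring

omit [IsDomain R] in
theorem lead_C {z : R} (hz : z ≠ 0) : v.Lead (C z) 0 (v z) := by
  refine ⟨by simpa using hz, by simp, fun i => ?_, fun i hi => ?_⟩
  · rw [coeff_C]
    split_ifs
    · exact v.ge_self z
    · simp
  · rw [coeff_C, if_neg (by lia)]
    simp

theorem Lead.prod {ι : Type*} {s : Finset ι} {p : ι → R[X]} {d : ι → ℕ} {a : ι → ℤ}
    (h : ∀ i ∈ s, v.Lead (p i) (d i) (a i)) :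
    v.Lead (∏ i ∈ s, p i) (∑ i ∈ s, d i) (∑ i ∈ s, a i) := by
  classical
  induction s using Finset.induction_on with
  | empty => simpa using lead_C (v := v) (one_ne_zero (α := R))
  | insert j s hj ih =>
    rw [Finset.sum_insert hj, Finset.sum_insert hj, Finset.prod_insert hj]
    exact (h j (by simp)).mul (ih fun i hi => h i (by simp [hi]))

end IntVal

end ReducedReduction

namespace ReducedReduction

open Polynomial

/-! ### Splitting off a variable: the auxiliary resultants -/

section Step

variable {R : Type*} [CommRing R] [IsDomain R] {s : ℕ}

/-- The choices needed to compare a polynomial `F` with the polynomial obtained by moving the first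
variable to the coefficients: monomials `top` and `top'` of the largest degrees `N` and `N'`, the
factorisation of the coefficient of `top'` into primes, and for each prime `g` a coefficient with
the least multiplicity `ord g` of `g`, with a monomial `idx g` of largest degree. -/
structure StepData (F : MvPolynomial (Fin (s + 1)) R) (N : ℕ) where
  deg_le : ∀ α ∈ F.support, α.degree ≤ N
  /-- a monomial of largest degree -/
  top : Fin (s + 1) →₀ ℕ
  top_mem : top ∈ F.support
  deg_top : top.degree = N
  /-- the degree in the other variables -/
  N' : ℕ
  deg_le' : ∀ β ∈ (splitEquiv s R F).support, β.degree ≤ N'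
  /-- a monomial of largest degree in the other variables -/
  top' : Fin s →₀ ℕ
  top'_mem : top' ∈ (splitEquiv s R F).support
  deg_top' : top'.degree = N'
  /-- the prime divisors of positive degree of the coefficient of `top'` -/
  primes : Finset R[X]
  /-- the multiplicities of the prime divisors -/
  mult : R[X] → ℕ
  /-- the constant factor -/
  unit : R
  prime : ∀ g ∈ primes, Prime g
  one_le_natDegree : ∀ g ∈ primes, 1 ≤ g.natDegree
  one_le_mult : ∀ g ∈ primes, 1 ≤ mult g
  eq_of_dvd : ∀ g ∈ primes, ∀ h ∈ primes, g ∣ h → g = h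
  unit_ne_zero : unit ≠ 0
  eq_prod : (splitEquiv s R F).coeff top' = C unit * ∏ g ∈ primes, g ^ mult g
  /-- the monomial chosen for a prime divisor -/
  idx : R[X] → Fin s →₀ ℕ
  /-- the least multiplicity of a prime divisor in a coefficient -/
  ord : R[X] → ℕ
  idx_mem : ∀ g ∈ primes, idx g ∈ (splitEquiv s R F).support
  ord_le : ∀ g ∈ primes, ord g ≤ 1
  pow_ord_dvd : ∀ g ∈ primes, ∀ β, g ^ ord g ∣ (splitEquiv s R F).coeff β
  pow_ord_dvd_of_lt : ∀ g ∈ primes, ∀ β : Fin s →₀ ℕ, (idx g).degree < β.degree →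
    g ^ (ord g + 1) ∣ (splitEquiv s R F).coeff β
  not_pow_ord_dvd : ∀ g ∈ primes, ¬ g ^ (ord g + 1) ∣ (splitEquiv s R F).coeff (idx g)
  not_dvd : ∀ g ∈ primes, ¬ g ∣ derivative^[ord g] ((splitEquiv s R F).coeff (idx g))

/-- Among the coefficients not in a given class there is one whose monomial has largest degree. -/
theorem exists_max_degree {R' : Type*} [CommRing R'] (F : MvPolynomial (Fin s) R') {P : R' → Prop}
    (hP : P 0) (h : ∃ β, ¬ P (F.coeff β)) :
    ∃ β ∈ F.support, ¬ P (F.coeff β) ∧ ∀ γ : Fin s →₀ ℕ, β.degree < γ.degree → P (F.coeff γ) := by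
  have hmem : ∀ β, ¬ P (F.coeff β) → β ∈ F.support := by
    intro β hβ
    rw [MvPolynomial.mem_support_iff]
    intro h0
    rw [h0] at hβ
    exact hβ hP
  have hfin : {β | ¬ P (F.coeff β)}.Finite :=
    F.support.finite_toSet.subset fun β hβ => hmem β hβ
  obtain ⟨β, hβ, hmax⟩ := Set.exists_max_image _ (fun β : Fin s →₀ ℕ => β.degree) hfin h
  refine ⟨β, hmem β hβ, hβ, fun γ hγ => ?_⟩
  by_contra h
  exact absurd (hmax γ h) (not_le.mpr hγ)

theorem exists_stepData [UniqueFactorizationMonoid R] [CharZero R]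
    {F : MvPolynomial (Fin (s + 1)) R} {N : ℕ} (hsq : ∀ U, U ^ 2 ∣ F → ∃ r, U = MvPolynomial.C r)
    (hN : ∀ α ∈ F.support, α.degree ≤ N) (hN' : ∃ α ∈ F.support, α.degree = N) :
    Nonempty (StepData F N) := by
  obtain ⟨α, hα, hαN⟩ := hN'
  set F' := splitEquiv s R F with hF'
  have hF0 : F ≠ 0 := by
    rintro rfl
    simp at hα
  have hF'0 : F' ≠ 0 := by simpa [hF'] using hF0
  obtain ⟨β, hβ, -, hβmax⟩ := exists_max_degree F' (P := fun x => x = 0) rfl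
    (MvPolynomial.ne_zero_iff.mp hF'0)
  obtain ⟨t, m, z, ht, ht', hz, hprod⟩ :=
    exists_eq_prod_primes (F'.coeff β) (MvPolynomial.mem_support_iff.mp hβ)
  have key : ∀ g : R[X], ∃ (γ : Fin s →₀ ℕ) (r : ℕ), g ∈ t → γ ∈ F'.support ∧ r ≤ 1 ∧
      (∀ β, g ^ r ∣ F'.coeff β) ∧
      (∀ β : Fin s →₀ ℕ, γ.degree < β.degree → g ^ (r + 1) ∣ F'.coeff β) ∧
      (¬ g ^ (r + 1) ∣ F'.coeff γ) ∧ ¬ g ∣ derivative^[r] (F'.coeff γ) := by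
    intro g
    by_cases hg : g ∈ t
    swap
    · exact ⟨0, 0, fun h => absurd h hg⟩
    obtain ⟨hgp, hg1, -⟩ := ht g hg
    by_cases hdvd : ∀ β, g ∣ F'.coeff β
    · have h2 : ∃ β, ¬ g ^ 2 ∣ F'.coeff β := by
        by_contra! h
        have h3 : MvPolynomial.C (g ^ 2) ∣ F' := MvPolynomial.C_dvd_iff_dvd_coeff _ _ |>.mpr h
        obtain ⟨Q, hQ⟩ := h3
        have h4 : ((splitEquiv s R).symm (MvPolynomial.C g)) ^ 2 ∣ F := by
          refine ⟨(splitEquiv s R).symm Q, ?_⟩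
          apply (splitEquiv s R).injective
          rw [map_mul, map_pow, AlgEquiv.apply_symm_apply, AlgEquiv.apply_symm_apply, ← map_pow,
            ← hQ]
        obtain ⟨r, hr⟩ := hsq _ h4
        have h5 := congrArg (splitEquiv s R) hr
        rw [AlgEquiv.apply_symm_apply, splitEquiv_C] at h5
        have h6 := MvPolynomial.C_injective _ _ h5
        rw [h6, natDegree_C] at hg1
        lia
      obtain ⟨γ, hγ, hγ', hmax⟩ := exists_max_degree F' (P := fun x => g ^ 2 ∣ x) (dvd_zero _) h2
      refine ⟨γ, 1, fun _ => ⟨hγ, le_rfl, fun β => by simpa using hdvd β, hmax, hγ', fun h => ?_⟩⟩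
      exact hγ' (dvd_derivative_of_prime hgp hg1 (hdvd γ) (by simpa using h))
    · push Not at hdvd
      obtain ⟨γ, hγ, hγ', hmax⟩ := exists_max_degree F' (P := fun x => g ∣ x) (dvd_zero _) hdvd
      exact ⟨γ, 0, fun _ => ⟨hγ, zero_le_one, by simp, by simpa using hmax, by simpa using hγ',
        by simpa using hγ'⟩⟩
  choose idx ord hidx using key
  exact ⟨{
    deg_le := hN
    top := α
    top_mem := hα
    deg_top := hαN
    N' := β.degree
    deg_le' := fun γ hγ => by
      by_contra h
      exact MvPolynomial.mem_support_iff.mp hγ (hβmax γ (by lia))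
    top' := β
    top'_mem := hβ
    deg_top' := rfl
    primes := t
    mult := m
    unit := z
    prime := fun g hg => (ht g hg).1
    one_le_natDegree := fun g hg => (ht g hg).2.1
    one_le_mult := fun g hg => (ht g hg).2.2
    eq_of_dvd := ht'
    unit_ne_zero := hz
    eq_prod := hprod
    idx := idx
    ord := ord
    idx_mem := fun g hg => (hidx g hg).1
    ord_le := fun g hg => (hidx g hg).2.1
    pow_ord_dvd := fun g hg => (hidx g hg).2.2.1
    pow_ord_dvd_of_lt := fun g hg => (hidx g hg).2.2.2.1
    not_pow_ord_dvd := fun g hg => (hidx g hg).2.2.2.2.1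
    not_dvd := fun g hg => (hidx g hg).2.2.2.2.2 }⟩

namespace StepData

variable {F : MvPolynomial (Fin (s + 1)) R} {N : ℕ} (S : StepData F N)

/-- The coefficient whose prime divisors are considered. -/
noncomputable def lead : R[X] := (splitEquiv s R F).coeff S.top'

/-- The polynomial not divisible by a given prime divisor: a coefficient or its derivative. -/
noncomputable def partner (g : R[X]) : R[X] :=
  derivative^[S.ord g] ((splitEquiv s R F).coeff (S.idx g))

/-- The formal degree of the partner of a prime divisor. -/
noncomputable def formalDegree (g : R[X]) : ℕ := N - (S.idx g).degree - S.ord g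

/-- The resultant of a prime divisor and its partner. -/
noncomputable def res (g : R[X]) : R := resultant g (S.partner g) g.natDegree (S.formalDegree g)

/-- The degree of the product of the prime divisors. -/
def rad : ℕ := ∑ g ∈ S.primes, g.natDegree

include S in
omit [IsDomain R] in
theorem ne_zero : F ≠ 0 := by
  intro h
  have h1 := MvPolynomial.mem_support_iff.mp S.top_mem
  exact h1 (by simp [h])

omit [IsDomain R] in
theorem lead_ne_zero : S.lead ≠ 0 := MvPolynomial.mem_support_iff.mp S.top'_mem

include S in
omit [IsDomain R] in
theorem add_degree_le {β : Fin s →₀ ℕ} {l : ℕ} (h : ((splitEquiv s R F).coeff β).coeff l ≠ 0) :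
    l + β.degree ≤ N := by
  rw [← degree_cons]
  apply S.deg_le
  rwa [MvPolynomial.mem_support_iff, ← coeff_splitEquiv]

include S in
omit [IsDomain R] in
theorem natDegree_coeff_add_le {β : Fin s →₀ ℕ} (hβ : β ∈ (splitEquiv s R F).support) :
    ((splitEquiv s R F).coeff β).natDegree + β.degree ≤ N := by
  apply S.add_degree_le
  rw [coeff_natDegree]
  simpa using hβ

omit [IsDomain R] in
theorem N'_le : S.N' ≤ N := by
  have := S.natDegree_coeff_add_le S.top'_mem
  rw [S.deg_top'] at this
  lia

theorem ord_add_degree_le {g : R[X]} (hg : g ∈ S.primes) : S.ord g + (S.idx g).degree ≤ N := by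
  have h1 := S.natDegree_coeff_add_le (S.idx_mem g hg)
  have h2 := natDegree_le_of_dvd (S.pow_ord_dvd g hg (S.idx g))
    (MvPolynomial.mem_support_iff.mp (S.idx_mem g hg))
  rw [natDegree_pow] at h2
  have h3 := S.one_le_natDegree g hg
  nlinarith

omit [IsDomain R] in
theorem natDegree_partner_le {g : R[X]} (hg : g ∈ S.primes) :
    (S.partner g).natDegree ≤ S.formalDegree g := by
  have h1 := S.natDegree_coeff_add_le (S.idx_mem g hg)
  have h2 := natDegree_iterate_derivative ((splitEquiv s R F).coeff (S.idx g)) (S.ord g)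
  rw [partner, formalDegree]
  lia

theorem res_ne_zero {g : R[X]} (hg : g ∈ S.primes) : S.res g ≠ 0 :=
  resultant_ne_zero_of_prime (S.prime g hg) (S.one_le_natDegree g hg) (S.not_dvd g hg)
    (S.natDegree_partner_le hg)

theorem natDegree_lead : S.lead.natDegree = ∑ g ∈ S.primes, S.mult g * g.natDegree := by
  rw [lead, S.eq_prod, natDegree_C_mul S.unit_ne_zero, natDegree_prod _ _ fun g hg =>
    pow_ne_zero _ (S.prime g hg).ne_zero]
  simp

theorem rad_le : S.rad ≤ N - S.N' := by
  have h1 := S.natDegree_coeff_add_le S.top'_mem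
  have h2 := S.natDegree_lead
  rw [lead] at h2
  rw [S.deg_top'] at h1
  have h3 : S.rad ≤ ∑ g ∈ S.primes, S.mult g * g.natDegree :=
    Finset.sum_le_sum fun g hg => Nat.le_mul_of_pos_left _ (S.one_le_mult g hg)
  lia

/-! ### Lower bounds for the valuations of the auxiliary resultants -/

variable (v : IntVal R)

/-- The excess of the valuation of an auxiliary resultant over the lower bound that holds because
the resultant is bihomogeneous in the coefficients of the two polynomials. -/
noncomputable def excess (g : R[X]) : ℤ :=
  v (S.res g) - S.formalDegree g * v.gauss g - g.natDegree * v.mv F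

variable {v}

theorem ge_coeff (v : IntVal R) (β : Fin s →₀ ℕ) :
    v.gauss.Ge (v.mv F) ((splitEquiv s R F).coeff β) :=
  IntVal.splitEquiv_ge.mpr (v.ge_mv F) β

theorem ge_partner (v : IntVal R) {g : R[X]} (hg : g ∈ S.primes) :
    v.gauss.Ge (v.mv F) (S.partner g) := by
  have h := ge_coeff (F := F) v (S.idx g)
  have hr := S.ord_le g hg
  rw [partner]
  interval_cases S.ord g
  · exact h
  · exact h.derivative

/-- If the top coefficients of `F` and of a prime divisor have larger valuation, then so has the
auxiliary resultant. -/
theorem le_excess {g : R[X]} (hg : g ∈ S.primes) {d k κ : ℕ} (hd : v.Lead g d (v.gauss g))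
    (hk : k + d ≤ g.natDegree) (hκ : v.TopSmall F N κ) (hkκ : k ≤ κ) : (k : ℤ) ≤ S.excess v g := by
  have h := IntVal.ge_resultant (v := v) (f := g) (g := S.partner g) (m := g.natDegree)
    (n := S.formalDegree g) (k := k) (a := v.gauss g) (b := v.mv F) (by lia) (v.gauss.ge_self g)
    (S.ge_partner v hg) (fun i hi => hd.gt i (by lia)) (fun i hi => by
      have h1 := S.ord_add_degree_le hg
      have h2 : ∀ l, N < l + (S.idx g).degree + κ →
          v.Ge (v.mv F + 1) (((splitEquiv s R F).coeff (S.idx g)).coeff l) := by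
        intro l hl
        rw [coeff_splitEquiv]
        refine hκ.2 _ ?_
        rw [degree_cons]
        exact hl
      have hr := S.ord_le g hg
      rw [formalDegree] at hi
      rw [partner]
      interval_cases S.ord g
      · exact h2 i (by lia)
      · rw [Function.iterate_one, coeff_derivative]
        exact_mod_cast (h2 (i + 1) (by lia)).mul_natCast (i + 1))
  have := h.le (S.res_ne_zero hg)
  rw [excess, res]
  linarith

theorem excess_nonneg (v : IntVal R) {g : R[X]} (hg : g ∈ S.primes) : 0 ≤ S.excess v g := by
  obtain ⟨d, hd⟩ := v.exists_lead_gauss (S.prime g hg).ne_zero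
  have hdeg : d ≤ g.natDegree := le_natDegree_of_ne_zero hd.ne_zero
  exact_mod_cast S.le_excess hg hd (k := 0) (by lia)
    (IntVal.topSmall_zero S.deg_le) le_rfl

omit [IsDomain R] in
theorem mv_le_top (v : IntVal R) : v.mv F ≤ v (F.coeff S.top) :=
  (v.ge_mv F S.top).le (MvPolynomial.mem_support_iff.mp S.top_mem)

theorem mv_le_lead (v : IntVal R) : v.mv F ≤ v.gauss S.lead :=
  (ge_coeff (F := F) v S.top').le S.lead_ne_zero

/-- The gain at a discrete place: the excess, in the inequalities for the auxiliary resultants and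
for two coefficients of largest degree, over the obvious lower bounds. -/
noncomputable def gain (v : IntVal R) : ℤ :=
  ∑ g ∈ S.primes, S.excess v g + ((N : ℤ) - S.N' - S.rad) * (v (F.coeff S.top) - v.mv F) +
    ((N : ℤ) - S.N') * (v.gauss S.lead - v.mv F)

theorem mul_le_gain (v : IntVal R) :
    ((N : ℤ) - S.N') * (v.gauss S.lead - v.mv F) ≤ S.gain v := by
  have h1 : 0 ≤ ∑ g ∈ S.primes, S.excess v g := Finset.sum_nonneg fun g hg => S.excess_nonneg v hg
  have h2 := S.rad_le
  have h3 := S.N'_le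
  have h4 : 0 ≤ ((N : ℤ) - S.N' - S.rad) * (v (F.coeff S.top) - v.mv F) :=
    mul_nonneg (by lia) (sub_nonneg.mpr (S.mv_le_top v))
  rw [gain]
  lia

theorem gain_nonneg (v : IntVal R) : 0 ≤ S.gain v :=
  (mul_nonneg (by have := S.N'_le; lia) (sub_nonneg.mpr (S.mv_le_lead v))).trans (S.mul_le_gain v)

theorem le_gain_of_lt (v : IntVal R) (h : v.mv F < v.gauss S.lead) : (N : ℤ) - S.N' ≤ S.gain v := by
  refine le_trans ?_ (S.mul_le_gain v)
  have := S.N'_le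
  nlinarith

theorem lead_lead (v : IntVal R) {d : R[X] → ℕ}
    (hd : ∀ g ∈ S.primes, v.Lead g (d g) (v.gauss g)) :
    v.Lead S.lead (∑ g ∈ S.primes, S.mult g * d g)
      (v S.unit + ∑ g ∈ S.primes, S.mult g * v.gauss g) := by
  have h := (IntVal.lead_C (v := v) S.unit_ne_zero).mul
    (IntVal.Lead.prod (s := S.primes) fun g hg => (hd g hg).pow (S.mult g))
  rw [zero_add, ← S.eq_prod] at h
  exact h

theorem gauss_lead (v : IntVal R) :
    v.gauss S.lead = v S.unit + ∑ g ∈ S.primes, S.mult g * v.gauss g := by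
  have : ∀ g : R[X], ∃ d, g ∈ S.primes → v.Lead g d (v.gauss g) := by
    intro g
    by_cases hg : g ∈ S.primes
    · obtain ⟨d, hd⟩ := v.exists_lead_gauss (S.prime g hg).ne_zero
      exact ⟨d, fun _ => hd⟩
    · exact ⟨0, fun h => absurd h hg⟩
  choose d hd using this
  exact (S.lead_lead v hd).minVal_eq

/-- The gain when small top coefficients of `F` are not visible after splitting off a variable. -/
theorem le_gain_of_topSmall {κ : ℕ} (hκ : v.TopSmall F N κ) (h : v.gauss S.lead = v.mv F) :
    (κ : ℤ) ≤ S.gain v := by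
  rcases Nat.eq_zero_or_pos κ with rfl | hκ1
  · exact_mod_cast S.gain_nonneg v
  have : ∀ g : R[X], ∃ d, g ∈ S.primes → v.Lead g d (v.gauss g) := by
    intro g
    by_cases hg : g ∈ S.primes
    · obtain ⟨d, hd⟩ := v.exists_lead_gauss (S.prime g hg).ne_zero
      exact ⟨d, fun _ => hd⟩
    · exact ⟨0, fun h => absurd h hg⟩
  choose d hd using this
  have hlead := S.lead_lead v hd
  rw [← S.gauss_lead v, h] at hlead
  have hdle : ∀ g ∈ S.primes, d g ≤ g.natDegree := fun g hg =>
    le_natDegree_of_ne_zero (hd g hg).ne_zero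
  -- The largest index of a coefficient of least valuation of the leading coefficient is small.
  have h1 : ∑ g ∈ S.primes, S.mult g * d g + S.N' + κ ≤ N := by
    by_contra! hlt
    have h2 := hκ.2 (Finsupp.cons (∑ g ∈ S.primes, S.mult g * d g) S.top') (by
      rw [degree_cons, S.deg_top']
      exact hlt)
    rw [← coeff_splitEquiv] at h2
    have := h2.le hlead.ne_zero
    have h3 := hlead.eq
    rw [lead] at h3
    lia
  have h2 : ∑ g ∈ S.primes, d g ≤ ∑ g ∈ S.primes, S.mult g * d g :=
    Finset.sum_le_sum fun g hg => Nat.le_mul_of_pos_left _ (S.one_le_mult g hg)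
  have h3 : v.mv F + 1 ≤ v (F.coeff S.top) :=
    (hκ.2 S.top (by rw [S.deg_top]; lia)).le (MvPolynomial.mem_support_iff.mp S.top_mem)
  have h4 := S.rad_le
  have h5 := S.N'_le
  have h6 : (N : ℤ) - S.N' - S.rad ≤
      ((N : ℤ) - S.N' - S.rad) * (v (F.coeff S.top) - v.mv F) :=
    le_mul_of_one_le_right (by lia) (by lia)
  have h7 : (0 : ℤ) ≤ ((N : ℤ) - S.N' - S.rad) := by lia
  have h8 : 0 ≤ ((N : ℤ) - S.N') * (v.gauss S.lead - v.mv F) :=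
    mul_nonneg (by lia) (sub_nonneg.mpr (S.mv_le_lead v))
  have hexc : ∀ g ∈ S.primes, ((min (g.natDegree - d g) κ : ℕ) : ℤ) ≤ S.excess v g := fun g hg =>
    S.le_excess hg (hd g hg) (by have := hdle g hg; lia) hκ (min_le_right _ _)
  have hsum := Finset.sum_le_sum hexc
  suffices h9 : κ ≤ ∑ g ∈ S.primes, min (g.natDegree - d g) κ + (N - S.N' - S.rad) by
    rw [gain]
    have : ((∑ g ∈ S.primes, min (g.natDegree - d g) κ : ℕ) : ℤ) ≤
        ∑ g ∈ S.primes, S.excess v g := by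
      exact_mod_cast hsum
    lia
  by_cases hbig : ∃ g ∈ S.primes, κ ≤ g.natDegree - d g
  · obtain ⟨g, hg, hgκ⟩ := hbig
    have := Finset.single_le_sum (f := fun g => min (g.natDegree - d g) κ)
      (fun _ _ => Nat.zero_le _) hg
    simp only [min_eq_right hgκ] at this
    lia
  · push Not at hbig
    have h10 : ∑ g ∈ S.primes, min (g.natDegree - d g) κ + ∑ g ∈ S.primes, d g = S.rad := by
      rw [← Finset.sum_add_distrib]
      refine Finset.sum_congr rfl fun g hg => ?_
      have := hbig g hg
      have := hdle g hg
      lia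
    lia

/-- If the coefficients and their derivatives have a common approximate factor, then the excess of
some auxiliary resultant is positive: otherwise a Bézout identity for each prime divisor would
exhibit a constant as an approximate multiple of this factor. -/
theorem exists_excess_pos (hnear : v.NearCoeffs (splitEquiv s R F)) (h : v.gauss S.lead = v.mv F) :
    ∃ g ∈ S.primes, 1 ≤ S.excess v g := by
  by_contra! hall
  obtain ⟨U, d, hU, hd, hUβ⟩ := hnear
  rw [IntVal.mv_splitEquiv S.ne_zero] at hUβ
  set t := v.mv F
  have hbez : ∀ g : R[X], ∃ A : R[X], g ∈ S.primes → v.gauss.Ge (v (S.res g) - v.gauss g) A ∧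
      v.Congr U (v (S.res g)) (C (S.res g)) (g * A) := by
    intro g
    by_cases hg : g ∈ S.primes
    swap
    · exact ⟨0, fun h => absurd h hg⟩
    have h0 : S.excess v g = 0 := by
      have := hall g hg
      have := S.excess_nonneg v hg
      lia
    have hval : v (S.res g) = S.formalDegree g * v.gauss g + g.natDegree * t := by
      rw [excess] at h0
      linarith
    obtain ⟨A, B, hAB, hA, hB⟩ := IntVal.exists_bezout (v := v) (f := g) (g := S.partner g)
      (m := g.natDegree) (n := S.formalDegree g) le_rfl (S.natDegree_partner_le hg)
      (by have := S.one_le_natDegree g hg; lia) (v.gauss.ge_self g) (S.ge_partner v hg)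
    rw [← hval] at hA hB
    refine ⟨A, fun _ => ⟨hA, IntVal.ge_gauss_C.mpr (v.ge_self _), ?_, ?_⟩⟩
    · exact ((v.gauss.ge_self g).mul hA).mono (by lia)
    · have h1 : C (S.res g) - g * A = S.partner g * B := by
        rw [res, ← hAB]
        ring
      have h2 : v.Near U t (S.partner g) := by
        have hr := S.ord_le g hg
        rw [partner]
        interval_cases S.ord g
        · exact (hUβ _).1
        · exact (hUβ _).2
      rw [h1]
      have := h2.mul hB
      rwa [add_sub_cancel] at this
  choose A hA using hbez
  have hcongr := IntVal.Congr.prod (s := S.primes) fun g hg => ((hA g hg).2).pow (S.mult g)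
  have hunit : v.Congr U (v S.unit) (C S.unit) (C S.unit) :=
    ⟨IntVal.ge_gauss_C.mpr (v.ge_self _), IntVal.ge_gauss_C.mpr (v.ge_self _), by
      rw [sub_self]; exact IntVal.near_of_ge (by simp)⟩
  have htot := (hunit.mul hcongr).2.2
  have hne : ∀ g ∈ S.primes, S.res g ^ S.mult g ≠ 0 := fun g hg => pow_ne_zero _ (S.res_ne_zero hg)
  have hne' : S.unit * ∏ g ∈ S.primes, S.res g ^ S.mult g ≠ 0 :=
    mul_ne_zero S.unit_ne_zero (Finset.prod_ne_zero_iff.mpr hne)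
  have hvtot : v (S.unit * ∏ g ∈ S.primes, S.res g ^ S.mult g) =
      v S.unit + ∑ g ∈ S.primes, S.mult g * v (S.res g) := by
    rw [v.map_mul S.unit_ne_zero (Finset.prod_ne_zero_iff.mpr hne), IntVal.map_prod _ _ hne]
    congr 1
    exact Finset.sum_congr rfl fun g hg => IntVal.map_pow (S.res_ne_zero hg) _
  refine IntVal.not_near_C hU hd hne' ?_
  have hlead : C S.unit * ∏ g ∈ S.primes, (g * A g) ^ S.mult g =
      S.lead * ∏ g ∈ S.primes, A g ^ S.mult g := by
    rw [lead, S.eq_prod, mul_assoc, ← Finset.prod_mul_distrib]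
    simp only [mul_pow]
  have hprodA : v.gauss.Ge (∑ g ∈ S.primes, S.mult g * (v (S.res g) - v.gauss g))
      (∏ g ∈ S.primes, A g ^ S.mult g) := by
    refine IntVal.Ge.prod fun g hg => ?_
    have := IntVal.Ge.prod (v := v.gauss) (s := Finset.range (S.mult g)) fun _ _ => (hA g hg).1
    simpa [mul_sub] using this
  have hlast := (hUβ S.top').1.mul hprodA
  have hlast2 : v.Near U (v S.unit + ∑ g ∈ S.primes, S.mult g * v (S.res g))
      (S.lead * ∏ g ∈ S.primes, A g ^ S.mult g) := by
    rw [lead]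
    convert hlast using 1
    rw [← h, S.gauss_lead v, add_assoc, ← Finset.sum_add_distrib]
    congr 1
    refine Finset.sum_congr rfl fun g _ => ?_
    ring
  rw [hvtot]
  have := htot.add hlast2
  rw [hlead, sub_add_cancel] at this
  simpa only [map_mul, map_prod, map_pow] using this

/-- What is lost at a discrete place when a variable is split off is compensated by the gain. -/
theorem exists_le_add_gain (hN' : 1 ≤ S.N') {κ : ℕ}
    (hκ : v.TopSmall F N κ ∨ κ ≤ 1 ∧ v.NearSquare F) :
    ∃ κ' : ℕ, (v.gauss.TopSmall (splitEquiv s R F) S.N' κ' ∨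
      κ' ≤ 1 ∧ v.gauss.NearSquare (splitEquiv s R F)) ∧ (κ : ℤ) ≤ κ' + S.gain v := by
  have hmv : v.gauss.mv (splitEquiv s R F) = v.mv F := IntVal.mv_splitEquiv S.ne_zero
  have hzero : v.gauss.TopSmall (splitEquiv s R F) S.N' 0 := IntVal.topSmall_zero S.deg_le'
  have hgain := S.gain_nonneg v
  have hF'0 : splitEquiv s R F ≠ 0 := by simpa using S.ne_zero
  rcases (S.mv_le_lead v).lt_or_eq with hlt | heq
  · have hμ := S.le_gain_of_lt v hlt
    rcases hκ with hκ | ⟨hκ1, hκ⟩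
    · -- `β` is a monomial of largest degree among those whose coefficient has least valuation.
      obtain ⟨β, hβ, hβ', hmax⟩ := exists_max_degree (splitEquiv s R F)
        (P := fun x => v.gauss.Ge (v.mv F + 1) x) (by simp) (by
          obtain ⟨β, hβ, hβ'⟩ := v.gauss.exists_eq_mv hF'0
          refine ⟨β, fun h => ?_⟩
          have := h.le hβ
          lia)
      have hβN := S.deg_le' β hβ
      have htop : v.gauss.TopSmall (splitEquiv s R F) S.N' (S.N' - β.degree) := by
        refine ⟨Nat.sub_le _ _, fun γ hγ => ?_⟩
        rw [hmv]
        exact hmax γ (by lia)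
      refine ⟨min κ (S.N' - β.degree), Or.inl (htop.mono (min_le_right _ _)), ?_⟩
      have h1 : ∃ l, ¬ v.Ge (v.mv F + 1) (((splitEquiv s R F).coeff β).coeff l) := by
        by_contra! h
        exact hβ' (IntVal.ge_gauss_iff.mpr h)
      obtain ⟨l, hl⟩ := h1
      rw [coeff_splitEquiv] at hl
      have h2 : ¬ N < (Finsupp.cons l β).degree + κ := fun h => hl (hκ.2 _ h)
      rw [degree_cons] at h2
      have := S.N'_le
      lia
    · rcases hκ.split S.ne_zero with hns | hnear
      · exact ⟨κ, Or.inr ⟨hκ1, hns⟩, by lia⟩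
      by_cases htop : v.gauss.TopSmall (splitEquiv s R F) S.N' 1
      · exact ⟨κ, Or.inl (htop.mono hκ1), by lia⟩
      refine ⟨0, Or.inl hzero, ?_⟩
      suffices h : 1 ≤ N - S.N' by lia
      by_contra hN0
      -- All coefficients of top degree are constants, which cannot be approximate multiples.
      have h1 : ∃ β : Fin s →₀ ℕ, S.N' < β.degree + 1 ∧
          ¬ v.gauss.Ge (v.mv F + 1) ((splitEquiv s R F).coeff β) := by
        by_contra! h
        exact htop ⟨hN', fun β hβ => by rw [hmv]; exact h β hβ⟩
      obtain ⟨β, hβ, hβ'⟩ := h1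
      have hβ0 : (splitEquiv s R F).coeff β ≠ 0 := fun h => hβ' (Or.inl h)
      have hdeg := S.natDegree_coeff_add_le (MvPolynomial.mem_support_iff.mpr hβ0)
      obtain ⟨r, hr⟩ := natDegree_eq_zero.mp
        (show ((splitEquiv s R F).coeff β).natDegree = 0 by lia)
      obtain ⟨U, d, hU, hd, hUβ⟩ := hnear
      have hr0 : r ≠ 0 := by
        rintro rfl
        exact hβ0 (by rw [← hr, C_0])
      have hvr : v r = v.mv F := by
        have h2 := ge_coeff (F := F) v β
        rw [← hr] at h2 hβ'
        rw [IntVal.ge_gauss_C] at h2 hβ'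
        have := h2.le hr0
        have : ¬ v.mv F + 1 ≤ v r := fun h => hβ' (Or.inr h)
        lia
      have h3 := (hUβ β).1
      rw [hmv, ← hr, ← hvr] at h3
      exact IntVal.not_near_C hU hd hr0 h3
  · rcases hκ with hκ | ⟨hκ1, hκ⟩
    · refine ⟨0, Or.inl hzero, ?_⟩
      have := S.le_gain_of_topSmall hκ heq.symm
      lia
    · rcases hκ.split S.ne_zero with hns | hnear
      · exact ⟨κ, Or.inr ⟨hκ1, hns⟩, by lia⟩
      refine ⟨0, Or.inl hzero, ?_⟩
      obtain ⟨g, hg, hg1⟩ := S.exists_excess_pos hnear heq.symm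
      have h1 := Finset.single_le_sum (f := fun g => S.excess v g)
        (fun g hg => S.excess_nonneg v hg) hg
      have h2 := S.rad_le
      have h3 := S.N'_le
      have h4 : 0 ≤ ((N : ℤ) - S.N' - S.rad) * (v (F.coeff S.top) - v.mv F) :=
        mul_nonneg (by lia) (sub_nonneg.mpr (S.mv_le_top v))
      have h5 : 0 ≤ ((N : ℤ) - S.N') * (v.gauss S.lead - v.mv F) :=
        mul_nonneg (by lia) (sub_nonneg.mpr (S.mv_le_lead v))
      rw [gain]
      lia

end StepData

end Step

end ReducedReduction

namespace ReducedReduction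

open Polynomial MeasureTheory Filter

/-! ### The bound for polynomials in several variables -/

/-- The constant that bounds the logarithmic size of each coefficient of a polynomial that satisfies
`ArchData.Bound`, after any number of variables have been moved to the coefficients. -/
noncomputable def archConst {R Ω : Type*} [CommRing R] [MeasurableSpace Ω] (D : ArchData R Ω)
    (A : ℝ) (n δ : ℕ) : ℝ := A + 2⁻¹ * D.mass * Real.log ((n + δ).choose n)

section Base

variable {R : Type*} [CommRing R] [IsDomain R]

/-- The valuation of the resultant of a polynomial and its derivative, at a place where the leading
coefficients are small or where the polynomial has an approximate square factor. -/
theorem le_val_resultant_derivative {v : IntVal R} {F : MvPolynomial (Fin 1) R} {p : R[X]} {κ : ℕ}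
    (hF : F ≠ 0) (hp : p = (splitEquiv 0 R F).coeff 0) (hp1 : 1 ≤ p.natDegree)
    (hS : resultant p (derivative p) p.natDegree (p.natDegree - 1) ≠ 0)
    (hκ : v.TopSmall F p.natDegree κ ∨ κ ≤ 1 ∧ v.NearSquare F) :
    κ + (2 * (p.natDegree : ℤ) - 1) * v.mv F ≤
      v (resultant p (derivative p) p.natDegree (p.natDegree - 1)) := by
  have hpge : v.gauss.Ge (v.mv F) p := hp ▸ IntVal.splitEquiv_ge.mpr (v.ge_mv F) 0
  have hcast : ((p.natDegree - 1 : ℕ) : ℤ) = p.natDegree - 1 := by lia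
  have hgen : ∀ k : ℕ, v.TopSmall F p.natDegree k → k + (2 * (p.natDegree : ℤ) - 1) * v.mv F ≤
      v (resultant p (derivative p) p.natDegree (p.natDegree - 1)) := by
    intro k hk
    have hcoef : ∀ l, p.natDegree < l + k → v.Ge (v.mv F + 1) (p.coeff l) := by
      intro l hl
      rw [hp, coeff_splitEquiv]
      apply hk.2
      rw [degree_cons]
      simpa using hl
    have h := (IntVal.ge_resultant (k := k) (m := p.natDegree) (n := p.natDegree - 1)
      (by have := hk.1; lia) hpge hpge.derivative hcoef (fun i hi => by
        rw [coeff_derivative]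
        exact_mod_cast (hcoef (i + 1) (by lia)).mul_natCast (i + 1))).le hS
    rw [hcast] at h
    linarith
  rcases hκ with hκ | ⟨hκ1, hκ⟩
  · exact hgen κ hκ
  · have h0 : v.TopSmall F p.natDegree 0 := by
      refine IntVal.topSmall_zero fun α hα => ?_
      rw [← Finsupp.cons_tail α, degree_cons, Subsingleton.elim α.tail 0]
      simp only [map_zero, add_zero]
      apply le_natDegree_of_ne_zero
      rw [hp, coeff_splitEquiv, Subsingleton.elim (0 : Fin 0 →₀ ℕ) α.tail, Finsupp.cons_tail]
      exact MvPolynomial.mem_support_iff.mp hα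
    have h1 := hgen 0 h0
    rcases hκ.split hF with ⟨_, _, _, _, _, _, _, β, hβ, _⟩ | ⟨U, d, hU, hd, hUβ⟩
    · exact absurd (Subsingleton.elim β 0) hβ
    rw [IntVal.mv_splitEquiv hF] at hUβ
    obtain ⟨hn1, hn2⟩ := hUβ 0
    rw [← hp] at hn1 hn2
    -- Both polynomials are approximate multiples of `U`, hence so is the resultant. It is a
    -- constant, so its valuation is not the least possible one.
    obtain ⟨A, B, hAB, hA, hB⟩ := IntVal.exists_bezout (v := v) (f := p) (g := derivative p)
      (m := p.natDegree) (n := p.natDegree - 1) le_rfl (natDegree_derivative_le p) (by lia) hpge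
      hpge.derivative
    by_contra! hlt
    have hval : v (resultant p (derivative p) p.natDegree (p.natDegree - 1)) =
        (2 * (p.natDegree : ℤ) - 1) * v.mv F := by
      generalize (2 * (p.natDegree : ℤ) - 1) * v.mv F = Z at h1 hlt ⊢
      push_cast at h1
      lia
    refine IntVal.not_near_C hU hd hS ?_
    rw [← hAB, hval]
    have hsum : ∀ {x y : ℤ}, y = 2 * (p.natDegree : ℤ) * v.mv F - 2 * v.mv F →
        x = v.mv F + y → x = (2 * (p.natDegree : ℤ) - 1) * v.mv F := by
      intro x y hy hx
      rw [hx, hy]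
      ring
    have e : ((p.natDegree - 1 : ℕ) : ℤ) * v.mv F + p.natDegree * v.mv F - v.mv F =
        2 * (p.natDegree : ℤ) * v.mv F - 2 * v.mv F := by
      rw [hcast]
      ring
    have h2 := hn1.mul hA
    have h3 := hn2.mul hB
    rw [hsum e rfl] at h2 h3
    exact h2.add h3

end Base

universe u w

/-- The central estimate: a bound for the weighted number of discrete places at which the top
coefficients of a polynomial without nonconstant square factors are small, or at which it has an
approximate square factor. The proof is by induction on the number of variables: the first variable
is moved to the coefficients, and the places given by the prime divisors of a coefficient of largest
degree are added. What is lost at a place is compensated by the product inequalities for the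
auxiliary resultants and for two coefficients of largest degree. -/
theorem HeightData.eventually_sum_add_le {s : ℕ} : ∀ {R ι : Type u} {Ω : Type w} [CommRing R]
    [IsDomain R] [UniqueFactorizationMonoid R] [CharZero R] [MeasurableSpace Ω]
    (H : HeightData R ι Ω) {F : MvPolynomial (Fin (s + 1)) R} {A : ℝ} {j δ n N : ℕ},
    (∀ U, U ^ 2 ∣ F → ∃ r, U = MvPolynomial.C r) →
    (∃ α ∈ F.support, 1 ≤ α (Fin.last s)) → (∀ α ∈ F.support, α.degree ≤ N) →
    (∃ α ∈ F.support, α.degree = N) → N ≤ δ → j + s + 1 = n → H.Bound F A j δ →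
    ∀ κ : ι → ℕ, (∀ i, (H.v i).TopSmall F N (κ i) ∨ κ i ≤ 1 ∧ (H.v i).NearSquare F) →
    ∀ᶠ T in (atTop : Filter (Finset ι)),
      ∑ i ∈ T, H.w i * (κ i + (2 * N - 1) * (H.v i).mv F) ≤
        (2 * N - 1) * archConst H.toArchData A n δ + N * (H.mass * Real.log δ) := by
  induction s with
  | zero =>
    intro R ι Ω _ _ _ _ _ H F A j δ n N hsq hlast hN hN' hNδ hjn hB κ hκ
    set p := (splitEquiv 0 R F).coeff 0 with hp
    have hcoef : ∀ α : Fin 1 →₀ ℕ, p.coeff (α 0) = F.coeff α := by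
      intro α
      rw [hp, coeff_splitEquiv, Subsingleton.elim (0 : Fin 0 →₀ ℕ) α.tail, Finsupp.cons_tail]
    have hdegα : ∀ α : Fin 1 →₀ ℕ, α.degree = α 0 := by
      intro α
      simp [Finsupp.degree_eq_sum]
    obtain ⟨α, hα, hαN⟩ := hN'
    obtain ⟨α₁, hα₁, hα₁1⟩ := hlast
    have hF : F ≠ 0 := by
      rintro rfl
      simp at hα
    have hpN : p.natDegree = N := by
      refine le_antisymm ?_ ?_
      · rw [natDegree_le_iff_coeff_eq_zero]
        intro l hl
        by_contra h
        have h1 := hN (Finsupp.cons l 0) (by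
          rw [MvPolynomial.mem_support_iff, ← coeff_splitEquiv]
          exact h)
        rw [degree_cons] at h1
        simp at h1
        lia
      · apply le_natDegree_of_ne_zero
        rw [← hαN, hdegα, hcoef]
        exact MvPolynomial.mem_support_iff.mp hα
    have hN1 : 1 ≤ N := by
      have := hN α₁ hα₁
      rw [hdegα] at this
      exact hα₁1.trans this
    have hsplit : splitEquiv 0 R F = MvPolynomial.C p := by
      rw [hp]
      exact MvPolynomial.eq_C_of_isEmpty _
    have hS : resultant p (derivative p) p.natDegree (p.natDegree - 1) ≠ 0 := by
      refine resultant_derivative_ne_zero (by lia) fun u hu => ?_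
      obtain ⟨q, hq⟩ := hu
      obtain ⟨r, hr⟩ := hsq ((splitEquiv 0 R).symm (MvPolynomial.C u)) (by
        refine ⟨(splitEquiv 0 R).symm (MvPolynomial.C q), ?_⟩
        apply (splitEquiv 0 R).injective
        rw [map_mul, map_pow, AlgEquiv.apply_symm_apply, AlgEquiv.apply_symm_apply, ← map_pow,
          ← map_mul, ← hq, hsplit])
      have h5 := congrArg (splitEquiv 0 R) hr
      rw [AlgEquiv.apply_symm_apply, splitEquiv_C] at h5
      rw [MvPolynomial.C_injective _ _ h5, natDegree_C]
    have harch := hB.m_resultant_derivative_le (n := n) (by lia) (by rw [← hp]; lia)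
      (by rw [← hp]; lia) hp hS
    filter_upwards [H.eventually_sum_le hS] with T hT
    rw [hpN] at harch hT
    refine le_trans ?_ (hT.trans (harch.trans (le_of_eq ?_)))
    · refine Finset.sum_le_sum fun i _ => mul_le_mul_of_nonneg_left ?_ (H.w_nonneg i)
      have h := le_val_resultant_derivative hF hp (by lia) hS (by rw [hpN]; exact hκ i)
      rw [hpN] at h
      exact_mod_cast h
    · rw [archConst]
      ring
  | succ s ih =>
    intro R ι Ω _ _ _ _ _ H F A j δ n N hsq hlast hN hN' hNδ hjn hB κ hκ
    obtain ⟨S⟩ := exists_stepData hsq hN hN'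
    obtain ⟨α₁, hα₁, hα₁1⟩ := hlast
    -- The last variable still occurs after splitting off the first one.
    have hlast' : ∃ β ∈ (splitEquiv (s + 1) R F).support, 1 ≤ β (Fin.last s) := by
      refine ⟨α₁.tail, ?_, by rw [Finsupp.tail_apply, Fin.succ_last]; exact hα₁1⟩
      rw [MvPolynomial.mem_support_iff]
      intro h
      have h1 := coeff_splitEquiv F α₁.tail (α₁ 0)
      rw [h, Polynomial.coeff_zero, Finsupp.cons_tail] at h1
      exact MvPolynomial.mem_support_iff.mp hα₁ h1.symm
    have hN'1 : 1 ≤ S.N' := by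
      obtain ⟨β, hβ, hβ1⟩ := hlast'
      exact hβ1.trans ((Finsupp.le_degree _ β).trans (S.deg_le' β hβ))
    have hsq' : ∀ U, U ^ 2 ∣ splitEquiv (s + 1) R F → ∃ r, U = MvPolynomial.C r := by
      rintro U ⟨Q, hQ⟩
      obtain ⟨r, hr⟩ := hsq ((splitEquiv (s + 1) R).symm U) ⟨(splitEquiv (s + 1) R).symm Q, by
        rw [← map_pow, ← map_mul, ← hQ, AlgEquiv.symm_apply_apply]⟩
      refine ⟨C r, ?_⟩
      rw [← splitEquiv_C, ← hr, AlgEquiv.apply_symm_apply]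
    set B := archConst H.toArchData A n δ with hBdef
    have hmassH : H.poly.toArchData.mass = H.mass := H.toArchData.poly_mass
    have hB' := hB.split fun α hα => (hN α hα).trans hNδ
    -- The numbers `κ'` are what remains of `κ` at the old places.
    choose κ' hκ' hgain using fun i => S.exists_le_add_gain hN'1 (hκ i)
    have hprime := S.prime
    let H' := H.poly.adjoin S.primes S.prime S.eq_of_dvd
    -- The multiplicity of a prime divisor in the new polynomial.
    have hmvg : ∀ g (hg : g ∈ S.primes), (primeVal g (S.prime g hg)).mv (splitEquiv (s + 1) R F) =
        S.ord g := by
      intro g hg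
      have h0 := MvPolynomial.mem_support_iff.mp (S.idx_mem g hg)
      refine IntVal.mv_eq_of h0 (le_antisymm ?_ ?_) fun β =>
        (primeVal_ge (S.prime g hg)).mpr (S.pow_ord_dvd g hg β)
      · by_contra! h
        exact S.not_pow_ord_dvd g hg ((le_primeVal (S.prime g hg) h0).mp (by push_cast; lia))
      · exact (le_primeVal (S.prime g hg) h0).mpr (S.pow_ord_dvd g hg _)
    have hih := ih H' (A := A) (j := j + 1) (δ := δ) (n := n) (N := S.N') hsq' hlast' S.deg_le'
      ⟨_, S.top'_mem, S.deg_top'⟩ (S.N'_le.trans hNδ) (by lia) hB'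
      (Sum.elim κ' fun g : S.primes => S.N' - (S.idx g.1).degree) (by
        rintro (i | g)
        · exact hκ' i
        · refine Or.inl ⟨Nat.sub_le _ _, fun β hβ => ?_⟩
          change (primeVal g.1 (S.prime g.1 g.2)).Ge _ _
          change _ < _ + (S.N' - (S.idx g.1).degree) at hβ
          have h1 := hmvg g.1 g.2
          have h2 : (H'.v (Sum.inr g)).mv (splitEquiv (s + 1) R F) = S.ord g.1 := h1
          rw [h2]
          have h3 := S.deg_le' _ (S.idx_mem g.1 g.2)
          exact_mod_cast (primeVal_ge (S.prime g.1 g.2)).mpr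
            (S.pow_ord_dvd_of_lt g.1 g.2 β (by lia)))
    obtain ⟨T₀, hT₀⟩ := eventually_atTop.mp hih
    have hmF : ∀ i, (H.v i).gauss.mv (splitEquiv (s + 1) R F) = (H.v i).mv F :=
      fun i => IntVal.mv_splitEquiv S.ne_zero
    have htop0 : F.coeff S.top ≠ 0 := MvPolynomial.mem_support_iff.mp S.top_mem
    have hδ1 : 1 ≤ δ := by have := S.N'_le; lia
    set L := H.mass * Real.log δ with hL
    have hL0 : 0 ≤ L := mul_nonneg H.toArchData.mass_nonneg (Real.log_natCast_nonneg δ)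
    have hmtop : H.m (F.coeff S.top) ≤ B := hB.m_coeff_le (by lia) S.top_mem
    have hmlead : H.poly.m S.lead ≤ B := by
      have := hB'.m_coeff_le (n := n) (by lia) S.top'_mem
      rwa [ArchData.poly_mass] at this
    have hdefect : ∑ g ∈ S.primes, H.poly.defect g ≤ B - H.poly.tot S.lead := by
      refine le_trans (Finset.sum_le_sum fun g hg => ?_) ((H.poly.sum_defect_le S.prime S.eq_of_dvd
        S.lead_ne_zero).trans (sub_le_sub_right hmlead _))
      have h1 : 1 ≤ multiplicity g S.lead := by
        have hdvd : g ^ 1 ∣ S.lead := by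
          rw [pow_one, StepData.lead, S.eq_prod]
          exact ((dvd_pow_self g (by have := S.one_le_mult g hg; lia)).trans
            (Finset.dvd_prod_of_mem (fun g => g ^ S.mult g) hg)).mul_left _
        rwa [(FiniteMultiplicity.of_not_isUnit (S.prime g hg).not_isUnit
          S.lead_ne_zero).pow_dvd_iff_le_multiplicity] at hdvd
      have h2 : (1 : ℝ) ≤ multiplicity g S.lead := by exact_mod_cast h1
      have h3 := H.poly.defect_nonneg (S.prime g hg).ne_zero
      nlinarith
    -- A prime divisor of positive degree forces the total degree to be at least two.
    have hres : ∀ g ∈ S.primes, H.m (S.res g) ≤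
        S.formalDegree g * H.poly.m g + g.natDegree * (L + B) := by
      intro g hg
      have h1 := S.rad_le
      have h2 : g.natDegree ≤ S.rad :=
        Finset.single_le_sum (f := fun g : R[X] => g.natDegree) (fun _ _ => Nat.zero_le _) hg
      have h3 := S.one_le_natDegree g hg
      have h4 := S.ord_add_degree_le hg
      have h5 := S.natDegree_coeff_add_le (S.idx_mem g hg)
      exact hB.m_resultant_le (n := n) (d := N - (S.idx g).degree) (by lia) (by lia)
        (S.idx_mem g hg) (S.ord_le g hg) (by lia) (by lia) (by lia) (S.prime g hg).ne_zero
        (S.res_ne_zero hg)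
    have hev1 : ∀ᶠ T in (atTop : Filter (Finset ι)), ∀ g ∈ S.primes,
        ∑ i ∈ T, H.w i * H.v i (S.res g) ≤ H.m (S.res g) :=
      (eventually_all_finset S.primes).mpr fun g hg => H.eventually_sum_le (S.res_ne_zero hg)
    have hev2 : ∀ᶠ T in (atTop : Filter (Finset ι)), ∀ g ∈ S.primes,
        ∑ i ∈ T, H.w i * (H.v i).gauss g = H.poly.tot g :=
      (eventually_all_finset S.primes).mpr fun g hg =>
        H.poly.eventually_sum_eq (S.prime g hg).ne_zero
    filter_upwards [eventually_ge_atTop T₀.toLeft, hev1, hev2, H.eventually_sum_le htop0,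
      H.poly.eventually_sum_eq S.lead_ne_zero] with T hT hT1 hT2 hT3 hT4
    have hT5 := hT₀ (T.disjSum Finset.univ) (by
      intro x hx
      rcases x with i | g
      · exact Finset.inl_mem_disjSum.mpr (hT (Finset.mem_toLeft.mpr hx))
      · exact Finset.inr_mem_disjSum.mpr (Finset.mem_univ g))
    have hconst : archConst H'.toArchData A n δ = B := by
      change A + 2⁻¹ * H.toArchData.poly.mass * _ = _
      rw [ArchData.poly_mass]
      rfl
    have hmass' : H'.mass = H.mass := H.toArchData.poly_mass
    rw [hconst, hmass', ← hL, Finset.sum_disjSum] at hT5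
    set V := ∑ i ∈ T, H.w i * ((H.v i).mv F : ℝ) with hV
    set X := ∑ i ∈ T, H.w i * (H.v i (F.coeff S.top) : ℝ) with hX
    set Y := H.poly.tot S.lead with hY
    have hT5a : ∑ i ∈ T, H'.w (Sum.inl i) * (((Sum.elim κ' fun g : S.primes =>
        S.N' - (S.idx g.1).degree) (Sum.inl i) : ℕ) + (2 * (S.N' : ℝ) - 1) *
        ((H'.v (Sum.inl i)).mv (splitEquiv (s + 1) R F) : ℝ)) =
        ∑ i ∈ T, H.w i * κ' i + (2 * (S.N' : ℝ) - 1) * V := by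
      rw [hV, Finset.mul_sum, ← Finset.sum_add_distrib]
      refine Finset.sum_congr rfl fun i _ => ?_
      have h1 : (H'.v (Sum.inl i)).mv (splitEquiv (s + 1) R F) = (H.v i).mv F := hmF i
      have h2 : H'.w (Sum.inl i) = H.w i := rfl
      rw [h1, h2, Sum.elim_inl]
      ring
    have hN'R : (1 : ℝ) ≤ S.N' := by exact_mod_cast hN'1
    have hT5b : ∑ g ∈ S.primes, H.poly.defect g * ((S.N' : ℝ) - (S.idx g).degree) ≤
        ∑ g : S.primes, H'.w (Sum.inr g) * (((Sum.elim κ' fun g : S.primes =>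
        S.N' - (S.idx g.1).degree) (Sum.inr g) : ℕ) + (2 * (S.N' : ℝ) - 1) *
        ((H'.v (Sum.inr g)).mv (splitEquiv (s + 1) R F) : ℝ)) := by
      rw [← Finset.sum_coe_sort S.primes]
      refine Finset.sum_le_sum fun g _ => ?_
      have h1 : (H'.v (Sum.inr g)).mv (splitEquiv (s + 1) R F) = S.ord g.1 := hmvg g.1 g.2
      have h2 : H'.w (Sum.inr g) = H.poly.defect g.1 := rfl
      rw [h1, h2, Sum.elim_inr, Nat.cast_sub (S.deg_le' _ (S.idx_mem g.1 g.2))]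
      refine mul_le_mul_of_nonneg_left ?_ (H.poly.defect_nonneg (S.prime g.1 g.2).ne_zero)
      have : (0 : ℝ) ≤ (2 * (S.N' : ℝ) - 1) * ((S.ord g.1 : ℤ) : ℝ) :=
        mul_nonneg (by linarith) (by positivity)
      linarith
    rw [hT5a] at hT5
    -- The inequality for the auxiliary resultants.
    have hexc : ∀ g ∈ S.primes, ∑ i ∈ T, H.w i * (S.excess (H.v i) g : ℝ) ≤
        S.formalDegree g * H.poly.defect g + g.natDegree * (L + B - V) := by
      intro g hg
      have h1 : ∑ i ∈ T, H.w i * (S.excess (H.v i) g : ℝ) =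
          ∑ i ∈ T, H.w i * (H.v i (S.res g) : ℝ) - S.formalDegree g * H.poly.tot g -
            g.natDegree * V := by
        rw [← hT2 g hg, hV, Finset.mul_sum, Finset.mul_sum, ← Finset.sum_sub_distrib,
          ← Finset.sum_sub_distrib]
        refine Finset.sum_congr rfl fun i _ => ?_
        rw [StepData.excess]
        push_cast
        ring
      have h2 := (hT1 g hg).trans (hres g hg)
      rw [h1, HeightData.defect]
      linarith
    have hgainsum : ∑ i ∈ T, H.w i * (κ i : ℝ) ≤ ∑ i ∈ T, H.w i * (κ' i : ℝ) +
        (∑ g ∈ S.primes, ∑ i ∈ T, H.w i * (S.excess (H.v i) g : ℝ) +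
          ((N : ℝ) - S.N' - S.rad) * (X - V) + ((N : ℝ) - S.N') * (Y - V)) := by
      have h1 : ∑ g ∈ S.primes, ∑ i ∈ T, H.w i * (S.excess (H.v i) g : ℝ) +
          ((N : ℝ) - S.N' - S.rad) * (X - V) + ((N : ℝ) - S.N') * (Y - V) =
          ∑ i ∈ T, H.w i * (S.gain (H.v i) : ℝ) := by
        have hY' : Y = ∑ i ∈ T, H.w i * ((H.v i).gauss S.lead : ℝ) := hT4.symm
        rw [Finset.sum_comm, hY', hX, hV, ← Finset.sum_sub_distrib, ← Finset.sum_sub_distrib,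
          Finset.mul_sum, Finset.mul_sum, ← Finset.sum_add_distrib, ← Finset.sum_add_distrib]
        refine Finset.sum_congr rfl fun i _ => ?_
        rw [StepData.gain, ← Finset.mul_sum]
        push_cast
        ring
      rw [h1, ← Finset.sum_add_distrib]
      refine Finset.sum_le_sum fun i _ => ?_
      rw [← mul_add]
      refine mul_le_mul_of_nonneg_left ?_ (H.w_nonneg i)
      exact_mod_cast hgain i
    have hexcsum := Finset.sum_le_sum hexc
    -- The defects that occur here are the weights of the new places in the induction hypothesis.
    have hform : ∑ g ∈ S.primes, (S.formalDegree g * H.poly.defect g +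
        (g.natDegree : ℝ) * (L + B - V)) ≤
        ∑ g ∈ S.primes, H.poly.defect g * ((S.N' : ℝ) - (S.idx g).degree) +
        ((N : ℝ) - S.N') * ∑ g ∈ S.primes, H.poly.defect g + S.rad * (L + B - V) := by
      rw [StepData.rad, Nat.cast_sum, Finset.sum_mul, Finset.mul_sum, ← Finset.sum_add_distrib,
        ← Finset.sum_add_distrib]
      refine Finset.sum_le_sum fun g hg => add_le_add ?_ le_rfl
      have h1 : (S.formalDegree g : ℝ) ≤ N - (S.idx g).degree := by
        have h2 := S.ord_add_degree_le hg
        have h3 : S.formalDegree g + (S.idx g).degree ≤ N := by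
          rw [StepData.formalDegree]
          lia
        have h4 : ((S.formalDegree g + (S.idx g).degree : ℕ) : ℝ) ≤ N := by exact_mod_cast h3
        push_cast at h4
        linarith
      have h2 := H.poly.defect_nonneg (S.prime g hg).ne_zero
      nlinarith
    have hradR : (S.rad : ℝ) ≤ N - S.N' := by
      have h1 := S.rad_le
      have h2 := S.N'_le
      have h3 : ((S.rad + S.N' : ℕ) : ℝ) ≤ N := by exact_mod_cast (show S.rad + S.N' ≤ N by lia)
      push_cast at h3
      linarith
    have hrad0 : (0 : ℝ) ≤ S.rad := Nat.cast_nonneg _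
    have hXB : X ≤ B := hT3.trans hmtop
    have hgoal : ∑ i ∈ T, H.w i * (κ i + (2 * (N : ℝ) - 1) * ((H.v i).mv F : ℝ)) =
        ∑ i ∈ T, H.w i * (κ i : ℝ) + (2 * (N : ℝ) - 1) * V := by
      rw [hV, Finset.mul_sum, ← Finset.sum_add_distrib]
      refine Finset.sum_congr rfl fun i _ => ?_
      ring
    rw [hgoal]
    have e1 : ((N : ℝ) - S.N' - S.rad) * (X - V) ≤ ((N : ℝ) - S.N' - S.rad) * (B - V) :=
      mul_le_mul_of_nonneg_left (by linarith) (by linarith)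
    have e2 : ((N : ℝ) - S.N') * (Y - V) ≤
        ((N : ℝ) - S.N') * (B - ∑ g ∈ S.primes, H.poly.defect g - V) :=
      mul_le_mul_of_nonneg_left (by linarith) (by linarith)
    have e3 : (S.rad : ℝ) * L ≤ ((N : ℝ) - S.N') * L := mul_le_mul_of_nonneg_right hradR hL0
    have e4 := hexcsum.trans hform
    linarith [hT5, hT5b, hgainsum, e1, e2, e3, e4]

end ReducedReduction

namespace ReducedReduction

open MeasureTheory Filter IsDedekindDomain

/-! ### The places of a number field -/

section NumberField

variable {K : Type*} [Field K] [NumberField K]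

/-- The normalised discrete valuation attached to a maximal ideal. -/
noncomputable def placeVal (p : HeightOneSpectrum (𝓞 K)) : IntVal K where
  toFun x := -WithZero.log (p.valuation K x)
  map_mul' x y hx hy := by
    rw [map_mul, WithZero.log_mul (by simpa using hx) (by simpa using hy)]
    ring
  map_add' x y n hx hy hxy h1 h2 := by
    have h := (p.valuation K).map_add x y
    have hx' : p.valuation K x ≠ 0 := by simpa using hx
    have hy' : p.valuation K y ≠ 0 := by simpa using hy
    have hxy' : p.valuation K (x + y) ≠ 0 := by simpa using hxy
    rcases le_max_iff.mp h with h | h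
    · have := (WithZero.log_le_log hxy' hx').mpr h
      lia
    · have := (WithZero.log_le_log hxy' hy').mpr h
      lia

theorem log_norm_embedding (p : HeightOneSpectrum (𝓞 K)) {x : K} (hx : x ≠ 0) :
    Real.log ‖FinitePlace.embedding p x‖ =
      -(Real.log (Ideal.absNorm p.asIdeal) * placeVal p x) := by
  have hx' : p.valuation K x ≠ 0 := by simpa using hx
  have h : ‖FinitePlace.embedding p x‖ =
      (Ideal.absNorm p.asIdeal : ℝ) ^ WithZero.log (p.valuation K x) := by
    rw [FinitePlace.norm_embedding', WithZeroMulInt.toNNReal_neg_apply _ hx']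
    push_cast
    congr 1
    conv_rhs => rw [← WithZero.coe_unzero hx']
    rfl
  rw [h, Real.log_zpow]
  change _ = -(_ * ((-WithZero.log (p.valuation K x) : ℤ) : ℝ))
  push_cast
  ring

theorem norm_embedding_eq_exp (p : HeightOneSpectrum (𝓞 K)) {x : K} (hx : x ≠ 0) :
    ‖FinitePlace.embedding p x‖ =
      Real.exp (-(Real.log (Ideal.absNorm p.asIdeal) * placeVal p x)) := by
  rw [← log_norm_embedding p hx, Real.exp_log]
  simpa using hx

theorem log_absNorm_pos (p : HeightOneSpectrum (𝓞 K)) :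
    0 < Real.log (Ideal.absNorm p.asIdeal) :=
  Real.log_pos (by exact_mod_cast HeightOneSpectrum.one_lt_absNorm p)

/-- An integral element has nonnegative valuation. -/
theorem placeVal_ge_zero (p : HeightOneSpectrum (𝓞 K)) (a : 𝓞 K) :
    (placeVal p).Ge 0 (algebraMap (𝓞 K) K a) := by
  refine or_iff_not_imp_left.mpr fun ha => ?_
  have h := p.valuation_le_one (K := K) a
  change 0 ≤ -WithZero.log _
  have := (WithZero.log_le_log (by simpa using ha) one_ne_zero).mpr h
  rw [WithZero.log_one] at this
  lia

/-- An integral element has positive valuation if and only if it lies in the maximal ideal. -/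
theorem placeVal_ge_one_iff (p : HeightOneSpectrum (𝓞 K)) (a : 𝓞 K) :
    (placeVal p).Ge 1 (algebraMap (𝓞 K) K a) ↔ a ∈ p.asIdeal := by
  by_cases ha : a = 0
  · simp [ha]
  have ha' : p.valuation K (algebraMap (𝓞 K) K a) ≠ 0 := by simpa using ha
  rw [← HeightOneSpectrum.valuation_lt_one_iff_mem (K := K), ← WithZero.log_lt_log ha' one_ne_zero,
    WithZero.log_one]
  constructor
  · intro h
    have := h.le (by simpa using ha)
    change 1 ≤ -WithZero.log _ at this
    lia
  · intro h
    right
    change 1 ≤ -WithZero.log _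
    lia

/-- The finite set of complex embeddings carries the discrete measurable structure. -/
instance : MeasurableSpace (K →+* ℂ) := ⊤

instance : DiscreteMeasurableSpace (K →+* ℂ) := ⟨fun _ => trivial⟩

/-- The sum over the complex embeddings is the sum over the infinite places with multiplicity. -/
theorem sum_embeddings_eq (g : InfinitePlace K → ℝ) :
    ∑ σ : K →+* ℂ, g (InfinitePlace.mk σ) = ∑ w : InfinitePlace K, w.mult * g w := by
  classical
  rw [← Finset.sum_fiberwise (s := Finset.univ) (g := fun σ : K →+* ℂ => InfinitePlace.mk σ)]
  refine Finset.sum_congr rfl fun w _ => ?_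
  rw [Finset.sum_congr rfl (g := fun _ => g w) fun σ hσ => by
    rw [(Finset.mem_filter.mp hσ).2], Finset.sum_const, InfinitePlace.card_filter_mk_eq,
    nsmul_eq_mul]

variable (K) in
/-- The complex embeddings of a number field, with the counting measure. -/
noncomputable def embeddingData : ArchData K (K →+* ℂ) where
  μ := Measure.count
  finite := inferInstance
  ev σ := σ
  measurable _ := measurable_of_countable _
  ae_ne _ hx := Eventually.of_forall fun σ => by simpa using hx
  integrable _ _ := Integrable.of_finite

variable (K) in
theorem embeddingData_mass : (embeddingData K).mass = Module.finrank ℚ K := by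
  rw [ArchData.mass, embeddingData]
  rw [measureReal_def, Measure.count_apply_finite _ Set.finite_univ]
  simp [← Embeddings.card K ℂ]

theorem embeddingData_m (x : K) : (embeddingData K).m x = ∑ σ : K →+* ℂ, Real.log ‖σ x‖ :=
  integral_count _

theorem support_log_subset {x : K} (hx : x ≠ 0) :
    {p : HeightOneSpectrum (𝓞 K) | placeVal p x ≠ 0}.Finite := by
  have h := (FinitePlace.hasFiniteMulSupport hx).image FinitePlace.maximalIdeal
  refine h.subset fun p hp => ⟨FinitePlace.mk p, ?_, FinitePlace.maximalIdeal_mk p⟩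
  intro h1
  change ‖FinitePlace.embedding p x‖ = 1 at h1
  have h2 := log_norm_embedding p hx
  rw [h1, Real.log_one] at h2
  have h3 : Real.log (Ideal.absNorm p.asIdeal) * placeVal p x = 0 := by linarith
  rcases mul_eq_zero.mp h3 with h | h
  · exact (log_absNorm_pos p).ne' h
  · exact hp (by exact_mod_cast h)

theorem finprod_pos {ι : Type*} {f : ι → ℝ} (h : ∀ i, 0 < f i) : 0 < ∏ᶠ i, f i :=
  finprod_induction (fun x : ℝ => 0 < x) one_pos (fun _ _ => mul_pos) h

theorem sum_placeVal_eq {x : K} (hx : x ≠ 0) :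
    ∑ᶠ p : HeightOneSpectrum (𝓞 K), Real.log (Ideal.absNorm p.asIdeal) * placeVal p x =
      (embeddingData K).m x := by
  have h0 : ∀ w ∈ (Finset.univ : Finset (InfinitePlace K)), w x ^ w.mult ≠ 0 :=
    fun w _ => pow_ne_zero _ (InfinitePlace.pos_iff.mpr hx).ne'
  have h1 := congrArg Real.log (prod_abs_eq_one hx)
  rw [Real.log_one, Real.log_mul (Finset.prod_ne_zero_iff.mpr h0)
    (finprod_pos fun w : FinitePlace K => FinitePlace.pos_iff.mpr hx).ne', Real.log_prod h0,
    Real.log_finprod (fun w => FinitePlace.pos_iff.mpr hx),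
    ← finsum_comp_equiv FinitePlace.equivHeightOneSpectrum.symm] at h1
  have h2 : ∑ᶠ p : HeightOneSpectrum (𝓞 K),
      Real.log ((FinitePlace.equivHeightOneSpectrum.symm p) x) =
      -∑ᶠ p : HeightOneSpectrum (𝓞 K), Real.log (Ideal.absNorm p.asIdeal) * placeVal p x := by
    rw [← finsum_neg_distrib]
    exact finsum_congr fun p => log_norm_embedding p hx
  rw [h2] at h1
  rw [embeddingData_m]
  have h3 := sum_embeddings_eq (K := K) fun w => Real.log (w x)
  simp only [InfinitePlace.apply] at h3
  rw [h3]
  simp only [Real.log_pow] at h1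
  linarith

variable (K) in
/-- The places of a number field. The product formula is an equality here. -/
noncomputable def numberFieldData : HeightData K (HeightOneSpectrum (𝓞 K)) (K →+* ℂ) where
  toArchData := embeddingData K
  v := placeVal
  w p := Real.log (Ideal.absNorm p.asIdeal)
  w_nonneg p := (log_absNorm_pos p).le
  finite_support _ hx := support_log_subset hx
  sum_le _ hx := (sum_placeVal_eq hx).le

variable {s : ℕ}

/-- The contribution of the complex embeddings to the height of the coefficients. -/
noncomputable def archHeight (F : MvPolynomial (Fin s) K) : ℝ :=
  ∑ σ : K →+* ℂ, Real.log (⨆ α : F.support, ‖σ (F.coeff α)‖)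

theorem bound_archHeight {F : MvPolynomial (Fin s) K} (δ : ℕ) :
    (embeddingData K).Bound F (archHeight F) 0 δ := by
  rintro w hw ⟨α₀, hα₀, hw₀⟩
  have hW : 0 < ∑ α ∈ F.support, w α :=
    hw₀.trans_le (Finset.single_le_sum (fun α _ => hw α) hα₀)
  simp only [zero_add, Nat.choose_zero_right, Nat.cast_one, mul_one]
  rw [embeddingData_mass, archHeight]
  change ∫ σ : K →+* ℂ, _ ∂Measure.count ≤ _
  rw [integral_count, ← Embeddings.card K ℂ]
  have hcard : (2 : ℝ)⁻¹ * Fintype.card (K →+* ℂ) * Real.log (∑ α ∈ F.support, w α) =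
      ∑ σ : K →+* ℂ, 2⁻¹ * Real.log (∑ α ∈ F.support, w α) := by
    rw [Finset.sum_const, Finset.card_univ, nsmul_eq_mul]
    ring
  rw [hcard, ← Finset.sum_add_distrib]
  refine Finset.sum_le_sum fun σ _ => ?_
  set M := ⨆ α : F.support, ‖σ (F.coeff α)‖ with hM
  have hle : ∀ α ∈ F.support, ‖σ (F.coeff α)‖ ≤ M := fun α hα =>
    le_ciSup (f := fun α : F.support => ‖σ (F.coeff α)‖) (Set.finite_range _).bddAbove ⟨α, hα⟩
  have hpos : 0 < ‖σ (F.coeff α₀)‖ := by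
    simpa using MvPolynomial.mem_support_iff.mp hα₀
  have hM0 : 0 < M := hpos.trans_le (hle α₀ hα₀)
  have h1 : ∑ α ∈ F.support, w α * ‖σ (F.coeff α)‖ ^ 2 ≤ M ^ 2 * ∑ α ∈ F.support, w α := by
    rw [Finset.mul_sum]
    refine Finset.sum_le_sum fun α hα => ?_
    rw [mul_comm]
    exact mul_le_mul_of_nonneg_right (pow_le_pow_left₀ (norm_nonneg _) (hle α hα) 2) (hw α)
  have h0 : 0 < ∑ α ∈ F.support, w α * ‖σ (F.coeff α)‖ ^ 2 :=
    (mul_pos hw₀ (pow_pos hpos 2)).trans_le (Finset.single_le_sum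
      (f := fun α => w α * ‖σ (F.coeff α)‖ ^ 2) (fun α _ => mul_nonneg (hw α) (by positivity)) hα₀)
  have h2 := Real.log_le_log h0 h1
  rw [Real.log_mul (by positivity) hW.ne', Real.log_pow] at h2
  change 2⁻¹ * Real.log (∑ α ∈ F.support, w α * ‖σ (F.coeff α)‖ ^ 2) ≤ _
  push_cast at h2
  linarith

/-- The height of the family of coefficients is the sum of the contributions of the complex
embeddings and of the finite places. -/
theorem eventually_sum_mv_eq {F : MvPolynomial (Fin s) K} (hF : F ≠ 0) :
    ∀ᶠ T in (atTop : Filter (Finset (HeightOneSpectrum (𝓞 K)))),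
      ∑ p ∈ T, Real.log (Ideal.absNorm p.asIdeal) * (placeVal p).mv F =
        archHeight F - Height.logHeight (fun α : F.support => F.coeff α) := by
  obtain ⟨α₀, hα₀⟩ := MvPolynomial.support_nonempty.mpr hF
  have : Nonempty F.support := ⟨⟨α₀, hα₀⟩⟩
  have hne : ∀ α : F.support, F.coeff α ≠ 0 := fun α => MvPolynomial.mem_support_iff.mp α.2
  have hx : (fun α : F.support => F.coeff α) ≠ 0 := fun h => hne ⟨α₀, hα₀⟩ (congrFun h _)
  have hsup : ∀ p : HeightOneSpectrum (𝓞 K), ⨆ α : F.support, (FinitePlace.mk p) (F.coeff α) =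
      Real.exp (-(Real.log (Ideal.absNorm p.asIdeal) * (placeVal p).mv F)) := by
    intro p
    obtain ⟨β, hβ, hβ'⟩ := (placeVal p).exists_eq_mv hF
    refine le_antisymm (ciSup_le fun α => ?_) ?_
    · rw [FinitePlace.mk_apply, norm_embedding_eq_exp p (hne α), Real.exp_le_exp, neg_le_neg_iff]
      refine mul_le_mul_of_nonneg_left ?_ (log_absNorm_pos p).le
      exact_mod_cast ((placeVal p).ge_mv F α).le (hne α)
    · have h := le_ciSup (f := fun α : F.support => (FinitePlace.mk p) (F.coeff α))
        (Set.finite_range _).bddAbove ⟨β, MvPolynomial.mem_support_iff.mpr hβ⟩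
      rw [← hβ', ← norm_embedding_eq_exp p hβ, ← FinitePlace.mk_apply]
      exact h
  have hsupw : ∀ w : FinitePlace K, 0 < ⨆ α : F.support, w (F.coeff α) := by
    intro w
    rw [← FinitePlace.mk_maximalIdeal w, hsup]
    exact Real.exp_pos _
  have hsupi : ∀ w : InfinitePlace K, 0 < ⨆ α : F.support, w (F.coeff α) := by
    intro w
    refine lt_of_lt_of_le ?_ (le_ciSup (f := fun α : F.support => w (F.coeff α))
      (Set.finite_range _).bddAbove ⟨α₀, hα₀⟩)
    exact InfinitePlace.pos_iff.mpr (hne ⟨α₀, hα₀⟩)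
  have hlog : Height.logHeight (fun α : F.support => F.coeff α) = archHeight F -
      ∑ᶠ p : HeightOneSpectrum (𝓞 K),
        Real.log (Ideal.absNorm p.asIdeal) * (placeVal p).mv F := by
    rw [Height.logHeight_eq_log_mulHeight, NumberField.mulHeight_eq hx, Real.log_mul
      (Finset.prod_pos fun w _ => pow_pos (hsupi w) _).ne' (finprod_pos hsupw).ne',
      Real.log_prod fun w _ => (pow_pos (hsupi w) _).ne', Real.log_finprod hsupw,
      ← finsum_comp_equiv FinitePlace.equivHeightOneSpectrum.symm, sub_eq_add_neg,
      ← finsum_neg_distrib]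
    congr 1
    · rw [archHeight]
      have h3 := sum_embeddings_eq (K := K) fun w => Real.log (⨆ α : F.support, w (F.coeff α))
      simp only [InfinitePlace.apply] at h3
      rw [h3]
      simp only [Real.log_pow]
    · refine finsum_congr fun p => ?_
      change Real.log (⨆ α : F.support, (FinitePlace.mk p) (F.coeff α)) = _
      rw [hsup, Real.log_exp]
  have hfin : {p : HeightOneSpectrum (𝓞 K) | (placeVal p).mv F ≠ 0}.Finite := by
    have h1 : (⋃ α ∈ F.support,
        {p : HeightOneSpectrum (𝓞 K) | placeVal p (F.coeff α) ≠ 0}).Finite :=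
      F.support.finite_toSet.biUnion fun α hα =>
        support_log_subset (MvPolynomial.mem_support_iff.mp hα)
    refine h1.subset fun p hp => ?_
    obtain ⟨β, hβ, hβ'⟩ := (placeVal p).exists_eq_mv hF
    simp only [Set.mem_iUnion]
    exact ⟨β, MvPolynomial.mem_support_iff.mpr hβ, by rw [Set.mem_ofPred_eq, hβ']; exact hp⟩
  filter_upwards [eventually_ge_atTop hfin.toFinset] with T hT
  rw [hlog, sub_sub_cancel, finsum_eq_sum_of_support_subset]
  intro p hp
  refine hT ?_
  rw [Set.Finite.mem_toFinset]
  intro h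
  apply hp
  simp [h]

/-- The number of places at which the top coefficients of a polynomial without nonconstant square
factors are small, or at which it has an approximate square factor, is bounded in terms of the
height of the polynomial. -/
theorem sum_log_absNorm_le {F : MvPolynomial (Fin (s + 1)) K} {N δ : ℕ}
    (hsq : ∀ U, U ^ 2 ∣ F → ∃ r, U = MvPolynomial.C r)
    (hlast : ∃ α ∈ F.support, 1 ≤ α (Fin.last s)) (hN : ∀ α ∈ F.support, α.degree ≤ N)
    (hN' : ∃ α ∈ F.support, α.degree = N) (hNδ : N ≤ δ)
    (I : Finset (HeightOneSpectrum (𝓞 K)))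
    (hI : ∀ p ∈ I, (placeVal p).TopSmall F N 1 ∨ (placeVal p).NearSquare F) :
    ∑ p ∈ I, Real.log (Ideal.absNorm p.asIdeal) ≤
      (2 * δ - 1) * (Height.logHeight (fun α : F.support => F.coeff α) +
        2⁻¹ * Module.finrank ℚ K * Real.log ((s + 1 + δ).choose (s + 1))) +
      δ * (Module.finrank ℚ K * Real.log δ) := by
  classical
  obtain ⟨α₁, hα₁, hα₁1⟩ := hlast
  have hF : F ≠ 0 := by
    rintro rfl
    simp at hα₁
  have hN1 : 1 ≤ N := hα₁1.trans ((Finsupp.le_degree _ α₁).trans (hN α₁ hα₁))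
  have hmain := (numberFieldData K).eventually_sum_add_le hsq ⟨α₁, hα₁, hα₁1⟩ hN hN' hNδ
    (j := 0) (n := s + 1) (by lia) (bound_archHeight δ) (fun p => if p ∈ I then 1 else 0)
    (fun p => by
      split_ifs with hp
      · rcases hI p hp with h | h
        · exact Or.inl h
        · exact Or.inr ⟨le_rfl, h⟩
      · exact Or.inl (IntVal.topSmall_zero hN))
  obtain ⟨T, hT, hT1, hT2⟩ :=
    ((hmain.and ((eventually_sum_mv_eq hF).and (eventually_ge_atTop I)))).exists
  have e1 : ∑ p ∈ T, (numberFieldData K).w p *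
      (((if p ∈ I then 1 else 0 : ℕ) : ℝ) + (2 * N - 1) * ((numberFieldData K).v p).mv F) =
      ∑ p ∈ I, Real.log (Ideal.absNorm p.asIdeal) +
        (2 * N - 1) * ∑ p ∈ T, Real.log (Ideal.absNorm p.asIdeal) * (placeVal p).mv F := by
    rw [← Finset.inter_eq_right.mpr hT2, ← Finset.sum_ite_mem, Finset.mul_sum,
      ← Finset.sum_add_distrib]
    refine Finset.sum_congr rfl fun p hp => ?_
    change Real.log (Ideal.absNorm p.asIdeal) * (_ + _ * ((placeVal p).mv F : ℝ)) = _
    rw [Finset.inter_eq_right.mpr hT2]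
    split_ifs <;> push_cast <;> ring
  rw [e1, hT1] at hT
  change _ ≤ _ * (archHeight F + 2⁻¹ * (embeddingData K).mass * _) +
    _ * ((embeddingData K).mass * _) at hT
  rw [embeddingData_mass] at hT
  have hN1' : (1 : ℝ) ≤ N := by exact_mod_cast hN1
  have hNδ' : (N : ℝ) ≤ δ := by exact_mod_cast hNδ
  have hh := Height.logHeight_nonneg (fun α : F.support => F.coeff α)
  have hc : 0 ≤ (2⁻¹ : ℝ) * Module.finrank ℚ K * Real.log ((s + 1 + δ).choose (s + 1)) :=
    mul_nonneg (by positivity) (Real.log_natCast_nonneg _)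
  have hl : 0 ≤ (Module.finrank ℚ K : ℝ) * Real.log δ :=
    mul_nonneg (by positivity) (Real.log_natCast_nonneg _)
  have e2 := mul_le_mul_of_nonneg_right (show (2 * N - 1 : ℝ) ≤ 2 * δ - 1 by linarith)
    (add_nonneg hh hc)
  have e3 := mul_le_mul_of_nonneg_right hNδ' hl
  linarith

end NumberField

end ReducedReduction

namespace ReducedReduction

/-! ### Dehomogenisation -/

section Dehomogenisation

open MvPolynomial

variable {R S : Type*} [CommRing R] [CommRing S] {n : ℕ} (π : Equiv.Perm (Fin (n + 1)))

/-- The dehomogenisation of a polynomial with respect to the variable `T_j` with `π j = 0`. The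
permutation `π` also numbers the other variables. -/
noncomputable def dehom : MvPolynomial (Fin (n + 1)) R →ₐ[R] MvPolynomial (Fin n) R :=
  aeval fun k => (Fin.cons 1 X : Fin (n + 1) → MvPolynomial (Fin n) R) (π k)

theorem dehom_X (k : Fin (n + 1)) :
    dehom π (X k : MvPolynomial (Fin (n + 1)) R) =
      (Fin.cons 1 X : Fin (n + 1) → MvPolynomial (Fin n) R) (π k) :=
  aeval_X _ _

@[simp] theorem dehom_X_symm_zero : dehom π (X (π.symm 0) : MvPolynomial (Fin (n + 1)) R) = 1 := by
  rw [dehom_X, Equiv.apply_symm_apply, Fin.cons_zero]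

theorem map_dehom (φ : R →+* S) (P : MvPolynomial (Fin (n + 1)) R) :
    map φ (dehom π P) = dehom π (map φ P) := by
  have h : ((map φ).comp (dehom π (R := R)).toRingHom) =
      ((dehom π (R := S)).toRingHom).comp (map φ) := by
    refine MvPolynomial.ringHom_ext (fun r => by simp) fun k => ?_
    simp only [RingHom.comp_apply, AlgHom.toRingHom_eq_coe, RingHom.coe_coe, map_X, dehom_X]
    cases π k using Fin.cases <;> simp
  exact congrArg (fun g => g P) h

/-- The exponents of the dehomogenisation of a monomial. -/
noncomputable def resIdx (m : Fin (n + 1) →₀ ℕ) : Fin n →₀ ℕ :=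
  (Finsupp.equivMapDomain π m).tail

/-- The exponents of the homogenisation of degree `d` of a monomial. -/
noncomputable def liftIdx (d : ℕ) (α : Fin n →₀ ℕ) : Fin (n + 1) →₀ ℕ :=
  Finsupp.equivMapDomain π.symm (Finsupp.cons (d - α.degree) α)

theorem resIdx_apply (m : Fin (n + 1) →₀ ℕ) (i : Fin n) : resIdx π m i = m (π.symm i.succ) := rfl

@[simp] theorem resIdx_liftIdx (d : ℕ) (α : Fin n →₀ ℕ) : resIdx π (liftIdx π d α) = α := by
  ext i
  simp [resIdx_apply, liftIdx]

theorem degree_equivMapDomain (m : Fin (n + 1) →₀ ℕ) :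
    (Finsupp.equivMapDomain π m).degree = m.degree := by
  simp only [Finsupp.degree_eq_sum, Finsupp.equivMapDomain_apply]
  exact Equiv.sum_comp π.symm m

theorem degree_liftIdx {d : ℕ} {α : Fin n →₀ ℕ} (h : α.degree ≤ d) :
    (liftIdx π d α).degree = d := by
  rw [liftIdx, degree_equivMapDomain, degree_cons]
  lia

theorem add_degree_resIdx (m : Fin (n + 1) →₀ ℕ) :
    m (π.symm 0) + (resIdx π m).degree = m.degree := by
  rw [← degree_equivMapDomain π m, ← Finsupp.cons_tail (Finsupp.equivMapDomain π m), degree_cons]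
  rfl

theorem liftIdx_resIdx (m : Fin (n + 1) →₀ ℕ) : liftIdx π m.degree (resIdx π m) = m := by
  have h := add_degree_resIdx π m
  ext k
  rw [liftIdx, Finsupp.equivMapDomain_apply, Equiv.symm_symm]
  obtain ⟨l, rfl⟩ := π.symm.surjective k
  rw [Equiv.apply_symm_apply]
  cases l using Fin.cases with
  | zero => rw [Finsupp.cons_zero]; lia
  | succ i => rw [Finsupp.cons_succ, resIdx_apply]

theorem dehom_monomial (m : Fin (n + 1) →₀ ℕ) (a : R) :
    dehom π (monomial m a) = monomial (resIdx π m) a := by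
  rw [dehom, aeval_monomial, monomial_eq, Finsupp.prod_fintype _ _ (by simp),
    Finsupp.prod_fintype _ _ (by simp), ← Equiv.prod_comp π.symm, Fin.prod_univ_succ]
  simp [resIdx_apply, algebraMap_eq]

theorem dehom_eq_sum (P : MvPolynomial (Fin (n + 1)) R) :
    dehom π P = ∑ m ∈ P.support, monomial (resIdx π m) (P.coeff m) := by
  conv_lhs => rw [P.as_sum, map_sum]
  simp only [dehom_monomial]

variable {d : ℕ} {P : MvPolynomial (Fin (n + 1)) R}

theorem coeff_dehom (hP : P.IsHomogeneous d) {α : Fin n →₀ ℕ} (hα : α.degree ≤ d) :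
    (dehom π P).coeff α = P.coeff (liftIdx π d α) := by
  classical
  rw [dehom_eq_sum, coeff_sum]
  simp only [coeff_monomial]
  rw [Finset.sum_eq_single (liftIdx π d α)]
  · simp
  · intro m hm hne
    rw [if_neg]
    rintro rfl
    apply hne
    have h1 : m.degree = d := by
      by_contra h
      exact mem_support_iff.mp hm (hP.coeff_eq_zero h)
    rw [← h1, liftIdx_resIdx]
  · intro h
    rw [notMem_support_iff.mp h, ite_self]

theorem coeff_dehom_of_lt (hP : P.IsHomogeneous d) {α : Fin n →₀ ℕ} (hα : d < α.degree) :
    (dehom π P).coeff α = 0 := by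
  classical
  rw [dehom_eq_sum, coeff_sum]
  refine Finset.sum_eq_zero fun m hm => ?_
  rw [coeff_monomial, if_neg]
  rintro rfl
  have h1 : m.degree = d := by
    by_contra h
    exact mem_support_iff.mp hm (hP.coeff_eq_zero h)
  have := add_degree_resIdx π m
  lia

theorem degree_le_of_mem_support_dehom (hP : P.IsHomogeneous d) {α : Fin n →₀ ℕ}
    (hα : α ∈ (dehom π P).support) : α.degree ≤ d := by
  by_contra! h
  exact mem_support_iff.mp hα (coeff_dehom_of_lt π hP h)

theorem coeff_dehom_resIdx (hP : P.IsHomogeneous d) {m : Fin (n + 1) →₀ ℕ} (hm : m.degree = d) :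
    (dehom π P).coeff (resIdx π m) = P.coeff m := by
  have := add_degree_resIdx π m
  rw [coeff_dehom π hP (by lia), ← hm, liftIdx_resIdx]

/-- A homogeneous polynomial is determined by its degree and its dehomogenisation. -/
theorem eq_of_dehom_eq {Q : MvPolynomial (Fin (n + 1)) R} (hP : P.IsHomogeneous d)
    (hQ : Q.IsHomogeneous d) (h : dehom π P = dehom π Q) : P = Q := by
  ext m
  by_cases hm : m.degree = d
  · rw [← coeff_dehom_resIdx π hP hm, h, coeff_dehom_resIdx π hQ hm]
  · rw [hP.coeff_eq_zero hm, hQ.coeff_eq_zero hm]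

theorem dehom_ne_zero (hP : P.IsHomogeneous d) (h : P ≠ 0) : dehom π P ≠ 0 := fun h0 =>
  h (eq_of_dehom_eq π hP (isHomogeneous_zero _ _ _) (by rw [h0, map_zero]))

/-- Every polynomial is the dehomogenisation of a homogeneous polynomial. -/
theorem exists_isHomogeneous_dehom_eq (q : MvPolynomial (Fin n) R) (hq : q.totalDegree ≤ d) :
    ∃ Q : MvPolynomial (Fin (n + 1)) R, Q.IsHomogeneous d ∧ dehom π Q = q := by
  refine ⟨∑ α ∈ q.support, monomial (liftIdx π d α) (q.coeff α), ?_, ?_⟩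
  · refine IsHomogeneous.sum _ _ _ fun α hα => isHomogeneous_monomial _ (degree_liftIdx π ?_)
    exact (le_totalDegree hα).trans hq
  · rw [map_sum]
    simp only [dehom_monomial, resIdx_liftIdx]
    exact q.as_sum.symm

/-- A square factor of the dehomogenisation of a homogeneous polynomial comes from a square factor
of the polynomial. -/
theorem exists_eq_sq_mul_of_dehom [IsDomain R] {u w : MvPolynomial (Fin n) R}
    (hP : P.IsHomogeneous d) (hP0 : P ≠ 0) (h : dehom π P = u ^ 2 * w) :
    ∃ (U W : MvPolynomial (Fin (n + 1)) R), U.IsHomogeneous u.totalDegree ∧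
      2 * u.totalDegree ≤ d ∧ W.IsHomogeneous (d - 2 * u.totalDegree) ∧ P = U ^ 2 * W := by
  have h0 := dehom_ne_zero π hP hP0
  rw [h] at h0
  have hu : u ≠ 0 := by
    rintro rfl
    simp at h0
  have hw : w ≠ 0 := by
    rintro rfl
    simp at h0
  have hle : (dehom π P).totalDegree ≤ d :=
    Finset.sup_le fun α hα => degree_le_of_mem_support_dehom π hP hα
  have hdeg : (dehom π P).totalDegree = 2 * u.totalDegree + w.totalDegree := by
    rw [h, totalDegree_mul_of_isDomain (pow_ne_zero 2 hu) hw, sq,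
      totalDegree_mul_of_isDomain hu hu]
    lia
  obtain ⟨U, hU, hUu⟩ := exists_isHomogeneous_dehom_eq π u le_rfl
  obtain ⟨W, hW, hWw⟩ := exists_isHomogeneous_dehom_eq π w (d := d - 2 * u.totalDegree) (by lia)
  refine ⟨U, W, hU, by lia, hW, eq_of_dehom_eq π hP ?_ ?_⟩
  · have h2 := (hU.pow 2).mul hW
    rwa [show u.totalDegree * 2 + (d - 2 * u.totalDegree) = d by lia] at h2
  · rw [map_mul, map_pow, hUu, hWw, h]

end Dehomogenisation

end ReducedReduction

namespace ReducedReduction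

open HomogeneousLocalization

universe u

/-! ### The standard charts of projective space and of a hypersurface -/

section AwayEval

variable {B σ C : Type*} [CommRing B] [SetLike σ B] [AddSubgroupClass σ B] [CommRing C]
  (ℬ : ℕ → σ) [GradedRing ℬ]

/-- The evaluation of homogeneous fractions with denominator a power of `t` by a ring homomorphism
that maps `t` to `1`. -/
noncomputable def awayEval {t : B} (φ : B →+* C) (ht : φ t = 1) : Away ℬ t →+* C :=
  (IsLocalization.Away.lift (S := Localization.Away t) t (g := φ)
    (by rw [ht]; exact isUnit_one)).comp (algebraMap (Away ℬ t) (Localization.Away t))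

variable {t : B} (φ : B →+* C) (ht : φ t = 1)

theorem awayEval_mk {d : ℕ} (hd : t ∈ ℬ d) (k : ℕ) (x : B) (hx : x ∈ ℬ (k • d)) :
    awayEval ℬ φ ht (Away.mk ℬ hd k x hx) = φ x := by
  rw [awayEval, RingHom.comp_apply, HomogeneousLocalization.algebraMap_apply, Away.val_mk,
    Localization.mk_eq_mk', IsLocalization.Away.lift, IsLocalization.lift_mk'_spec]
  simp [ht]

theorem awayEval_fromZeroRingHom (x : ℬ 0) :
    awayEval ℬ φ ht (fromZeroRingHom ℬ (Submonoid.powers t) x) = φ x := by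
  rw [awayEval, RingHom.comp_apply, HomogeneousLocalization.algebraMap_apply]
  change IsLocalization.Away.lift t _ (Localization.mk (x : B) 1) = _
  rw [Localization.mk_one_eq_algebraMap, IsLocalization.Away.lift_eq]

end AwayEval

section Chart

attribute [local instance] MvPolynomial.gradedAlgebra

variable {n : ℕ} (π : Equiv.Perm (Fin (n + 1)))

section Ring

variable {R : Type u} [CommRing R] {t : MvPolynomial (Fin (n + 1)) R}

theorem dehom_eq_one (ht : t = MvPolynomial.X (π.symm 0)) :
    (dehom π : MvPolynomial (Fin (n + 1)) R →ₐ[R] _).toRingHom t = 1 := by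
  subst ht
  exact dehom_X_symm_zero π

theorem mem_polyGrading_one (ht : t = MvPolynomial.X (π.symm 0)) : t ∈ polyGrading n R 1 := by
  subst ht
  exact MvPolynomial.isHomogeneous_X _ _

/-- The coordinate ring of the chart `T_j ≠ 0` is mapped to the polynomial ring. -/
noncomputable def chartMap (ht : t = MvPolynomial.X (π.symm 0)) :
    Away (polyGrading n R) t →+* MvPolynomial (Fin n) R :=
  awayEval (polyGrading n R) (dehom π).toRingHom (dehom_eq_one π ht)

theorem chartMap_mk (ht : t = MvPolynomial.X (π.symm 0)) (k : ℕ) (P : MvPolynomial (Fin (n + 1)) R)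
    (hP : P ∈ polyGrading n R (k • 1)) :
    chartMap π ht (Away.mk _ (mem_polyGrading_one π ht) k P hP) = dehom π P :=
  awayEval_mk _ _ _ _ _ _ _

theorem chartMap_injective (ht : t = MvPolynomial.X (π.symm 0)) :
    Function.Injective (chartMap π ht) := by
  rw [injective_iff_map_eq_zero]
  intro a ha
  obtain ⟨k, P, hP, rfl⟩ := Away.mk_surjective _ (mem_polyGrading_one π ht) a
  rw [chartMap_mk] at ha
  have hP' : P.IsHomogeneous (k • 1) := hP
  have h0 : P = 0 := eq_of_dehom_eq π hP' (MvPolynomial.isHomogeneous_zero _ _ _)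
    (by rw [ha, map_zero])
  apply val_injective
  rw [Away.val_mk, h0, Localization.mk_zero, val_zero]

theorem chartMap_surjective (ht : t = MvPolynomial.X (π.symm 0)) :
    Function.Surjective (chartMap π ht) := by
  intro q
  obtain ⟨Q, hQ, hq⟩ := exists_isHomogeneous_dehom_eq π q le_rfl
  have hQ' : Q ∈ polyGrading n R (q.totalDegree • 1) := by
    rw [smul_eq_mul, mul_one]
    exact hQ
  exact ⟨Away.mk _ (mem_polyGrading_one π ht) _ Q hQ', by rw [chartMap_mk, hq]⟩

theorem chartMap_fromZeroRingHom (ht : t = MvPolynomial.X (π.symm 0)) (r : R) :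
    chartMap π ht (fromZeroRingHom (polyGrading n R) (Submonoid.powers t)
      (algebraMap R (polyGrading n R 0) r)) = MvPolynomial.C r := by
  rw [chartMap, awayEval_fromZeroRingHom]
  exact (dehom π).commutes r

theorem chartMap_map {S : Type u} [CommRing S] [Algebra R S] (ht : t = MvPolynomial.X (π.symm 0))
    (ht' : polyGradedHom n R S t = MvPolynomial.X (π.symm 0)) (a : Away (polyGrading n R) t) :
    chartMap π ht' (Away.map (polyGradedHom n R S) t a) =
      MvPolynomial.map (algebraMap R S) (chartMap π ht a) := by
  obtain ⟨k, P, hP, rfl⟩ := Away.mk_surjective _ (mem_polyGrading_one π ht) a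
  rw [Away.map_mk, chartMap_mk, chartMap_mk, map_dehom]
  rfl

end Ring

section Field

variable {K : Type u} [Field K] {t : MvPolynomial (Fin (n + 1)) K}
  (ht : t = MvPolynomial.X (π.symm 0)) {δ : ℕ} {f : MvPolynomial (Fin (n + 1)) K}
  (hf : f.IsHomogeneous δ)

include ht hf in
/-- The kernel of the restriction of functions from a chart of projective space to the
hypersurface. -/
theorem coordMap_eq_zero_iff (a : Away (polyGrading n K) t) :
    letI := coordGradedAlgebra hf
    Away.map (coordGradedHom f) t a = 0 ↔ dehom π f ∣ chartMap π ht a := by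
  let := coordGradedAlgebra hf
  constructor
  · intro h
    -- The restriction to the hypersurface followed by dehomogenisation is again dehomogenisation.
    let φ : MvPolynomial (Fin (n + 1)) K ⧸ Ideal.span {f} →+*
        MvPolynomial (Fin n) K ⧸ Ideal.span {dehom π f} :=
      Ideal.quotientMap _ (dehom π).toRingHom (by
        rw [Ideal.span_le, Set.singleton_subset_iff]
        exact Ideal.mem_span_singleton_self _)
    have hφ : φ (coordGradedHom f t) = 1 := by
      change Ideal.Quotient.mk _ ((dehom π).toRingHom t) = 1
      rw [dehom_eq_one π ht, map_one]
    have key : awayEval (coordGrading f) φ hφ (Away.map (coordGradedHom f) t a) =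
        Ideal.Quotient.mk _ (chartMap π ht a) := by
      obtain ⟨k, P, hP, rfl⟩ := Away.mk_surjective _ (mem_polyGrading_one π ht) a
      rw [Away.map_mk, chartMap_mk]
      exact awayEval_mk _ _ _ _ _ _ _
    rw [h, map_zero] at key
    exact Ideal.mem_span_singleton.mp (Ideal.Quotient.eq_zero_iff_mem.mp key.symm)
  · rintro ⟨G, hG⟩
    obtain ⟨b, rfl⟩ := chartMap_surjective π ht G
    have hf' : f ∈ polyGrading n K (δ • 1) := by
      rw [smul_eq_mul, mul_one]
      exact hf
    have h : a = Away.mk _ (mem_polyGrading_one π ht) δ f hf' * b := by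
      apply chartMap_injective π ht
      rw [map_mul, chartMap_mk, hG]
    have h0 : Away.map (coordGradedHom f) t (Away.mk _ (mem_polyGrading_one π ht) δ f hf') = 0 := by
      rw [Away.map_mk]
      apply val_injective
      rw [Away.val_mk, val_zero]
      have : coordGradedHom f f = 0 :=
        Ideal.Quotient.eq_zero_iff_mem.mpr (Ideal.mem_span_singleton_self f)
      rw [this, Localization.mk_zero]
    rw [h, map_mul, h0, zero_mul]

include hf in
/-- On a reduced hypersurface, the equation in an affine chart has no nonconstant square factor. -/
theorem exists_eq_C_of_sq_dvd (hf0 : f ≠ 0) (hX : IsReduced (hypersurface hf))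
    (U : MvPolynomial (Fin n) K) (hU : U ^ 2 ∣ dehom π f) : ∃ r, U = MvPolynomial.C r := by
  let := coordGradedAlgebra hf
  obtain ⟨W, hW⟩ := hU
  set t : MvPolynomial (Fin (n + 1)) K := MvPolynomial.X (π.symm 0) with ht
  have hX' : IsReduced (Proj (coordGrading f)) := hX
  have ht1 : coordGradedHom f t ∈ coordGrading f 1 :=
    (coordGradedHom f).map_mem (mem_polyGrading_one π ht)
  have hred : _root_.IsReduced (Away (coordGrading f) (coordGradedHom f t)) := by
    have := isReduced_of_isOpenImmersion (Proj.awayι (coordGrading f) _ ht1 one_pos)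
    exact (affine_isReduced_iff _).mp this
  obtain ⟨b, hb⟩ := chartMap_surjective π ht (U * W)
  have h1 : Away.map (coordGradedHom f) t (b ^ 2) = 0 := by
    rw [coordMap_eq_zero_iff π ht hf, map_pow, hb, hW]
    exact ⟨W, by ring⟩
  rw [map_pow] at h1
  have h2 := pow_eq_zero_iff two_ne_zero |>.mp h1
  rw [coordMap_eq_zero_iff π ht hf, hb, hW] at h2
  obtain ⟨Q, hQ⟩ := h2
  have hne := dehom_ne_zero π hf hf0
  rw [hW] at hne
  have hUW : U * W ≠ 0 := fun h => hne (by rw [sq, mul_assoc, h, mul_zero])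
  have hunit : IsUnit U := by
    refine IsUnit.of_mul_eq_one Q ?_
    apply mul_left_cancel₀ hUW
    rw [mul_one]
    calc U * W * (U * Q) = U ^ 2 * W * Q := by ring
      _ = U * W := hQ.symm
  obtain ⟨r, -, hr⟩ := MvPolynomial.isUnit_iff_eq_C_of_isReduced.mp hunit
  exact ⟨r, hr⟩

end Field

end Chart

end ReducedReduction

namespace ReducedReduction

open HomogeneousLocalization

universe u

/-! ### The charts of the reduction of the Zariski closure -/

section Zariski

attribute [local instance] MvPolynomial.gradedAlgebra

variable {n : ℕ} (π : Equiv.Perm (Fin (n + 1))) {K : Type u} [Field K] {δ : ℕ}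
  {f : MvPolynomial (Fin (n + 1)) K} (hf : f.IsHomogeneous δ)

/-- The ideal of the Zariski closure of the hypersurface in an affine chart: the polynomials with
integral coefficients that are multiples of the dehomogenised equation over the field. -/
noncomputable def chartIdeal (f : MvPolynomial (Fin (n + 1)) K) :
    Ideal (MvPolynomial (Fin n) (𝓞 K)) :=
  (Ideal.span {dehom π f}).comap (MvPolynomial.map (algebraMap (𝓞 K) K))

/-- The morphism whose scheme-theoretic image is the Zariski closure. -/
noncomputable def closureMap : hypersurface hf ⟶ projSpace n (𝓞 K) :=
  hypersurfaceι hf ≫ projSpaceMap n (𝓞 K) K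

/-- The open subset `T_j ≠ 0` of projective space. -/
noncomputable def chartOpen (n : ℕ) (R : Type u) [CommRing R] (j : Fin (n + 1)) :
    (projSpace n R).Opens :=
  Proj.basicOpen (polyGrading n R) (MvPolynomial.X j)

theorem X_mem_polyGrading (R : Type u) [CommRing R] (j : Fin (n + 1)) :
    (MvPolynomial.X j : MvPolynomial (Fin (n + 1)) R) ∈ polyGrading n R 1 :=
  MvPolynomial.isHomogeneous_X R j

theorem isAffineOpen_chartOpen (R : Type u) [CommRing R] (j : Fin (n + 1)) :
    IsAffineOpen (chartOpen n R j) :=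
  Proj.isAffineOpen_basicOpen _ _ (X_mem_polyGrading R j) one_pos

theorem iSup_chartOpen (R : Type u) [CommRing R] : ⨆ j, chartOpen n R j = ⊤ := by
  refine Proj.iSup_basicOpen_eq_top' (polyGrading n R) (fun j : Fin (n + 1) => MvPolynomial.X j)
    (fun j => ⟨1, X_mem_polyGrading R j⟩) ?_
  rw [eq_top_iff]
  intro P hP
  clear hP
  induction P using MvPolynomial.induction_on with
  | C r => exact Subalgebra.algebraMap_mem _ (algebraMap R (polyGrading n R 0) r)
  | add p q hp hq => exact add_mem hp hq
  | mul_X p i hp => exact mul_mem hp (Algebra.subset_adjoin ⟨i, rfl⟩)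

/-- The sections of the structure sheaf over a standard chart. -/
noncomputable def awayToChart (n : ℕ) (R : Type u) [CommRing R] (j : Fin (n + 1)) :
    CommRingCat.of (Away (polyGrading n R) (MvPolynomial.X j)) ⟶
      Γ(projSpace n R, chartOpen n R j) :=
  Proj.awayToSection (polyGrading n R) (MvPolynomial.X j)

theorem isIso_awayToChart (R : Type u) [CommRing R] (j : Fin (n + 1)) :
    IsIso (awayToChart n R j) :=
  (Proj.basicOpenIsoAway (polyGrading n R) _ (X_mem_polyGrading R j) one_pos).isIso_hom

variable {j : Fin (n + 1)} (hj : π.symm 0 = j)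

theorem closureMap_app_eq_zero_iff
    (a : Away (polyGrading n (𝓞 K)) (MvPolynomial.X j)) :
    ((closureMap hf).app (chartOpen n (𝓞 K) j)).hom ((awayToChart n (𝓞 K) j).hom a) = 0 ↔
      chartMap π (by rw [hj]) a ∈ chartIdeal π f := by
  let := coordGradedAlgebra hf
  have ht : (MvPolynomial.X j : MvPolynomial (Fin (n + 1)) (𝓞 K)) = MvPolynomial.X (π.symm 0) := by
    rw [hj]
  have ht' : polyGradedHom n (𝓞 K) K (MvPolynomial.X j) = MvPolynomial.X (π.symm 0) := by
    rw [hj]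
    exact MvPolynomial.map_X _ _
  have h1 := Proj.awayToSection_comp_appLE (polyGradedHom n (𝓞 K) K)
    (irrelevant_le_map_polyGradedHom n (𝓞 K) K) (mem_polyGrading_one π ht)
  have h2 := Proj.awayToSection_comp_appLE (coordGradedHom f)
    (irrelevant_le_map_coordGradedHom hf) (mem_polyGrading_one π ht')
  have h3 : awayToChart n (𝓞 K) j ≫ (closureMap hf).app (chartOpen n (𝓞 K) j) =
      CommRingCat.ofHom (Away.map (polyGradedHom n (𝓞 K) K) (MvPolynomial.X j)) ≫
      CommRingCat.ofHom (Away.map (coordGradedHom f)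
        (polyGradedHom n (𝓞 K) K (MvPolynomial.X j))) ≫
      Proj.awayToSection (coordGrading f)
        (coordGradedHom f (polyGradedHom n (𝓞 K) K (MvPolynomial.X j))) := by
    rw [← h2, ← Category.assoc, ← h1, Category.assoc]
    congr 1
  have h4 : ((closureMap hf).app (chartOpen n (𝓞 K) j)).hom ((awayToChart n (𝓞 K) j).hom a) =
      (Proj.awayToSection (coordGrading f)
        (coordGradedHom f (polyGradedHom n (𝓞 K) K (MvPolynomial.X j)))).hom
      (Away.map (coordGradedHom f) (polyGradedHom n (𝓞 K) K (MvPolynomial.X j))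
        (Away.map (polyGradedHom n (𝓞 K) K) (MvPolynomial.X j) a)) :=
    congrArg (fun g => g.hom a) h3
  have hinj : Function.Injective (Proj.awayToSection (coordGrading f)
      (coordGradedHom f (polyGradedHom n (𝓞 K) K (MvPolynomial.X j)))).hom := by
    have hiso : IsIso (Proj.awayToSection (coordGrading f)
        (coordGradedHom f (polyGradedHom n (𝓞 K) K (MvPolynomial.X j)))) :=
      (Proj.basicOpenIsoAway (coordGrading f) _
        ((coordGradedHom f).map_mem (mem_polyGrading_one π ht')) one_pos).isIso_hom
    exact (ConcreteCategory.bijective_of_isIso _).1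
  rw [h4]
  refine (map_eq_zero_iff _ hinj).trans ?_
  rw [coordMap_eq_zero_iff π ht' hf, chartMap_map π ht ht' a, chartIdeal, Ideal.mem_comap,
    Ideal.mem_span_singleton]

instance : QuasiCompact (closureMap hf) := by
  let := coordGradedAlgebra hf
  have : IsAffineHom (closureMap hf) := by
    refine isAffineHom_of_forall_exists_isAffineOpen _ fun x => ?_
    have hx : x ∈ ⨆ j, chartOpen n (𝓞 K) j := by
      rw [iSup_chartOpen]
      trivial
    obtain ⟨j, hj⟩ := TopologicalSpace.Opens.mem_iSup.mp hx
    refine ⟨_, hj, isAffineOpen_chartOpen _ j, ?_⟩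
    have h1 : coordGradedHom f (polyGradedHom n (𝓞 K) K (MvPolynomial.X j)) ∈ coordGrading f 1 :=
      (coordGradedHom f).map_mem ((polyGradedHom n (𝓞 K) K).map_mem (X_mem_polyGrading _ j))
    exact Proj.isAffineOpen_basicOpen (coordGrading f) _ h1 one_pos
  infer_instance

/-- The base change of `Spec M → Spec R` to `R ⧸ p` is reduced if `M ⧸ pM` is reduced. -/
theorem isReduced_pullback_quotient {R M : Type u} [CommRing R] [CommRing M] (φ : R →+* M)
    (p : Ideal R) (h : _root_.IsReduced (M ⧸ p.map φ)) :
    IsReduced (pullback (Spec.map (CommRingCat.ofHom φ))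
      (Spec.map (CommRingCat.ofHom (Ideal.Quotient.mk p)))) := by
  let := φ.toAlgebra
  have h1 : _root_.IsReduced (TensorProduct R M (R ⧸ p)) :=
    isReduced_of_injective (Algebra.TensorProduct.quotIdealMapEquivTensorQuot M p).symm
      (Algebra.TensorProduct.quotIdealMapEquivTensorQuot M p).symm.injective
  have : IsReduced (Spec (CommRingCat.of (TensorProduct R M (R ⧸ p)))) := inferInstance
  exact isReduced_of_isOpenImmersion (pullbackSpecIso R M (R ⧸ p)).hom

/-- If a quotient of `P` by an ideal containing `p` is reduced, this passes to a ring that is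
isomorphic to the quotient. -/
theorem isReduced_quotient_map {R P M : Type*} [CommRing R] [CommRing P] [CommRing M]
    (φ : R →+* P) (σ : P →+* M) (hσ : Function.Surjective σ) (p : Ideal R)
    (h : (RingHom.ker σ ⊔ p.map φ).IsRadical) :
    _root_.IsReduced (M ⧸ p.map (σ.comp φ)) := by
  rw [← Ideal.isRadical_iff_quotient_reduced, ← Ideal.map_map]
  have hcomap : ((p.map φ).map σ).comap σ = RingHom.ker σ ⊔ p.map φ := by
    rw [Ideal.comap_map_of_surjective σ hσ, sup_comm]
    rfl
  rintro x ⟨m, hm⟩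
  obtain ⟨y, rfl⟩ := hσ x
  rw [← map_pow] at hm
  have h1 : y ^ m ∈ RingHom.ker σ ⊔ p.map φ := hcomap ▸ Ideal.mem_comap.mpr hm
  have h2 : y ∈ RingHom.ker σ ⊔ p.map φ := h ⟨m, h1⟩
  rw [← hcomap] at h2
  exact h2

/-- The open cover of the Zariski closure by the closed subschemes of the standard charts. -/
noncomputable def closureCover : (closureMap hf).image.AffineOpenCover where
  I₀ := Fin (n + 1)
  X j := (closureMap hf).ker.subschemeCover.X ⟨_, isAffineOpen_chartOpen (𝓞 K) j⟩
  f j := (closureMap hf).ker.subschemeCover.f ⟨_, isAffineOpen_chartOpen (𝓞 K) j⟩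
  idx x := (TopologicalSpace.Opens.mem_iSup.mp
    (show (closureMap hf).imageι x ∈ ⨆ j, chartOpen n (𝓞 K) j by
      rw [iSup_chartOpen]; trivial)).choose
  covers x := by
    have h := (TopologicalSpace.Opens.mem_iSup.mp
      (show (closureMap hf).imageι x ∈ ⨆ j, chartOpen n (𝓞 K) j by
        rw [iSup_chartOpen]; trivial)).choose_spec
    have := (closureMap hf).ker.subschemeCover.map_prop ⟨_, isAffineOpen_chartOpen (𝓞 K)
      (TopologicalSpace.Opens.mem_iSup.mp
        (show (closureMap hf).imageι x ∈ ⨆ j, chartOpen n (𝓞 K) j by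
          rw [iSup_chartOpen]; trivial)).choose⟩
    change x ∈ ((closureMap hf).ker.subschemeCover.f ⟨_, isAffineOpen_chartOpen (𝓞 K) _⟩).opensRange
    rw [Scheme.IdealSheafData.opensRange_subschemeCover_map]
    exact h
  map_prop j := (closureMap hf).ker.subschemeCover.map_prop _

/-- The inclusion of a basic open subset of `Proj`, expressed with the ring of homogeneous
fractions. -/
theorem fromSpec_basicOpen {A : Type u} [CommRing A] {σ : Type*} [SetLike σ A]
    [AddSubgroupClass σ A] (𝒜 : ℕ → σ) [GradedRing 𝒜] {t : A} {m : ℕ} (ht : t ∈ 𝒜 m) (hm : 0 < m) :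
    (Proj.isAffineOpen_basicOpen 𝒜 t ht hm).fromSpec =
      Spec.map (Proj.awayToSection 𝒜 t) ≫ Proj.awayι 𝒜 t ht hm := by
  have h1 : (Proj.isAffineOpen_basicOpen 𝒜 t ht hm).isoSpec.inv =
      Spec.map (Proj.awayToSection 𝒜 t) ≫ (Proj.basicOpenIsoSpec 𝒜 t ht hm).inv := by
    rw [Iso.eq_comp_inv, Iso.inv_comp_eq]
    rfl
  rw [IsAffineOpen.fromSpec, h1, Category.assoc]
  rfl

theorem awayι_toSpecZero_comp {A : Type u} [CommRing A] {σ : Type u} [SetLike σ A]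
    [AddSubgroupClass σ A] (𝒜 : ℕ → σ) [GradedRing 𝒜] {t : A} {m : ℕ} (ht : t ∈ 𝒜 m) (hm : 0 < m)
    {R : Type u} [CommRing R] (φ : R →+* 𝒜 0) :
    Proj.awayι 𝒜 t ht hm ≫ Proj.toSpecZero 𝒜 ≫ Spec.map (CommRingCat.ofHom φ) =
      Spec.map (CommRingCat.ofHom ((fromZeroRingHom 𝒜 (Submonoid.powers t)).comp φ)) := by
  rw [Proj.awayι_toSpecZero_assoc, ← Spec.map_comp]
  rfl

/-- The inclusion of a standard chart of projective space. -/
noncomputable def chartInclusion (n : ℕ) (R : Type u) [CommRing R] (j : Fin (n + 1)) :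
    Spec (CommRingCat.of (Away (polyGrading n R) (MvPolynomial.X j))) ⟶ projSpace n R :=
  Proj.awayι (polyGrading n R) _ (X_mem_polyGrading R j) one_pos

theorem fromSpec_chartOpen (R : Type u) [CommRing R] (j : Fin (n + 1)) :
    (isAffineOpen_chartOpen R j).fromSpec =
      Spec.map (awayToChart n R j) ≫ chartInclusion n R j :=
  fromSpec_basicOpen (polyGrading n R) (X_mem_polyGrading R j) one_pos

theorem chartInclusion_projSpaceToSpec (R : Type u) [CommRing R] (j : Fin (n + 1)) :
    chartInclusion n R j ≫ projSpaceToSpec n R =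
      Spec.map (CommRingCat.ofHom ((fromZeroRingHom (polyGrading n R)
        (Submonoid.powers (MvPolynomial.X j))).comp (algebraMap R (polyGrading n R 0)))) :=
  awayι_toSpecZero_comp (polyGrading n R) (X_mem_polyGrading R j) one_pos _

include hf in
/-- The reduction of the Zariski closure is reduced if the equations in all charts define reduced
rings modulo `p`. -/
theorem isReduced_reduction (p : Ideal (𝓞 K))
    (h : ∀ π : Equiv.Perm (Fin (n + 1)), (chartIdeal π f ⊔ p.map MvPolynomial.C).IsRadical) :
    IsReduced (reduction hf p) := by
  let 𝒰 := Scheme.Pullback.openCoverOfLeft (closureCover hf).openCover (zariskiClosureToSpec hf)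
    (Spec.map (CommRingCat.ofHom (Ideal.Quotient.mk p)))
  suffices ∀ j, IsReduced (𝒰.X j) from IsReduced.of_openCover _ 𝒰
  intro (j : Fin (n + 1))
  let U : (projSpace n (𝓞 K)).affineOpens := ⟨_, isAffineOpen_chartOpen (𝓞 K) j⟩
  let I := (closureMap hf).ker
  -- The chart of the Zariski closure is the spectrum of a quotient of a polynomial ring.
  let φ : 𝓞 K →+* Away (polyGrading n (𝓞 K)) (MvPolynomial.X j) :=
    (fromZeroRingHom (polyGrading n (𝓞 K)) _).comp (algebraMap (𝓞 K) (polyGrading n (𝓞 K) 0))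
  let ρ : Away (polyGrading n (𝓞 K)) (MvPolynomial.X j) →+* Γ(projSpace n (𝓞 K), U) ⧸ I.ideal U :=
    (Ideal.Quotient.mk (I.ideal U)).comp (awayToChart n (𝓞 K) j).hom
  have hmor : I.subschemeCover.f U ≫ zariskiClosureToSpec hf =
      Spec.map (CommRingCat.ofHom (ρ.comp φ)) := by
    have h1 : I.subschemeCover.f U ≫ I.subschemeι =
        Spec.map (CommRingCat.ofHom (Ideal.Quotient.mk (I.ideal U))) ≫
          Spec.map (awayToChart n (𝓞 K) j) ≫ chartInclusion n (𝓞 K) j := by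
      rw [← fromSpec_chartOpen]
      exact (I.subschemeCover_map_subschemeι U).trans (I.glueDataObjι_ι U)
    have h2 : (Spec.map (CommRingCat.ofHom (Ideal.Quotient.mk (I.ideal U))) ≫
        Spec.map (awayToChart n (𝓞 K) j) ≫ chartInclusion n (𝓞 K) j) ≫ projSpaceToSpec n (𝓞 K) =
          Spec.map (CommRingCat.ofHom (ρ.comp φ)) := by
      rw [Category.assoc, Category.assoc, chartInclusion_projSpaceToSpec, ← Spec.map_comp,
        ← Spec.map_comp]
      rfl
    exact (congrArg (· ≫ projSpaceToSpec n (𝓞 K)) h1).trans h2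
  have hX : IsReduced (pullback (I.subschemeCover.f U ≫ zariskiClosureToSpec hf)
      (Spec.map (CommRingCat.ofHom (Ideal.Quotient.mk p)))) := by
    rw [hmor]
    refine isReduced_pullback_quotient (ρ.comp φ) p ?_
    have hj : (Equiv.swap 0 j).symm 0 = j := by simp
    have ht : (MvPolynomial.X j : MvPolynomial (Fin (n + 1)) (𝓞 K)) =
        MvPolynomial.X ((Equiv.swap 0 j).symm 0) := by rw [hj]
    let e : Away (polyGrading n (𝓞 K)) (MvPolynomial.X j) ≃+* MvPolynomial (Fin n) (𝓞 K) :=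
      RingEquiv.ofBijective (chartMap _ ht) ⟨chartMap_injective _ ht, chartMap_surjective _ ht⟩
    let σ := ρ.comp e.symm.toRingHom
    have hbij : Function.Bijective (awayToChart n (𝓞 K) j).hom :=
      have := isIso_awayToChart (n := n) (𝓞 K) j
      ConcreteCategory.bijective_of_isIso _
    have hσ : Function.Surjective σ :=
      (Ideal.Quotient.mk_surjective.comp hbij.2).comp e.symm.surjective
    have hσC : σ.comp MvPolynomial.C = ρ.comp φ := by
      ext r
      have : e.symm (MvPolynomial.C r) = φ r := by
        rw [RingEquiv.symm_apply_eq]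
        exact (chartMap_fromZeroRingHom _ ht r).symm
      exact congrArg ρ this
    have hker : RingHom.ker σ = chartIdeal (Equiv.swap 0 j) f := by
      ext q
      obtain ⟨a, rfl⟩ := e.surjective q
      rw [RingHom.mem_ker]
      have h1 : σ (e a) = ρ a := congrArg ρ (e.symm_apply_apply a)
      rw [h1]
      refine Ideal.Quotient.eq_zero_iff_mem.trans ?_
      rw [Scheme.Hom.ker_apply]
      exact closureMap_app_eq_zero_iff _ hf hj a
    rw [← hσC]
    refine isReduced_quotient_map _ σ hσ p ?_
    rw [hker]
    exact h _
  exact hX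

end Zariski

end ReducedReduction

namespace ReducedReduction

open IsDedekindDomain MvPolynomial

universe u

/-! ### Reduction modulo a maximal ideal and Gauss's lemma -/

section Gauss

variable {K : Type u} [Field K] [NumberField K] (p : HeightOneSpectrum (𝓞 K))

/-- An element of nonnegative valuation is a fraction whose denominator is prime to `p`. -/
theorem exists_mul_eq_algebraMap {x : K} (hx : (placeVal p).Ge 0 x) :
    ∃ d ∉ p.asIdeal, ∃ a : 𝓞 K, algebraMap (𝓞 K) K a = algebraMap (𝓞 K) K d * x := by
  have hx' : p.valuation K x ≤ 1 := by
    rcases hx with rfl | hx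
    · simp
    · by_cases h0 : x = 0
      · simp [h0]
      have h1 : p.valuation K x ≠ 0 := by simpa using h0
      rw [← WithZero.log_le_log h1 one_ne_zero, WithZero.log_one]
      change 0 ≤ -WithZero.log _ at hx
      lia
  have hmem : x ∈ HeightOneSpectrum.valuationSubringAtPrime K p := by
    rw [HeightOneSpectrum.valuationSubringAtPrime_eq_valuationSubring]
    exact hx'
  obtain ⟨a, s, hs, rfl⟩ := hmem
  have hs0 : algebraMap (𝓞 K) K s ≠ 0 := by
    rw [Ne, FaithfulSMul.algebraMap_eq_zero_iff]
    rintro rfl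
    exact hs p.asIdeal.zero_mem
  exact ⟨s, hs, a, by field_simp⟩

variable {σ : Type*}

/-- A polynomial with coefficients of nonnegative valuation has a common denominator that is prime
to `p`. -/
theorem exists_notMem_C_mul_eq_map {Q : MvPolynomial σ K}
    (hQ : ∀ α, (placeVal p).Ge 0 (Q.coeff α)) :
    ∃ d ∉ p.asIdeal, ∃ Q' : MvPolynomial σ (𝓞 K),
      map (algebraMap (𝓞 K) K) Q' = C (algebraMap (𝓞 K) K d) * Q := by
  rw [Q.as_sum]
  refine Finset.sum_induction (fun α => monomial α (Q.coeff α))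
    (fun P => ∃ d ∉ p.asIdeal, ∃ Q' : MvPolynomial σ (𝓞 K),
      map (algebraMap (𝓞 K) K) Q' = C (algebraMap (𝓞 K) K d) * P) ?_ ?_ ?_
  · rintro P₁ P₂ ⟨d₁, hd₁, Q₁, h₁⟩ ⟨d₂, hd₂, Q₂, h₂⟩
    refine ⟨d₁ * d₂, fun h => (p.isPrime.mem_or_mem h).elim hd₁ hd₂, C d₂ * Q₁ + C d₁ * Q₂, ?_⟩
    simp only [_root_.map_add, _root_.map_mul, map_C, h₁, h₂]
    ring
  · exact ⟨1, fun h => p.isPrime.ne_top ((Ideal.eq_top_iff_one _).mpr h), 0, by simp⟩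
  · intro α _
    obtain ⟨d, hd, a, ha⟩ := exists_mul_eq_algebraMap p (hQ α)
    exact ⟨d, hd, monomial α a, by rw [map_monomial, ha, C_mul_monomial]⟩

variable {p} {m : ℕ}

theorem placeVal_eq_zero {a : 𝓞 K} (ha : a ∉ p.asIdeal) :
    algebraMap (𝓞 K) K a ≠ 0 ∧ placeVal p (algebraMap (𝓞 K) K a) = 0 := by
  have h1 := (placeVal_ge_one_iff p a).not.mpr ha
  have h0 : algebraMap (𝓞 K) K a ≠ 0 := fun h => h1 (Or.inl h)
  have h2 : ¬ 1 ≤ placeVal p (algebraMap (𝓞 K) K a) := fun h => h1 (Or.inr h)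
  have h3 := (placeVal_ge_zero p a).le h0
  exact ⟨h0, by lia⟩

/-- The Gauss valuation of a multiple of a primitive polynomial. -/
theorem mv_C_mul_map {c : K} (hc : c ≠ 0) {G : MvPolynomial (Fin m) (𝓞 K)}
    (hG : ∃ α, G.coeff α ∉ p.asIdeal) :
    (placeVal p).mv (C c * map (algebraMap (𝓞 K) K) G) = placeVal p c := by
  obtain ⟨α, hα⟩ := hG
  obtain ⟨h0, h1⟩ := placeVal_eq_zero hα
  refine IntVal.mv_eq_of (α := α) ?_ ?_ fun β => ?_
  · rw [coeff_C_mul, coeff_map]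
    exact mul_ne_zero hc h0
  · rw [coeff_C_mul, coeff_map, IntVal.map_mul _ hc h0, h1, add_zero]
  · rw [coeff_C_mul, coeff_map]
    simpa using ((placeVal p).ge_self c).mul (placeVal_ge_zero p (G.coeff β))

variable (p) in
/-- Every nonzero polynomial is a multiple of a polynomial with integral coefficients that does not
vanish modulo `p`. -/
theorem exists_eq_C_mul_map {F : MvPolynomial (Fin m) K} (hF : F ≠ 0) :
    ∃ c : K, c ≠ 0 ∧ ∃ G : MvPolynomial (Fin m) (𝓞 K), (∃ α, G.coeff α ∉ p.asIdeal) ∧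
      F = C c * map (algebraMap (𝓞 K) K) G := by
  obtain ⟨α, hα, hv⟩ := (placeVal p).exists_eq_mv hF
  have hinv : placeVal p (F.coeff α)⁻¹ = -(placeVal p).mv F := by
    have h := IntVal.map_mul (placeVal p) hα (inv_ne_zero hα)
    rw [mul_inv_cancel₀ hα, IntVal.map_one] at h
    lia
  obtain ⟨d, hd, G, hG⟩ := exists_notMem_C_mul_eq_map p (Q := C (F.coeff α)⁻¹ * F) fun β => by
    rw [coeff_C_mul]
    simpa [hinv] using ((placeVal p).ge_self (F.coeff α)⁻¹).mul ((placeVal p).ge_mv F β)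
  obtain ⟨hd0, -⟩ := placeVal_eq_zero hd
  refine ⟨F.coeff α / algebraMap (𝓞 K) K d, div_ne_zero hα hd0, G, ⟨α, ?_⟩, ?_⟩
  · have h := congrArg (coeff α) hG
    rw [coeff_map, coeff_C_mul, coeff_C_mul, inv_mul_cancel₀ hα, mul_one] at h
    rwa [FaithfulSMul.algebraMap_injective (𝓞 K) K h]
  · rw [hG, ← mul_assoc, ← mul_assoc, ← C_mul, ← C_mul]
    field_simp
    rw [C_1, one_mul]

variable {k : Type u} [Field k] {r : 𝓞 K →+* k} (hker : RingHom.ker r = p.asIdeal)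

omit [NumberField K] in
include hker in
theorem exists_coeff_notMem_iff {G : MvPolynomial (Fin m) (𝓞 K)} :
    (∃ α, G.coeff α ∉ p.asIdeal) ↔ map r G ≠ 0 := by
  rw [MvPolynomial.ne_zero_iff]
  simp only [coeff_map, ← hker, RingHom.mem_ker, Ne]

include hker in
/-- Gauss's lemma: divisibility by a primitive polynomial over the field of fractions implies
divisibility up to a constant that is prime to `p`. -/
theorem exists_dvd_C_mul {G Q : MvPolynomial (Fin m) (𝓞 K)} (hG : map r G ≠ 0)
    (h : map (algebraMap (𝓞 K) K) G ∣ map (algebraMap (𝓞 K) K) Q) :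
    ∃ d ∉ p.asIdeal, G ∣ C d * Q := by
  have hinj := map_injective (σ := Fin m) _ (FaithfulSMul.algebraMap_injective (𝓞 K) K)
  obtain ⟨H, hH⟩ := h
  rcases eq_or_ne H 0 with rfl | hH0
  · rw [mul_zero] at hH
    have hQ : Q = 0 := hinj (by rw [hH, map_zero])
    exact ⟨1, fun h => p.isPrime.ne_top ((Ideal.eq_top_iff_one _).mpr h), by simp [hQ]⟩
  obtain ⟨c, hc, H', hH', rfl⟩ := exists_eq_C_mul_map p hH0
  have hGH : map r (G * H') ≠ 0 := by
    rw [_root_.map_mul]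
    exact mul_ne_zero hG ((exists_coeff_notMem_iff hker).mp hH')
  have hQ : map (algebraMap (𝓞 K) K) Q = C c * map (algebraMap (𝓞 K) K) (G * H') := by
    rw [hH, _root_.map_mul]
    ring
  -- The valuation of the content of the cofactor is that of `Q`, hence nonnegative.
  have hcv : (placeVal p).Ge 0 c := by
    obtain ⟨α, hα⟩ := (exists_coeff_notMem_iff hker).mpr hGH
    obtain ⟨h0, h1⟩ := placeVal_eq_zero hα
    have h2 := congrArg (coeff α) hQ
    rw [coeff_map, coeff_C_mul, coeff_map] at h2
    have h3 := (placeVal_ge_zero p (Q.coeff α)).le (by rw [h2]; exact mul_ne_zero hc h0)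
    rw [h2, IntVal.map_mul _ hc h0, h1, add_zero] at h3
    exact Or.inr h3
  obtain ⟨d, hd, a, ha⟩ := exists_mul_eq_algebraMap p hcv
  refine ⟨d, hd, C a * H', hinj ?_⟩
  rw [_root_.map_mul, hQ, map_C, ← mul_assoc, ← C_mul, ← ha]
  simp only [_root_.map_mul, map_C]
  ring

include hker in
/-- If the reduction of a primitive polynomial is squarefree, then the ideal of its multiples with
integral coefficients is radical modulo `p`. -/
theorem isRadical_comap_span_sup (hr : Function.Surjective r) {G : MvPolynomial (Fin m) (𝓞 K)}
    (hG : map r G ≠ 0) (hsq : Squarefree (map r G)) :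
    ((Ideal.span {map (algebraMap (𝓞 K) K) G}).comap (map (algebraMap (𝓞 K) K)) ⊔
      p.asIdeal.map C).IsRadical := by
  have hrad : (Ideal.span {map r G}).IsRadical :=
    isRadical_iff_span_singleton.mp hsq.isRadical
  convert hrad.comap (map r) using 1
  ext Q
  constructor
  · refine fun h => (show _ ≤ (Ideal.span {map r G}).comap (map r) from
      sup_le (fun Q hQ => ?_) ?_) h
    · rw [Ideal.mem_comap, Ideal.mem_span_singleton] at hQ ⊢
      obtain ⟨d, hd, hdvd⟩ := exists_dvd_C_mul hker hG hQ
      have h1 := _root_.map_dvd (map r) hdvd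
      rw [_root_.map_mul, map_C] at h1
      rw [← hker, RingHom.mem_ker] at hd
      exact (IsUnit.dvd_mul_left ((isUnit_iff_ne_zero.mpr hd).map C)).mp h1
    · rw [← hker, ← MvPolynomial.ker_map]
      exact Ideal.ker_le_comap _
  · intro hQ
    rw [Ideal.mem_comap, Ideal.mem_span_singleton] at hQ
    obtain ⟨R, hR⟩ := hQ
    obtain ⟨R, rfl⟩ := map_surjective _ hr R
    rw [← add_sub_cancel (G * R) Q]
    refine Ideal.add_mem _ (Ideal.mem_sup_left ?_) (Ideal.mem_sup_right ?_)
    · rw [Ideal.mem_comap, Ideal.mem_span_singleton, _root_.map_mul]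
      exact dvd_mul_right _ _
    · rw [← hker, ← MvPolynomial.ker_map, RingHom.mem_ker, _root_.map_sub, _root_.map_mul, hR,
        sub_self]

end Gauss

section Places

attribute [local instance] MvPolynomial.gradedAlgebra

variable {n : ℕ} {K : Type u} [Field K] [NumberField K] {p : HeightOneSpectrum (𝓞 K)} {δ : ℕ}
  {f : MvPolynomial (Fin (n + 1)) K} (hf : f.IsHomogeneous δ)

include hf in
/-- If the reduction of the Zariski closure modulo `p` is not reduced, then the reduction of the
equation is divisible by the square of a nonconstant form `U`. If the dehomogenisation of `U` is not
constant, then the dehomogenised equation is nearly a multiple of a square. Otherwise the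
dehomogenisation lowers the degree by at least two. -/
theorem topSmall_or_nearSquare (hf0 : f ≠ 0) (h : ¬ IsReduced (reduction hf p.asIdeal))
    (π : Equiv.Perm (Fin (n + 1))) {N : ℕ} (hN : 1 ≤ N) (hδ : δ ≤ N + 1) :
    (placeVal p).TopSmall (dehom π f) N 1 ∨ (placeVal p).NearSquare (dehom π f) := by
  let r := algebraMap (𝓞 K) p.asIdeal.ResidueField
  have hker : RingHom.ker r = p.asIdeal := Ideal.ker_algebraMap_residueField _
  have hr : Function.Surjective r :=
    have := p.isMaximal
    p.asIdeal.algebraMap_residueField_surjective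
  obtain ⟨c, hc, G, hG, hfG⟩ := exists_eq_C_mul_map p hf0
  have hGhom : G.IsHomogeneous δ := by
    intro α hα
    refine hf ?_
    rw [hfG, coeff_C_mul, coeff_map]
    exact mul_ne_zero hc (by simpa using hα)
  have hdehom : ∀ π, dehom π f = C c * map (algebraMap (𝓞 K) K) (dehom π G) := by
    intro π
    rw [map_dehom, hfG, _root_.map_mul, ← algebraMap_eq, AlgHom.commutes, algebraMap_eq]
  have hG0 := (exists_coeff_notMem_iff hker).mp hG
  have hGhom' : (map r G).IsHomogeneous δ := hGhom.map r
  have hGπ : ∀ π, map r (dehom π G) ≠ 0 := by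
    intro π
    rw [map_dehom]
    exact dehom_ne_zero π hGhom' hG0
  have hmem : ∀ {a}, r a = 0 ↔ a ∈ p.asIdeal := by
    intro a
    exact RingHom.mem_ker.symm.trans (by rw [hker])
  -- Some dehomogenisation of the reduced equation is not squarefree.
  obtain ⟨π', hπ'⟩ : ∃ π', ¬ Squarefree (map r (dehom π' G)) := by
    by_contra! hsq
    refine h (isReduced_reduction hf p.asIdeal fun π => ?_)
    have h1 := isRadical_comap_span_sup hker hr (hGπ π) (hsq π)
    rwa [← Ideal.span_singleton_mul_left_unit ((isUnit_iff_ne_zero.mpr hc).map C), ← hdehom] at h1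
  rw [Squarefree] at hπ'
  push Not at hπ'
  obtain ⟨u, ⟨w, huw⟩, hu⟩ := hπ'
  rw [map_dehom, ← pow_two] at huw
  obtain ⟨U, W, hU, he, hW, hUW⟩ := exists_eq_sq_mul_of_dehom π' hGhom' hG0 huw
  have he1 : 1 ≤ u.totalDegree := by
    by_contra! h0
    have h1 : u = C (u.coeff 0) := totalDegree_eq_zero_iff_eq_C.mp (by lia)
    have h2 : u.coeff 0 ≠ 0 := by
      intro h2
      rw [h2, C_0] at h1
      rw [h1] at huw
      exact dehom_ne_zero π' hGhom' hG0 (by rw [huw]; ring)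
    exact hu (h1 ▸ (isUnit_iff_ne_zero.mpr h2).map C)
  have hcoeff : ∀ a : 𝓞 K, a ∈ p.asIdeal →
      (placeVal p).Ge ((placeVal p).mv (dehom π f) + 1) (c * algebraMap (𝓞 K) K a) := by
    intro a ha
    rw [hdehom, mv_C_mul_map hc ((exists_coeff_notMem_iff hker).mpr (hGπ π))]
    exact ((placeVal p).ge_self c).mul ((placeVal_ge_one_iff p a).mpr ha)
  by_cases hcase : ∃ α, α ≠ 0 ∧ (dehom π U).coeff α ≠ 0
  · right
    obtain ⟨α, hα, hUα⟩ := hcase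
    obtain ⟨U', hU'⟩ := map_surjective _ hr (dehom π U)
    obtain ⟨W', hW'⟩ := map_surjective _ hr (dehom π W)
    have hα' : U'.coeff α ∉ p.asIdeal := by
      rw [← hU', coeff_map] at hUα
      exact fun h => hUα (hmem.mpr h)
    refine ⟨c, map (algebraMap (𝓞 K) K) U', map (algebraMap (𝓞 K) K) W', ?_, fun β => ?_,
      fun β => ?_, fun β => ?_, α, hα, ?_⟩
    · rw [hdehom, mv_C_mul_map hc ((exists_coeff_notMem_iff hker).mpr (hGπ π))]
      exact (placeVal p).ge_self c
    · rw [coeff_map]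
      exact placeVal_ge_zero p _
    · rw [coeff_map]
      exact placeVal_ge_zero p _
    · have h1 : dehom π f - C c * map (algebraMap (𝓞 K) K) U' ^ 2 * map (algebraMap (𝓞 K) K) W' =
          C c * map (algebraMap (𝓞 K) K) (dehom π G - U' ^ 2 * W') := by
        rw [hdehom]
        simp only [_root_.map_sub, _root_.map_mul, _root_.map_pow]
        ring
      rw [h1, coeff_C_mul, coeff_map]
      refine hcoeff _ (hmem.mp ?_)
      rw [← coeff_map]
      simp only [_root_.map_sub, _root_.map_mul, _root_.map_pow, hU', hW', map_dehom, hUW,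
        sub_self, coeff_zero]
    · rw [coeff_map]
      exact placeVal_eq_zero hα'
  · left
    push Not at hcase
    have hUC : dehom π U = C ((dehom π U).coeff 0) := by
      ext α
      rw [coeff_C]
      split_ifs with h
      · rw [h]
      · exact hcase α (Ne.symm h)
    refine ⟨hN, fun α hα => ?_⟩
    rw [hdehom, coeff_C_mul, coeff_map, ← hdehom]
    refine hcoeff _ (hmem.mp ?_)
    rw [← coeff_map, map_dehom, hUW, _root_.map_mul, _root_.map_pow, hUC, ← C_pow, coeff_C_mul,
      coeff_dehom_of_lt π hW (by lia), mul_zero]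

end Places

end ReducedReduction

namespace ReducedReduction

open IsDedekindDomain MvPolynomial

universe u

/-! ### The number of places of nonreduced reduction -/

section Count

attribute [local instance] MvPolynomial.gradedAlgebra

variable {n : ℕ} {K : Type u} [Field K] {δ : ℕ} {f : MvPolynomial (Fin (n + 1)) K}
  (hf : f.IsHomogeneous δ)

include hf in
/-- The equation of a reduced hypersurface is not divisible by the square of a variable. -/
theorem exists_mem_support_le_one (hf0 : f ≠ 0) (hX : IsReduced (hypersurface hf))
    {i j : Fin (n + 1)} (hij : i ≠ j) : ∃ m ∈ f.support, m i ≤ 1 := by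
  by_contra! h
  let π := Equiv.swap j 0
  have hπ : π i ≠ 0 := by
    intro h0
    exact hij (π.injective (by rw [h0]; simp [π]))
  obtain ⟨l, hl⟩ := Fin.exists_succ_eq.mpr hπ
  have hdvd : (X l : MvPolynomial (Fin n) K) ^ 2 ∣ dehom π f := by
    rw [dehom_eq_sum]
    refine Finset.dvd_sum fun m hm => ?_
    rw [X_pow_eq_monomial, monomial_dvd_monomial]
    refine ⟨Or.inr (Finsupp.single_le_iff.mpr ?_), one_dvd _⟩
    rw [resIdx_apply, hl, Equiv.symm_apply_apply]
    exact h m hm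
  obtain ⟨r, hr⟩ := exists_eq_C_of_sq_dvd π hf hf0 hX _ hdvd
  have h1 := congrArg totalDegree hr
  rw [totalDegree_X, totalDegree_C] at h1
  exact one_ne_zero h1

theorem exists_perm_apply_eq {n : ℕ} {i j : Fin (n + 2)} (hij : i ≠ j) :
    ∃ π : Equiv.Perm (Fin (n + 2)), π i = 0 ∧ π j = Fin.last (n + 1) := by
  have h0 : Equiv.swap i 0 j ≠ 0 := by
    intro h
    refine hij ((Equiv.swap i 0).injective ?_)
    rw [h, Equiv.swap_apply_left]
  refine ⟨(Equiv.swap i 0).trans (Equiv.swap (Equiv.swap i 0 j) (Fin.last (n + 1))), ?_, ?_⟩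
  · rw [Equiv.trans_apply, Equiv.swap_apply_left, Equiv.swap_apply_of_ne_of_ne h0.symm]
    exact (Fin.last_pos).ne
  · rw [Equiv.trans_apply, Equiv.swap_apply_left]

theorem dehom_logHeight_le [NumberField K] (π : Equiv.Perm (Fin (n + 1)))
    (hf : f.IsHomogeneous δ) :
    Height.logHeight (fun α : (dehom π f).support => (dehom π f).coeff α) ≤
      Height.logHeight (fun m : f.support => f.coeff m) := by
  have hdeg : ∀ α : (dehom π f).support, (dehom π f).coeff α = f.coeff (liftIdx π δ α) := fun α =>
    coeff_dehom π hf (degree_le_of_mem_support_dehom π hf α.2)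
  have hmem : ∀ α : (dehom π f).support, liftIdx π δ α ∈ f.support := fun α => by
    rw [mem_support_iff, ← hdeg]
    exact mem_support_iff.mp α.2
  have h := Height.logHeight_comp_le (fun α : (dehom π f).support => (⟨_, hmem α⟩ : f.support))
    (fun m : f.support => f.coeff m)
  convert h using 2
  ext α
  exact hdeg α

/-- In `ℙ⁰`, the hypersurface and its closure are empty. -/
theorem isReduced_reduction_of_fin_one {f : MvPolynomial (Fin 1) K} (hf : f.IsHomogeneous δ)
    (hf0 : f ≠ 0) (p : Ideal (𝓞 K)) : IsReduced (reduction (n := 0) hf p) := by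
  refine isReduced_reduction (n := 0) hf p fun π => ?_
  have h1 : dehom π f = C ((dehom π f).coeff 0) := eq_C_of_isEmpty _
  have h2 : (dehom π f).coeff 0 ≠ 0 := fun h2 =>
    dehom_ne_zero π hf hf0 (by rw [h1, h2, C_0])
  have h3 : chartIdeal π f = ⊤ := by
    rw [chartIdeal, Ideal.span_singleton_eq_top.mpr, Ideal.comap_top]
    rw [h1]
    exact (isUnit_iff_ne_zero.mpr h2).map C
  rw [h3, top_sup_eq]
  exact fun _ _ => trivial

variable [NumberField K]

/-- A finite set of places of nonreduced reduction has bounded total size. -/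
theorem sum_log_absNorm_le_of_not_isReduced {s : ℕ} {f : MvPolynomial (Fin (s + 2)) K}
    (hf : f.IsHomogeneous δ) (hδ : 1 ≤ δ) (hf0 : f ≠ 0) (hX : IsReduced (hypersurface hf))
    (I : Finset (HeightOneSpectrum (𝓞 K)))
    (hI : ∀ p ∈ I, ¬ IsReduced (reduction hf p.asIdeal)) :
    ∑ p ∈ I, Real.log (Ideal.absNorm p.asIdeal) ≤
      (2 * δ - 1) * (Height.logHeight (fun m : f.support => f.coeff m) +
        2⁻¹ * Module.finrank ℚ K * Real.log ((s + 1 + δ).choose (s + 1))) +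
          δ * (Module.finrank ℚ K * Real.log δ) := by
  obtain ⟨m, hm⟩ := MvPolynomial.ne_zero_iff.mp hf0
  have hmδ : ∀ m, f.coeff m ≠ 0 → m.degree = δ := fun m hm => by
    by_contra h
    exact hm (hf.coeff_eq_zero h)
  obtain ⟨i₀, hi₀⟩ : ∃ i, m i ≠ 0 := by
    by_contra! h
    have h0 : m = 0 := Finsupp.ext h
    have := hmδ m hm
    rw [h0, map_zero] at this
    lia
  obtain ⟨i₁, hi₁⟩ := exists_ne i₀
  -- The variable `i₁` is set to `1`, and the variable `i₀`, which occurs in `f`, becomes the last.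
  obtain ⟨π, hπ₁, hπ₀⟩ := exists_perm_apply_eq hi₁
  have hlast : ∃ α ∈ (dehom π f).support, 1 ≤ α (Fin.last s) := by
    refine ⟨resIdx π m, ?_, ?_⟩
    · rw [mem_support_iff, coeff_dehom_resIdx π hf (hmδ m hm)]
      exact hm
    · rw [resIdx_apply, Fin.succ_last, ← hπ₀, Equiv.symm_apply_apply]
      lia
  have hne : (dehom π f).support.Nonempty := hlast.imp fun _ h => h.1
  obtain ⟨β, hβ, hmax⟩ := Finset.exists_max_image _ Finsupp.degree hne
  have h1 : 1 ≤ β.degree := by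
    obtain ⟨α, hα, hα1⟩ := hlast
    exact (hα1.trans (Finsupp.le_degree _ α)).trans (hmax α hα)
  have h2 : δ ≤ β.degree + 1 := by
    obtain ⟨m', hm', hle⟩ := exists_mem_support_le_one hf hf0 hX hi₁
    have hm'' := hmδ m' (mem_support_iff.mp hm')
    have h3 := add_degree_resIdx π m'
    rw [← hπ₁, Equiv.symm_apply_apply] at h3
    have h4 := hmax (resIdx π m') (by
      rw [mem_support_iff, coeff_dehom_resIdx π hf hm'']
      exact mem_support_iff.mp hm')
    lia
  refine (sum_log_absNorm_le (fun U hU => exists_eq_C_of_sq_dvd π hf hf0 hX U hU) hlast hmax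
    ⟨β, hβ, rfl⟩ (degree_le_of_mem_support_dehom π hf hβ) I fun p hp =>
      topSmall_or_nearSquare hf hf0 (hI p hp) π h1 h2).trans ?_
  have hδ' : (1 : ℝ) ≤ δ := by exact_mod_cast hδ
  gcongr
  · linarith
  · exact dehom_logHeight_le π hf

omit hf in
/-- A set of maximal ideals of large norm is finite if the sums of the logarithms of the norms over
its finite subsets are bounded. -/
theorem finite_and_ncard_le {S : Set (MaximalSpectrum (𝓞 K))} {N₀ B : ℝ} (hN₀ : 1 < N₀)
    (hS : ∀ P ∈ S, N₀ < (Nat.card (𝓞 K ⧸ P.asIdeal) : ℝ))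
    (hB : ∀ I : Finset (HeightOneSpectrum (𝓞 K)),
      (∀ p ∈ I, ∃ P ∈ S, P.asIdeal = p.asIdeal) →
        ∑ p ∈ I, Real.log (Ideal.absNorm p.asIdeal) ≤ B) :
    S.Finite ∧ (S.ncard : ℝ) ≤ B / Real.log N₀ := by
  have hlog := Real.log_pos hN₀
  have key : ∀ J : Finset (MaximalSpectrum (𝓞 K)), (J : Set _) ⊆ S →
      (J.card : ℝ) ≤ B / Real.log N₀ := by
    intro J hJ
    let e := HeightOneSpectrum.equivMaximalSpectrum (RingOfIntegers.not_isField K)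
    have h1 := hB (J.map e.symm.toEmbedding) fun p hp => by
      obtain ⟨P, hP, rfl⟩ := Finset.mem_map.mp hp
      exact ⟨P, hJ hP, rfl⟩
    rw [le_div_iff₀ hlog, ← nsmul_eq_mul, ← Finset.sum_const]
    refine le_trans ?_ h1
    rw [Finset.sum_map]
    refine Finset.sum_le_sum fun P hP => ?_
    exact Real.log_le_log (by linarith) (hS P (hJ hP)).le
  have hfin : S.Finite := by
    by_contra hinf
    obtain ⟨J, hJ, hcard⟩ := Set.Infinite.exists_subset_card_eq hinf (⌊B / Real.log N₀⌋₊ + 1)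
    have h1 := key J hJ
    rw [hcard] at h1
    have h2 := Nat.lt_floor_add_one (B / Real.log N₀)
    push_cast at h1
    linarith
  refine ⟨hfin, ?_⟩
  rw [Set.ncard_eq_toFinset_card S hfin]
  exact key _ (by simp)

end Count

end ReducedReduction

theorem mainTheorem5 {K : Type*} [Field K] [NumberField K] (n δ : ℕ) (hδ : 1 ≤ δ)
    (f : MvPolynomial (Fin (n + 1)) K) (hf0 : f ≠ 0) (hf : f.IsHomogeneous δ)
    (hX : IsReduced (ReducedReduction.hypersurface hf)) (N₀ : ℝ) (hN₀ : 2 ≤ N₀) :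
    (ReducedReduction.nonReducedPlaces hf N₀).Finite ∧
      ((ReducedReduction.nonReducedPlaces hf N₀).ncard : ℝ) ≤
        (Module.finrank ℚ K : ℝ) / Real.log N₀ *
          ((2 * (δ : ℝ) - 1) * ReducedReduction.classicalHeight f
            + (δ : ℝ) * Real.log (δ : ℝ)
            + (2 * (δ : ℝ) - 1) / 2 * Real.log ((n + δ).choose δ : ℝ)) := by
  have hD : (Module.finrank ℚ K : ℝ) ≠ 0 := by exact_mod_cast Module.finrank_pos.ne'
  have hlog : Real.log N₀ ≠ 0 := (Real.log_pos (by linarith)).ne'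
  have hbound : (Module.finrank ℚ K : ℝ) / Real.log N₀ *
      ((2 * (δ : ℝ) - 1) * ReducedReduction.classicalHeight f + (δ : ℝ) * Real.log (δ : ℝ)
        + (2 * (δ : ℝ) - 1) / 2 * Real.log ((n + δ).choose δ : ℝ)) =
      ((2 * δ - 1) * (Height.logHeight (fun m : f.support => f.coeff m) +
        2⁻¹ * Module.finrank ℚ K * Real.log ((n + δ).choose n)) +
          δ * (Module.finrank ℚ K * Real.log δ)) / Real.log N₀ := by
    rw [ReducedReduction.classicalHeight, ← Nat.choose_symm_add]
    field_simp
    ring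
  rw [hbound]
  refine ReducedReduction.finite_and_ncard_le (by linarith) (fun P hP => hP.1) fun I hI => ?_
  cases n with
  | zero =>
    have hI' : I = ∅ := Finset.eq_empty_of_forall_notMem fun p hp => by
      obtain ⟨P, hP, -⟩ := hI p hp
      exact hP.2 (ReducedReduction.isReduced_reduction_of_fin_one hf hf0 _)
    have hδ' : (1 : ℝ) ≤ δ := by exact_mod_cast hδ
    have h1 : 0 ≤ Height.logHeight (fun m : f.support => f.coeff m) := Height.logHeight_nonneg _
    have h2 := Real.log_nonneg hδ'
    rw [hI', Finset.sum_empty, Nat.choose_zero_right, Nat.cast_one, Real.log_one, mul_zero,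
      add_zero]
    have h3 := mul_nonneg (by linarith : 0 ≤ 2 * (δ : ℝ) - 1) h1
    positivity
  | succ s =>
    refine (ReducedReduction.sum_log_absNorm_le_of_not_isReduced hf hδ hf0 hX I
      fun p hp => ?_).trans_eq (by norm_num)
    obtain ⟨P, hP, hPp⟩ := hI p hp
    rw [← hPp]
    exact hP.2
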